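/- An instance of the resource-constrained project scheduling problem (RCPSP) consists of a finite set $J$ of jobs, a partial order $\preceq$ on $J$, a finite set $R$ of renewable resources with available amounts $R_\rho\in\mathbb N$ ($\rho\in R$), and, for each job $j\in J$, a processing time $p_j\in\mathbb N$ and amounts $r_{j\rho}\le R_\rho$ ($r_{j\rho}\in\mathbb N$) of the resources $\rho\in R$ that it consumes; here $0\in\mathbb N$. A schedule is a family $(s_j)_{j\in J}$ of starting times $s_j\in\mathbb N$. It is feasible if $s_i+p_i\le s_j$ whenever $i\prec j$, and if, at every real time $t$ and for every resource $\rho$, $\sum_{j\in J:\, s_j\le t<s_j+p_j} r_{j\rho}\le R_\rho$. Its makespan is $\max_{j\in J}(s_j+p_j)$. A feasible schedule is optimal if its makespan is minimum among all feasible schedules. The earliest possible starting time of $j\in J$ is $\sigma_j=0$ if $j$ is $\preceq$-minimal, and inductively $\sigma_j=\max_{i\prec j}(\sigma_i+p_i)$ otherwise. The lag of a feasible schedule is $\max_{j\in J}(s_j-\sigma_j)$. (Maxima over $J=\emptyset$ are $0$.) The width $w$ of $\preceq$ is the size of a largest antichain. The size $n$ of the instance is the length of its encoding, with $\preceq$ written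 as a $0$-$1$ matrix and all numbers written in binary. Theorem. There is an algorithm (a program for a random access machine with addition, truncated subtraction and indirect addressing, under the logarithmic cost criterion) that, given an RCPSP instance and $\lambda\in\mathbb N$, runs in $(2\lambda+1)^w\cdot 2^w\cdot \mathrm{poly}(n)$ time and outputs a feasible schedule of lag at most $\lambda$ whose makespan is minimum among all feasible schedules of lag at most $\lambda$, if a feasible schedule of lag at most $\lambda$ exists, and reports that there is none otherwise. In particular, if some optimal schedule has lag at most $\lambda$, then the output is an optimal schedule of lag at most $\lambda$. The polynomial depends on nothing but the program, and $n$ does not count the encoding of $\lambda$. -/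

import Mathlib

/-! ### Resource-constrained project scheduling -/

/-- An instance of the resource-constrained project scheduling problem. The jobs are
`0, …, numJobs - 1` and the renewable resources are `0, …, numRes - 1`. -/
structure RCPSP where
  numJobs : ℕ
  numRes : ℕ
  /-- the partial order `⪯` on the jobs -/
  le : Fin numJobs → Fin numJobs → Prop
  le_refl : ∀ j, le j j
  le_trans : ∀ i j k, le i j → le j k → le i k
  le_antisymm : ∀ i j, le i j → le j i → i = j
  /-- the available amount of each resource -/
  avail : Fin numRes → ℕ
  /-- the processing time of each job -/
  proc : Fin numJobs → ℕ
  /-- the amount of each resource that each job consumes while it runs -/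
  req : Fin numJobs → Fin numRes → ℕ
  req_le_avail : ∀ j ρ, req j ρ ≤ avail ρ

namespace RCPSP

/-- The strict order `i ≺ j`. -/
def lt (I : RCPSP) (i j : Fin I.numJobs) : Prop := I.le i j ∧ i ≠ j

/-- The strict order on the (finitely many) jobs is well-founded. -/
theorem lt_wf (I : RCPSP) : WellFounded I.lt := by
  have : IsTrans (Fin I.numJobs) I.lt := ⟨fun a b c hab hbc =>
    ⟨I.le_trans a b c hab.1 hbc.1, fun h => hab.2 (I.le_antisymm a b hab.1 (h ▸ hbc.1))⟩⟩
  have : Std.Irrefl I.lt := ⟨fun a h => h.2 rfl⟩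
  exact Finite.wellFounded_of_trans_of_irrefl I.lt

open Classical in
/-- The width of the partial order: the size of a largest antichain. -/
noncomputable def width (I : RCPSP) : ℕ :=
  (Finset.univ.filter fun A : Finset (Fin I.numJobs) =>
    IsAntichain I.le (A : Set (Fin I.numJobs))).sup Finset.card

open Classical in
/-- `earliest I j` is the earliest possible starting time of the job `j`, that is, the maximum of
`earliest I i + proc i` over all `i ≺ j`, and `0` if `j` is minimal. -/
noncomputable def earliest (I : RCPSP) : Fin I.numJobs → ℕ :=
  I.lt_wf.fix fun j rec =>
    (Finset.univ.filter fun i => I.lt i j).attach.sup fun i =>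
      rec i.1 (Finset.mem_filter.mp i.2).2 + I.proc i.1

open Classical in
/-- The recursive equation that characterizes the earliest possible starting times. -/
theorem earliest_eq (I : RCPSP) (j : Fin I.numJobs) :
    I.earliest j =
      (Finset.univ.filter fun i => I.lt i j).sup fun i => I.earliest i + I.proc i := by
  rw [earliest, WellFounded.fix_eq]
  exact Finset.sup_attach (Finset.univ.filter fun i => I.lt i j)
    (fun i => I.earliest i + I.proc i)

open Classical in
/-- The jobs that are running at the real time `t`, i.e. those with `t ∈ [s j, s j + proc j)`. -/
noncomputable def running (I : RCPSP) (s : Fin I.numJobs → ℕ) (t : ℝ) : Finset (Fin I.numJobs) :=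
  Finset.univ.filter fun j => t ∈ Set.Ico (s j : ℝ) ((s j : ℝ) + (I.proc j : ℝ))

/-- Feasible schedules: the precedence constraints hold, and at no time more units of a resource
are used than are available. -/
structure Feasible (I : RCPSP) (s : Fin I.numJobs → ℕ) : Prop where
  precedence : ∀ i j, I.lt i j → s i + I.proc i ≤ s j
  resources : ∀ (t : ℝ) (ρ : Fin I.numRes), ∑ j ∈ I.running s t, I.req j ρ ≤ I.avail ρ

/-- The maximum completion time of a schedule. -/
def makespan (I : RCPSP) (s : Fin I.numJobs → ℕ) : ℕ :=
  Finset.univ.sup fun j => s j + I.proc j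

/-- The lag of a feasible schedule: the maximum difference between the actual and the earliest
possible starting time of a job. (A feasible schedule has `earliest j ≤ s j` for all `j`, so the
subtraction is not truncated.) -/
noncomputable def lag (I : RCPSP) (s : Fin I.numJobs → ℕ) : ℕ :=
  Finset.univ.sup fun j => s j - I.earliest j

/-- Optimal schedules: feasible and of minimum makespan among all feasible schedules. -/
def IsOptimal (I : RCPSP) (s : Fin I.numJobs → ℕ) : Prop :=
  I.Feasible s ∧ ∀ s', I.Feasible s' → I.makespan s ≤ I.makespan s'

/-- Feasible schedules of lag at most `lam` whose makespan is minimum among all feasible schedules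
of lag at most `lam`. -/
def IsOptimalWithLag (I : RCPSP) (lam : ℕ) (s : Fin I.numJobs → ℕ) : Prop :=
  (I.Feasible s ∧ I.lag s ≤ lam) ∧
    ∀ s', I.Feasible s' → I.lag s' ≤ lam → I.makespan s ≤ I.makespan s'

open Classical in
/-- An instance as a sequence of numbers: the number of jobs, the number of resources, the
order as a `0`-`1` matrix, the processing times, the available amounts of the resources, and the
matrix of the amounts that the jobs consume (matrices row by row). -/
noncomputable def encode (I : RCPSP) : List ℕ :=
  [I.numJobs, I.numRes]
    ++ (List.finRange I.numJobs).flatMap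
        (fun i => (List.finRange I.numJobs).map fun j => if I.le i j then 1 else 0)
    ++ (List.finRange I.numJobs).map I.proc
    ++ (List.finRange I.numRes).map I.avail
    ++ (List.finRange I.numJobs).flatMap (fun j => (List.finRange I.numRes).map (I.req j))

/-- The size of an instance: the number of bits of its encoding, all numbers being written in
binary, with one additional symbol per number that marks its end. -/
noncomputable def size (I : RCPSP) : ℕ :=
  (I.encode.map fun a => Nat.size a + 1).sum

end RCPSP

/-! ### Random access machines with logarithmic cost -/

namespace RAM

/-- A state of the machine: the contents of its registers and of its memory cells. A program is
finite and names its registers explicitly, so it uses only finitely many of them; memory cells are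
addressed indirectly, through registers. -/
structure State where
  reg : ℕ → ℕ
  mem : ℕ → ℕ

/-- Programs of the machine. -/
inductive Prog where
  /-- do nothing -/
  | skip : Prog
  /-- `reg x := c` -/
  | const (x c : ℕ) : Prog
  /-- `reg x := reg y + reg z` -/
  | add (x y z : ℕ) : Prog
  /-- `reg x := max (reg y - reg z) 0` -/
  | sub (x y z : ℕ) : Prog
  /-- `reg x := mem (reg y)` -/
  | load (x y : ℕ) : Prog
  /-- `mem (reg x) := reg y` -/
  | store (x y : ℕ) : Prog
  /-- first `p`, then `q` -/
  | seq (p q : Prog) : Prog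
  /-- if `reg x ≠ 0` then `p` else `q` -/
  | ite (x : ℕ) (p q : Prog) : Prog
  /-- while `reg x ≠ 0` do `p` -/
  | loop (x : ℕ) (p : Prog) : Prog

/-- Set a register. -/
def State.setReg (σ : State) (x v : ℕ) : State := { σ with reg := Function.update σ.reg x v }

/-- Set a memory cell. -/
def State.setMem (σ : State) (a v : ℕ) : State := { σ with mem := Function.update σ.mem a v }

/-- `Exec p σ t τ`: started in the state `σ`, the program `p` halts in the state `τ`, at total cost
`t`. Every executed instruction and every executed test costs one plus the bit lengths of the
numbers (constants, operands, addresses) that it handles. -/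
inductive Exec : Prog → State → ℕ → State → Prop where
  | skip (σ : State) : Exec .skip σ 1 σ
  | const (σ : State) (x c : ℕ) : Exec (.const x c) σ (1 + Nat.size c) (σ.setReg x c)
  | add (σ : State) (x y z : ℕ) :
      Exec (.add x y z) σ (1 + Nat.size (σ.reg y) + Nat.size (σ.reg z))
        (σ.setReg x (σ.reg y + σ.reg z))
  | sub (σ : State) (x y z : ℕ) :
      Exec (.sub x y z) σ (1 + Nat.size (σ.reg y) + Nat.size (σ.reg z))
        (σ.setReg x (σ.reg y - σ.reg z))
  | load (σ : State) (x y : ℕ) :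
      Exec (.load x y) σ (1 + Nat.size (σ.reg y) + Nat.size (σ.mem (σ.reg y)))
        (σ.setReg x (σ.mem (σ.reg y)))
  | store (σ : State) (x y : ℕ) :
      Exec (.store x y) σ (1 + Nat.size (σ.reg x) + Nat.size (σ.reg y))
        (σ.setMem (σ.reg x) (σ.reg y))
  | seq {p q : Prog} {σ₀ σ₁ σ₂ : State} {t₁ t₂ : ℕ} (h₁ : Exec p σ₀ t₁ σ₁)
      (h₂ : Exec q σ₁ t₂ σ₂) : Exec (.seq p q) σ₀ (t₁ + t₂) σ₂
  | ite_true {x : ℕ} {p q : Prog} {σ τ : State} {t : ℕ} (hx : σ.reg x ≠ 0)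
      (h : Exec p σ t τ) : Exec (.ite x p q) σ (1 + Nat.size (σ.reg x) + t) τ
  | ite_false {x : ℕ} {p q : Prog} {σ τ : State} {t : ℕ} (hx : σ.reg x = 0)
      (h : Exec q σ t τ) : Exec (.ite x p q) σ (1 + Nat.size (σ.reg x) + t) τ
  | loop_stop {x : ℕ} {p : Prog} {σ : State} (hx : σ.reg x = 0) :
      Exec (.loop x p) σ (1 + Nat.size (σ.reg x)) σ
  | loop_step {x : ℕ} {p : Prog} {σ₀ σ₁ σ₂ : State} {t₁ t₂ : ℕ} (hx : σ₀.reg x ≠ 0)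
      (h₁ : Exec p σ₀ t₁ σ₁) (h₂ : Exec (.loop x p) σ₁ t₂ σ₂) :
      Exec (.loop x p) σ₀ (1 + Nat.size (σ₀.reg x) + t₁ + t₂) σ₂

/-- The initial state on an input: the input numbers are in the memory cells `0, 1, 2, …`; all
other memory cells and all registers contain `0`. -/
def initial (input : List ℕ) : State where
  reg := fun _ => 0
  mem := fun a => input.getD a 0

/-- The output of a computation that is asked for a vector of `m` numbers or the answer that there
is none: `none` if register `0` contains `0`, and otherwise the first `m` memory cells. -/
def State.output (σ : State) (m : ℕ) : Option (Fin m → ℕ) :=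
  if σ.reg 0 = 0 then none else some fun j => σ.mem j

end RAM

/-!
The algorithm searches the partial schedules, breadth first. A *partial schedule* fixes the starting
times of some jobs of positive length. Its *clock* is the latest of these times, and it is extended
by starting one more job, either at the clock time or when a job is completed that runs at the clock
time. These extensions suffice: in every schedule, the jobs can be shifted to the left until each of
them starts at time zero or at the completion of another one, and this neither increases the lag nor
the makespan (`RCPSP.exists_leftShifted`); a schedule of this kind is built by starting its jobs in
the order of their starting times (`RCPSP.reach_of_leftShifted`). Jobs of length zero are added at
the end (`RCPSP.fill`). As a shifted schedule has no starting time beyond the sum of all processing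
times, the bound `lam` on the lag can be capped by this sum.

Only the clock, the set of jobs that have been started, and the starting times of the running jobs
matter for the continuation of a partial schedule (`RCPSP.Equivalent`, `RCPSP.Equivalent.succ`), so
of several equivalent ones a single one enters the queue. Their number is bounded in
`RCPSP.card_le_of_inequivalent`. By Dilworth's theorem (`exists_antichain_chain_cover`), the jobs
are covered by `width` chains. Given the clock time `c`, the state of a chain is described by one of
`2 * lam + 2` numbers. If a job of the chain runs, this is its delay, which is at most `lam` and
which identifies the job, since the jobs of a chain would run one after another if each of them
started as early as possible. If no job of the chain runs, then its completed jobs are determined by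
the earliest possible completion time of the last of them; as jobs that have not been started must
have an earliest possible starting time of at least `c - lam`, the times below `c - lam` need not be
distinguished, and `lam + 1` values remain. The clock time is the starting time of the job that was
started last; it follows from this job and its delay, which is the number that describes the state
of its chain. Hence there are at most `numJobs * (2 * lam + 2) ^ width` entries besides the empty
partial schedule, and `(2 * lam + 2) ^ width ≤ (2 * lam + 1) ^ width * 2 ^ width`.

The machine program is compiled from a language of loop programs with arrays, whose commands have a
functional semantics (`LoopLang.Cmd.compile_runs`). The number of unit steps of a command is bounded
by a polynomial in the bounds of its loops, and a unit step lengthens the largest number on the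
machine by at most one bit (`RAM.Runs`); so polynomially many unit steps have polynomial logarithmic
cost. This applies to the visit of a single entry of the queue (`Solver.body_exec`). After each
visit the registers with intermediate results are cleared, so that the numbers keep polynomial
length during the whole search. The entries that have been seen are marked in an array, indexed by
numbers of polynomial length that encode them up to equivalence (`RCPSP.code`). The bound on the
lag, whose length is not bounded in terms of the size of the instance, is read only once, at a cost
that the factor `(2 * lam + 1) ^ width` pays for.
-/

/-! ### Executions with uniform cost -/

namespace RAM

/-- All numbers that the machine holds have at most `b` bits, except possibly the one in the
memory cell `0`. (That cell initially holds the bound on the lag, which the size of the instance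
does not account for.) -/
def Bdd (b : ℕ) (σ : State) : Prop :=
  (∀ r, σ.reg r < 2 ^ b) ∧ ∀ a, a ≠ 0 → σ.mem a < 2 ^ b

/-- `Runs p σ k τ`: started in `σ`, the program `p` halts in `τ` after at most `k` unit steps. As a
unit step lengthens the largest number by at most one bit, this is expressed by the logarithmic cost
of the execution and the sizes of the numbers in `τ`, in terms of those in `σ`. -/
def Runs (p : Prog) (σ : State) (k : ℕ) (τ : State) : Prop :=
  ∀ b, Bdd b σ → ∃ t, Exec p σ t τ ∧ t ≤ k * (1 + 2 * (b + k)) ∧ Bdd (b + k) τ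

theorem Bdd.mono {b c : ℕ} {σ : State} (h : Bdd b σ) (hbc : b ≤ c) : Bdd c σ :=
  ⟨fun r => (h.1 r).trans_le (Nat.pow_le_pow_right two_pos hbc),
    fun a ha => (h.2 a ha).trans_le (Nat.pow_le_pow_right two_pos hbc)⟩

theorem Bdd.size_reg {b : ℕ} {σ : State} (h : Bdd b σ) (r : ℕ) : Nat.size (σ.reg r) ≤ b :=
  Nat.size_le.2 (h.1 r)

theorem Bdd.size_mem {b : ℕ} {σ : State} (h : Bdd b σ) {a : ℕ} (ha : a ≠ 0) :
    Nat.size (σ.mem a) ≤ b :=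
  Nat.size_le.2 (h.2 a ha)

theorem Bdd.setReg {b : ℕ} {σ : State} (h : Bdd b σ) {x v : ℕ} (hv : v < 2 ^ b) :
    Bdd b (σ.setReg x v) := by
  refine ⟨fun r => ?_, h.2⟩
  by_cases hr : r = x
  · subst hr; simpa [State.setReg] using hv
  · simpa [State.setReg, hr] using h.1 r

theorem Bdd.setMem {b : ℕ} {σ : State} (h : Bdd b σ) {a v : ℕ} (hv : v < 2 ^ b) :
    Bdd b (σ.setMem a v) := by
  refine ⟨h.1, fun r hr0 => ?_⟩
  by_cases hr : r = a
  · subst hr; simpa [State.setMem] using hv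
  · simpa [State.setMem, hr] using h.2 r hr0

theorem Runs.mono {p : Prog} {σ τ : State} {k l : ℕ} (h : Runs p σ k τ) (hkl : k ≤ l) :
    Runs p σ l τ := by
  intro b hb
  obtain ⟨t, h1, h2, h3⟩ := h b hb
  refine ⟨t, h1, h2.trans ?_, h3.mono (by omega)⟩
  gcongr

theorem Runs.skip (σ : State) : Runs .skip σ 1 σ := fun b hb =>
  ⟨1, .skip σ, by omega, hb.mono (by omega)⟩

theorem Runs.const (σ : State) (x c : ℕ) : Runs (.const x c) σ (c + 1) (σ.setReg x c) := by
  intro b hb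
  refine ⟨_, .const σ x c, ?_, (hb.mono (by omega)).setReg ?_⟩
  · have : Nat.size c ≤ c := Nat.size_le.2 Nat.lt_two_pow_self
    nlinarith
  · exact (Nat.lt_two_pow_self (n := c)).trans_le (Nat.pow_le_pow_right two_pos (by omega))

theorem Runs.add (σ : State) (x y z : ℕ) :
    Runs (.add x y z) σ 1 (σ.setReg x (σ.reg y + σ.reg z)) := by
  intro b hb
  refine ⟨_, .add σ x y z, ?_, (hb.mono (by omega)).setReg ?_⟩
  · have := hb.size_reg y; have := hb.size_reg z; omega
  · have := hb.1 y; have := hb.1 z; rw [pow_succ]; omega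

theorem Runs.sub (σ : State) (x y z : ℕ) :
    Runs (.sub x y z) σ 1 (σ.setReg x (σ.reg y - σ.reg z)) := by
  intro b hb
  refine ⟨_, .sub σ x y z, ?_, (hb.mono (by omega)).setReg ?_⟩
  · have := hb.size_reg y; have := hb.size_reg z; omega
  · have := hb.1 y; rw [pow_succ]; omega

theorem Runs.load (σ : State) (x y : ℕ) (hy : σ.reg y ≠ 0) :
    Runs (.load x y) σ 1 (σ.setReg x (σ.mem (σ.reg y))) := by
  intro b hb
  refine ⟨_, .load σ x y, ?_, (hb.mono (by omega)).setReg ?_⟩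
  · have := hb.size_reg y; have := hb.size_mem hy; omega
  · have := hb.2 _ hy; rw [pow_succ]; omega

theorem Runs.store (σ : State) (x y : ℕ) :
    Runs (.store x y) σ 1 (σ.setMem (σ.reg x) (σ.reg y)) := by
  intro b hb
  refine ⟨_, .store σ x y, ?_, (hb.mono (by omega)).setMem ?_⟩
  · have := hb.size_reg x; have := hb.size_reg y; omega
  · have := hb.1 y; rw [pow_succ]; omega

theorem Runs.seq {p q : Prog} {σ₀ σ₁ σ₂ : State} {k l : ℕ} (h₁ : Runs p σ₀ k σ₁)
    (h₂ : Runs q σ₁ l σ₂) : Runs (.seq p q) σ₀ (k + l) σ₂ := by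
  intro b hb
  obtain ⟨t, e, ht, hb'⟩ := h₁ b hb
  obtain ⟨t', e', ht', hb''⟩ := h₂ _ hb'
  refine ⟨_, .seq e e', ?_, hb''.mono (by omega)⟩
  nlinarith [Nat.zero_le (k * l)]

theorem Runs.ite {x : ℕ} {p q : Prog} {σ τ : State} {k : ℕ}
    (h₁ : σ.reg x ≠ 0 → Runs p σ k τ) (h₀ : σ.reg x = 0 → Runs q σ k τ) :
    Runs (.ite x p q) σ (k + 1) τ := by
  intro b hb
  have hs := hb.size_reg x
  by_cases hx : σ.reg x = 0
  · obtain ⟨t, e, ht, hb'⟩ := h₀ hx b hb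
    exact ⟨_, .ite_false hx e, by nlinarith, hb'.mono (by omega)⟩
  · obtain ⟨t, e, ht, hb'⟩ := h₁ hx b hb
    exact ⟨_, .ite_true hx e, by nlinarith, hb'.mono (by omega)⟩

theorem Runs.loop_stop {x : ℕ} {p : Prog} {σ : State} (hx : σ.reg x = 0) :
    Runs (.loop x p) σ 1 σ := fun b hb =>
  ⟨_, Exec.loop_stop hx, by rw [hx, Nat.size_zero]; omega, hb.mono (by omega)⟩

theorem Runs.loop_step {x : ℕ} {p : Prog} {σ₀ σ₁ σ₂ : State} {k l : ℕ} (hx : σ₀.reg x ≠ 0)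
    (h₁ : Runs p σ₀ k σ₁) (h₂ : Runs (.loop x p) σ₁ l σ₂) :
    Runs (.loop x p) σ₀ (k + l + 1) σ₂ := by
  intro b hb
  have hs := hb.size_reg x
  obtain ⟨t, e, ht, hb'⟩ := h₁ b hb
  obtain ⟨t', e', ht', hb''⟩ := h₂ _ hb'
  refine ⟨_, .loop_step hx e e', ?_, hb''.mono (by omega)⟩
  nlinarith [Nat.zero_le (k * l)]

end RAM

/-! ### A language of loop programs with arrays -/

namespace LoopLang

open RAM (State Prog Runs)

/-- The variables of the programs. The first line holds those that keep their meaning throughout the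
search: whether a complete partial schedule has been found, the numbers of jobs and of resources,
the number of bits of a digit in the codes of partial schedules, the sum of the processing times,
the bound on the lag, the positions of the current entry of the queue and of the end of the queue,
the number of entries that have not been treated, the makespan of the best schedule so far, and the
positions of the parts of the input. -/
inductive Var where
  | found | N | R | K | P | lam | head | tail | pending | best | offP | offA | offR
  | clock | span | time | ok | power | gap | acc | code | prod
  | i | j | k | r | c
  deriving DecidableEq

/-- The arrays of the programs: the earliest possible starting times (and finally the resulting
schedule), the partial schedules in the queue, one after another, the marks of the codes that have
been seen, and the best partial schedule so far. -/
inductive Arr where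
  | es | queue | seen | best
  deriving DecidableEq

/-- A state of a loop program: variables, arrays, and the first `base` memory cells of the
machine, which hold the input and receive the output. -/
@[ext]
structure St where
  base : ℕ
  v : Var → ℕ
  a : Arr → ℕ → ℕ
  io : ℕ → ℕ

namespace St

/-- Set a variable. -/
def setv (S : St) (x : Var) (n : ℕ) : St := { S with v := Function.update S.v x n }

/-- Set a cell of an array. -/
def seta (S : St) (k : Arr) (i n : ℕ) : St :=
  { S with a := Function.update S.a k (Function.update (S.a k) i n) }

/-- Set a cell of the input and output area. -/
def setio (S : St) (i n : ℕ) : St := { S with io := Function.update S.io i n }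

@[simp] theorem setv_base (S : St) (x : Var) (n : ℕ) : (S.setv x n).base = S.base := rfl
@[simp] theorem seta_base (S : St) (k : Arr) (i n : ℕ) : (S.seta k i n).base = S.base := rfl
@[simp] theorem setio_base (S : St) (i n : ℕ) : (S.setio i n).base = S.base := rfl
@[simp] theorem setio_a (S : St) (i n : ℕ) : (S.setio i n).a = S.a := rfl
@[simp] theorem setv_a (S : St) (x : Var) (n : ℕ) : (S.setv x n).a = S.a := rfl
@[simp] theorem seta_v (S : St) (k : Arr) (i n : ℕ) : (S.seta k i n).v = S.v := rfl

theorem setv_v (S : St) (x y : Var) (n : ℕ) : (S.setv x n).v y = if y = x then n else S.v y := by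
  simp [setv, Function.update_apply]

theorem seta_a (S : St) (k l : Arr) (i j n : ℕ) :
    (S.seta k i n).a l j = if l = k ∧ j = i then n else S.a l j := by
  by_cases h : l = k
  · subst h; simp [seta, Function.update_apply]
  · simp [seta, h]

theorem setio_io (S : St) (i n j : ℕ) : (S.setio i n).io j = if j = i then n else S.io j := by
  simp [setio, Function.update_apply]

/-- The input number with the given index, not counting the one in the memory cell `0`. -/
def inp (S : St) (i : ℕ) : ℕ := if i + 1 < S.base then S.io (i + 1) else 0

@[simp] theorem setv_inp (S : St) (x : Var) (n i : ℕ) : (S.setv x n).inp i = S.inp i := rfl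

end St

/-- Expressions; their values are natural numbers, and `sub` is truncated subtraction. -/
inductive Expr where
  | lit (c : ℕ)
  | var (x : Var)
  | add (e₁ e₂ : Expr)
  | sub (e₁ e₂ : Expr)
  /-- the cell of the given array with the given index -/
  | get (k : Arr) (e : Expr)
  /-- the input number with the given index -/
  | inp (e : Expr)

/-- Commands. There is no unbounded iteration. -/
inductive Cmd where
  | skip
  | assign (x : Var) (e : Expr)
  | put (k : Arr) (e₁ e₂ : Expr)
  | seq (c₁ c₂ : Cmd)
  | ite (e : Expr) (c₁ c₂ : Cmd)
  /-- run `c` for `x` from the value of the variable `n` minus one down to zero -/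
  | iter (x n : Var) (c : Cmd)
  /-- write a number to the output -/
  | emit (e₁ e₂ : Expr)

namespace Expr

/-- The value of an expression. -/
def eval (S : St) : Expr → ℕ
  | lit c => c
  | var x => S.v x
  | add e₁ e₂ => e₁.eval S + e₂.eval S
  | sub e₁ e₂ => e₁.eval S - e₂.eval S
  | get k e => S.a k (e.eval S)
  | inp e => S.inp (e.eval S)

/-- A bound on the number of unit steps that evaluate the expression. -/
def cost : Expr → ℕ
  | lit c => c + 1
  | var _ => 2
  | add e₁ e₂ => e₁.cost + e₂.cost + 1
  | sub e₁ e₂ => e₁.cost + e₂.cost + 1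
  | get _ e => e.cost + 9
  | inp e => e.cost + 6

end Expr

/-- Repeat `f` with `x` set to `k - 1`, …, `0`. -/
def forEval (f : St → St) (x : Var) : ℕ → St → St
  | 0, S => S
  | k + 1, S => forEval f x k (f (S.setv x k))

namespace Cmd

/-- The effect of a command. It is defined for all states, since the number of iterations of a loop
is fixed when the loop is entered. -/
def eval : Cmd → St → St
  | skip, S => S
  | assign x e, S => S.setv x (e.eval S)
  | put k e₁ e₂, S => S.seta k (e₁.eval S) (e₂.eval S)
  | seq c₁ c₂, S => c₂.eval (c₁.eval S)
  | ite e c₁ c₂, S => if e.eval S ≠ 0 then c₁.eval S else c₂.eval S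
  | .iter x n c, S => forEval c.eval x (S.v n) S
  | emit e₁ e₂, S => if e₁.eval S < S.base then S.setio (e₁.eval S) (e₂.eval S) else S

/-- A bound on the number of unit steps of a command, as a polynomial in a common bound on the
numbers of iterations of all its loops. -/
noncomputable def cost : Cmd → Polynomial ℕ
  | skip => 1
  | assign _ e => (e.cost + 2 : ℕ)
  | put _ e₁ e₂ => (e₁.cost + e₂.cost + 9 : ℕ)
  | seq c₁ c₂ => c₁.cost + c₂.cost
  | ite e c₁ c₂ => (e.cost + 1 : ℕ) + c₁.cost + c₂.cost
  | .iter _ _ c => 3 + Polynomial.X * (c.cost + 7)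
  | emit e₁ e₂ => (e₁.cost + e₂.cost + 4 : ℕ)

/-- All loops are bounded by variables from `X`, and these are never assigned. -/
def BoundedBy (X : List Var) : Cmd → Bool
  | skip => true
  | assign x _ => !X.contains x
  | put _ _ _ => true
  | seq c₁ c₂ => c₁.BoundedBy X && c₂.BoundedBy X
  | ite _ c₁ c₂ => c₁.BoundedBy X && c₂.BoundedBy X
  | .iter x n c => X.contains n && !X.contains x && c.BoundedBy X
  | emit _ _ => true

/-- The variables that a command may change. -/
def vars : Cmd → List Var
  | skip => []
  | assign x _ => [x]
  | put _ _ _ => []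
  | seq c₁ c₂ => c₁.vars ++ c₂.vars
  | ite _ c₁ c₂ => c₁.vars ++ c₂.vars
  | .iter x _ c => x :: c.vars
  | emit _ _ => []

/-- The arrays that a command may change. -/
def arrs : Cmd → List Arr
  | skip => []
  | assign _ _ => []
  | put k _ _ => [k]
  | seq c₁ c₂ => c₁.arrs ++ c₂.arrs
  | ite _ c₁ c₂ => c₁.arrs ++ c₂.arrs
  | .iter _ _ c => c.arrs
  | emit _ _ => []

/-- Whether a command contains an output instruction. -/
def emits : Cmd → Bool
  | skip => false
  | assign _ _ => false
  | put _ _ _ => false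
  | seq c₁ c₂ => c₁.emits || c₂.emits
  | ite _ c₁ c₂ => c₁.emits || c₂.emits
  | .iter _ _ c => c.emits
  | emit _ _ => true

end Cmd

/-- The states `S` and `S'` agree except on the variables `V`, the arrays `A` and, unless `o` is
false, on the output. -/
structure Agree (V : List Var) (A : List Arr) (o : Bool) (S S' : St) : Prop where
  base : S'.base = S.base
  v : ∀ x, x ∉ V → S'.v x = S.v x
  a : ∀ k, k ∉ A → S'.a k = S.a k
  io : o = false → S'.io = S.io

theorem Agree.refl (V : List Var) (A : List Arr) (o : Bool) (S : St) : Agree V A o S S :=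
  ⟨rfl, fun _ _ => rfl, fun _ _ => rfl, fun _ => rfl⟩

theorem Agree.trans {V : List Var} {A : List Arr} {o : Bool} {S S' S'' : St}
    (h : Agree V A o S S') (h' : Agree V A o S' S'') : Agree V A o S S'' :=
  ⟨h'.base.trans h.base, fun x hx => (h'.v x hx).trans (h.v x hx),
    fun k hk => (h'.a k hk).trans (h.a k hk), fun ho => (h'.io ho).trans (h.io ho)⟩

theorem Agree.mono {V V' : List Var} {A A' : List Arr} {o o' : Bool} {S S' : St}
    (h : Agree V A o S S') (hV : V ⊆ V') (hA : A ⊆ A') (ho : o = true → o' = true) :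
    Agree V' A' o' S S' :=
  ⟨h.base, fun x hx => h.v x fun h' => hx (hV h'), fun k hk => h.a k fun h' => hk (hA h'),
    fun h' => h.io (by cases o <;> simp_all)⟩

theorem Agree.setv {V : List Var} {A : List Arr} {o : Bool} {S : St} {x : Var} (n : ℕ)
    (hx : x ∈ V) : Agree V A o S (S.setv x n) :=
  ⟨rfl, fun y hy => by
    rw [St.setv_v, if_neg]; rintro rfl; exact hy hx, fun _ _ => rfl, fun _ => rfl⟩

/-- A command changes nothing but what it assigns. -/
theorem Cmd.agree (c : Cmd) (S : St) : Agree c.vars c.arrs c.emits S (c.eval S) := by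
  induction c generalizing S with
  | skip => exact .refl _ _ _ _
  | assign x e => exact .setv _ (by simp [vars])
  | put k e₁ e₂ =>
    refine ⟨rfl, fun _ _ => rfl, fun l hl => ?_, fun _ => rfl⟩
    funext j
    rw [eval, St.seta_a, if_neg]
    rintro ⟨rfl, -⟩
    simp [arrs] at hl
  | seq c₁ c₂ ih₁ ih₂ =>
    exact ((ih₁ S).mono (by simp [vars]) (by simp [arrs]) (by simp +contextual [emits])).trans
      ((ih₂ _).mono (by simp [vars]) (by simp [arrs]) (by simp +contextual [emits]))
  | ite e c₁ c₂ ih₁ ih₂ =>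
    rw [eval]
    split_ifs
    · exact (ih₁ S).mono (by simp [vars]) (by simp [arrs]) (by simp +contextual [emits])
    · exact (ih₂ S).mono (by simp [vars]) (by simp [arrs]) (by simp +contextual [emits])
  | iter x n c ih =>
    rw [eval]
    generalize S.v n = k
    induction k generalizing S with
    | zero => exact .refl _ _ _ _
    | succ k ihk =>
      refine ((Agree.setv k ?_).trans ((ih _).mono ?_ ?_ ?_)).trans (ihk _)
      all_goals simp [vars, arrs, emits]
  | emit e₁ e₂ =>
    rw [eval]
    split_ifs
    · exact ⟨rfl, fun _ _ => rfl, fun _ _ => rfl, by simp [emits]⟩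
    · exact .refl _ _ _ _

/-- An invariant of a loop: `P k S` when the values `k`, …, `S.v n - 1` have been treated. -/
theorem iter_induction (x n : Var) (c : Cmd) (S : St) (P : ℕ → St → Prop) (h0 : P (S.v n) S)
    (hstep : ∀ k < S.v n, ∀ S', Agree (x :: c.vars) c.arrs c.emits S S' → P (k + 1) S' →
      P k (c.eval (S'.setv x k))) : P 0 ((Cmd.iter x n c).eval S) := by
  rw [Cmd.eval]
  have key : ∀ m ≤ S.v n, ∀ S', Agree (x :: c.vars) c.arrs c.emits S S' → P m S' →
      P 0 (forEval c.eval x m S') := by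
    intro m
    induction m with
    | zero => exact fun _ S' _ h => h
    | succ m ih =>
      intro hm S' hS' h
      refine ih (by omega) _ ?_ (hstep m (by omega) S' hS' h)
      exact (hS'.trans (.setv m (by simp))).trans ((c.agree _).mono (by simp) (by simp) (by simp))
  exact key _ le_rfl S (.refl _ _ _ _) h0

/-! ### Compilation of loop programs -/

/-- The register that holds a variable. -/
def vr (x : Var) : ℕ := 2 * x.ctorIdx

/-- The registers for intermediate results. -/
def tr (d : ℕ) : ℕ := 2 * d + 3

@[simp] theorem vr_inj {x y : Var} : vr x = vr y ↔ x = y := by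
  refine ⟨fun h => ?_, fun h => by rw [h]⟩
  rw [← Var.ofNat_ctorIdx x, ← Var.ofNat_ctorIdx y, show x.ctorIdx = y.ctorIdx by
    unfold vr at h; omega]

@[simp] theorem tr_inj {x y : ℕ} : tr x = tr y ↔ x = y := by unfold tr; omega
@[simp] theorem vr_ne_tr {x : Var} {y : ℕ} : vr x ≠ tr y := by unfold vr tr; omega
@[simp] theorem tr_ne_vr {x : ℕ} {y : Var} : tr x ≠ vr y := by unfold vr tr; omega
@[simp] theorem vr_ne_one {x : Var} : vr x ≠ 1 := by unfold vr; omega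
@[simp] theorem tr_ne_one {x : ℕ} : tr x ≠ 1 := by unfold tr; omega
@[simp] theorem one_ne_vr {x : Var} : 1 ≠ vr x := by unfold vr; omega
@[simp] theorem one_ne_tr {x : ℕ} : 1 ≠ tr x := by unfold tr; omega

theorem Arr.ctorIdx_lt (k : Arr) : k.ctorIdx < 4 := by cases k <;> decide

theorem Arr.ctorIdx_inj {k l : Arr} : k.ctorIdx = l.ctorIdx ↔ k = l :=
  ⟨fun h => by rw [← Arr.ofNat_ctorIdx k, ← Arr.ofNat_ctorIdx l, h], fun h => by rw [h]⟩

/-- The machine state `σ` represents the state `S` of a loop program: the register `1` holds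
`S.base`, and the arrays are interleaved in the cells from `S.base` on. -/
structure Rep (S : St) (σ : State) : Prop where
  pos : 0 < S.base
  base : σ.reg 1 = S.base
  v : ∀ x, σ.reg (vr x) = S.v x
  io : ∀ i < S.base, σ.mem i = S.io i
  a : ∀ (k : Arr) i, σ.mem (S.base + 4 * i + k.ctorIdx) = S.a k i

theorem Rep.setTr {S : St} {σ : State} (h : Rep S σ) (d n : ℕ) : Rep S (σ.setReg (tr d) n) :=
  ⟨h.pos, by simp [State.setReg, h.base], by simp [State.setReg, h.v], h.io, h.a⟩

theorem Rep.setVr {S : St} {σ : State} (h : Rep S σ) (x : Var) (n : ℕ) :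
    Rep (S.setv x n) (σ.setReg (vr x) n) :=
  ⟨h.pos, by simp [State.setReg, h.base], fun y => by
    simp [State.setReg, St.setv_v, Function.update_apply, h.v], h.io, h.a⟩

theorem Rep.setCell {S : St} {σ : State} (h : Rep S σ) (k : Arr) (i n : ℕ) :
    Rep (S.seta k i n) (σ.setMem (S.base + 4 * i + k.ctorIdx) n) := by
  refine ⟨h.pos, h.base, h.v, fun j hj => ?_, fun l j => ?_⟩
  · have hj' : j < S.base := hj
    change Function.update σ.mem _ n j = S.io j
    rw [Function.update_of_ne (by omega)]
    exact h.io j hj'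
  · rw [St.seta_a, ← h.a l j]
    simp only [State.setMem, Function.update_apply, St.seta_base]
    congr 1
    have := k.ctorIdx_lt
    have := l.ctorIdx_lt
    rw [eq_iff_iff, ← Arr.ctorIdx_inj]
    omega

theorem Rep.setIo {S : St} {σ : State} (h : Rep S σ) {i : ℕ} (n : ℕ) (hi : i < S.base) :
    Rep (S.setio i n) (σ.setMem i n) := by
  refine ⟨h.pos, h.base, h.v, fun j hj => ?_, fun l j => ?_⟩
  · simp only [State.setMem, St.setio, Function.update_apply, h.io j hj]
  · rw [State.setMem]
    dsimp only [St.setio_base, St.setio_a]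
    rw [Function.update_of_ne (by omega)]
    exact h.a l j

/-- The registers for intermediate results below `d` are the same in both states. -/
def Keeps (d : ℕ) (σ τ : State) : Prop := ∀ i < d, τ.reg (tr i) = σ.reg (tr i)

theorem Keeps.refl (d : ℕ) (σ : State) : Keeps d σ σ := fun _ _ => rfl

theorem Keeps.trans {d e : ℕ} {σ τ υ : State} (h : Keeps d σ τ) (h' : Keeps e τ υ)
    (hde : d ≤ e) : Keeps d σ υ := fun i hi => (h' i (by omega)).trans (h i hi)

theorem Keeps.setTr {d e n : ℕ} {σ τ : State} (h : Keeps d σ τ) (hde : d ≤ e) :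
    Keeps d σ (τ.setReg (tr e) n) := fun i hi => by
  simp [State.setReg, h i hi, show i ≠ e by omega]

theorem Keeps.setVr {d n : ℕ} {x : Var} {σ τ : State} (h : Keeps d σ τ) :
    Keeps d σ (τ.setReg (vr x) n) := fun i hi => by
  simp [State.setReg, h i hi]

theorem Keeps.setMem {d x n : ℕ} {σ τ : State} (h : Keeps d σ τ) :
    Keeps d σ (τ.setMem x n) := fun i hi => h i hi

@[simp] theorem setReg_reg_self (σ : State) (x n : ℕ) : (σ.setReg x n).reg x = n := by
  simp [State.setReg]

theorem setReg_reg_ne (σ : State) {x y : ℕ} (n : ℕ) (h : y ≠ x) :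
    (σ.setReg x n).reg y = σ.reg y := by
  simp [State.setReg, h]

/-- Turn the index `i` in the register `tr d` into the address of the cell `i` of an array. -/
def addr (k : Arr) (d : ℕ) : Prog :=
  .seq (.add (tr d) (tr d) (tr d)) <| .seq (.add (tr d) (tr d) (tr d)) <|
  .seq (.add (tr d) (tr d) 1) <|
  .seq (.const (tr (d + 1)) k.ctorIdx) (.add (tr d) (tr d) (tr (d + 1)))

theorem addr_runs {S : St} {σ : State} (k : Arr) (d : ℕ) (h : Rep S σ) :
    ∃ τ, Runs (addr k d) σ 8 τ ∧ Rep S τ ∧ τ.reg (tr d) = S.base + 4 * σ.reg (tr d) + k.ctorIdx ∧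
      Keeps d σ τ := by
  refine ⟨_, ((Runs.add _ _ _ _).seq <| (Runs.add _ _ _ _).seq <| (Runs.add _ _ _ _).seq <|
    (Runs.const _ _ _).seq (Runs.add _ _ _ _)).mono ?_, ?_, ?_, ?_⟩
  · have := k.ctorIdx_lt; omega
  · exact ((((h.setTr _ _).setTr _ _).setTr _ _).setTr _ _).setTr _ _
  · simp [State.setReg, h.base]
    ring
  · exact (((((Keeps.refl d σ).setTr le_rfl).setTr le_rfl).setTr le_rfl).setTr
      (by omega)).setTr le_rfl

/-- Evaluate an expression; the result is put into the register `tr d`. -/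
def Expr.compile : Expr → ℕ → Prog
  | lit c, d => .const (tr d) c
  | var x, d => .seq (.const (tr d) 0) (.add (tr d) (vr x) (tr d))
  | add e₁ e₂, d =>
    .seq (e₁.compile d) <| .seq (e₂.compile (d + 1)) (.add (tr d) (tr d) (tr (d + 1)))
  | sub e₁ e₂, d =>
    .seq (e₁.compile d) <| .seq (e₂.compile (d + 1)) (.sub (tr d) (tr d) (tr (d + 1)))
  | get k e, d => .seq (e.compile d) <| .seq (addr k d) (.load (tr d) (tr d))
  | inp e, d =>
    .seq (e.compile d) <| .seq (.const (tr (d + 1)) 1) <|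
    .seq (.add (tr d) (tr d) (tr (d + 1))) <| .seq (.sub (tr (d + 1)) 1 (tr d))
      (.ite (tr (d + 1)) (.load (tr d) (tr d)) (.const (tr d) 0))

/-- The compiled expression is evaluated in the number of unit steps given by `Expr.cost`. -/
theorem Expr.compile_runs (e : Expr) (d : ℕ) {S : St} {σ : State} (h : Rep S σ) :
    ∃ τ, Runs (e.compile d) σ e.cost τ ∧ Rep S τ ∧ τ.reg (tr d) = e.eval S ∧ Keeps d σ τ := by
  induction e generalizing d σ with
  | lit c =>
    exact ⟨_, Runs.const _ _ _, h.setTr _ _, by simp [eval], (Keeps.refl _ _).setTr le_rfl⟩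
  | var x =>
    exact ⟨_, (Runs.const _ _ _).seq (Runs.add _ _ _ _), (h.setTr _ _).setTr _ _,
      by simp [eval, State.setReg, h.v], ((Keeps.refl _ _).setTr le_rfl).setTr le_rfl⟩
  | add e₁ e₂ ih₁ ih₂ =>
    obtain ⟨σ₁, r₁, h₁, v₁, k₁⟩ := ih₁ d h
    obtain ⟨σ₂, r₂, h₂, v₂, k₂⟩ := ih₂ (d + 1) h₁
    exact ⟨_, (r₁.seq (r₂.seq (Runs.add _ _ _ _))).mono (by simp only [cost]; omega),
      h₂.setTr _ _, by simp [eval, v₂, k₂ d (by omega), v₁],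
      (k₁.trans k₂ (by omega)).setTr le_rfl⟩
  | sub e₁ e₂ ih₁ ih₂ =>
    obtain ⟨σ₁, r₁, h₁, v₁, k₁⟩ := ih₁ d h
    obtain ⟨σ₂, r₂, h₂, v₂, k₂⟩ := ih₂ (d + 1) h₁
    exact ⟨_, (r₁.seq (r₂.seq (Runs.sub _ _ _ _))).mono (by simp only [cost]; omega),
      h₂.setTr _ _, by simp [eval, v₂, k₂ d (by omega), v₁],
      (k₁.trans k₂ (by omega)).setTr le_rfl⟩
  | get k e ih =>
    obtain ⟨σ₁, r₁, h₁, v₁, k₁⟩ := ih d h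
    obtain ⟨σ₂, r₂, h₂, v₂, k₂⟩ := addr_runs k d h₁
    refine ⟨_, (r₁.seq (r₂.seq (Runs.load _ _ _ ?_))).mono (by simp only [cost]; omega),
      h₂.setTr _ _, ?_, (k₁.trans k₂ le_rfl).setTr le_rfl⟩
    · have := h.pos; omega
    · rw [setReg_reg_self, v₂, v₁, h₂.a, eval]
  | inp e ih =>
    obtain ⟨σ₁, r₁, h₁, v₁, k₁⟩ := ih d h
    obtain ⟨σ₂, hσ₂⟩ : ∃ σ₂, σ₂ = ((σ₁.setReg (tr (d + 1)) 1).setReg (tr d)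
      (e.eval S + 1)).setReg (tr (d + 1)) (S.base - (e.eval S + 1)) := ⟨_, rfl⟩
    have h₂ : Rep S σ₂ := hσ₂ ▸ ((h₁.setTr _ _).setTr _ _).setTr _ _
    have k₂ : Keeps d σ σ₂ := hσ₂ ▸ ((k₁.setTr (by omega)).setTr le_rfl).setTr (by omega)
    have v₂ : σ₂.reg (tr d) = e.eval S + 1 := by simp [hσ₂, State.setReg]
    have v₂' : σ₂.reg (tr (d + 1)) = S.base - (e.eval S + 1) := by simp [hσ₂, State.setReg]
    have r : ∀ {q k τ}, Runs q σ₂ k τ → Runs (.seq (e.compile d) <|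
        .seq (.const (tr (d + 1)) 1) <| .seq (.add (tr d) (tr d) (tr (d + 1))) <|
        .seq (.sub (tr (d + 1)) 1 (tr d)) q) σ (e.cost + (2 + (1 + (1 + k)))) τ := by
      intro q k τ hq
      refine r₁.seq ((Runs.const _ _ _).seq ((Runs.add _ _ _ _).seq ((Runs.sub _ _ _ _).seq ?_)))
      simpa [setReg_reg_ne, v₁, h₁.base, hσ₂] using hq
    by_cases hb : e.eval S + 1 < S.base
    · refine ⟨_, (r (Runs.ite (k := 1) (fun _ => Runs.load _ _ _ (by omega)) fun h0 => ?_)),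
        h₂.setTr _ _, ?_, k₂.setTr le_rfl⟩
      · omega
      · rw [setReg_reg_self, v₂, h₂.io _ hb, eval, St.inp, if_pos hb]
    · refine ⟨_, (r (Runs.ite (k := 1) (fun h0 => ?_) fun _ => Runs.const _ _ _)),
        h₂.setTr _ _, ?_, k₂.setTr le_rfl⟩
      · omega
      · rw [setReg_reg_self, eval, St.inp, if_neg hb]

/-- The machine program for a command; it changes no register `tr i` with `i < d`. -/
def Cmd.compile : Cmd → ℕ → Prog
  | skip, _ => .skip
  | assign x e, d =>
    .seq (e.compile d) <| .seq (.const (tr (d + 1)) 0) (.add (vr x) (tr d) (tr (d + 1)))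
  | put k e₁ e₂, d =>
    .seq (e₁.compile d) <| .seq (addr k d) <| .seq (e₂.compile (d + 1))
      (.store (tr d) (tr (d + 1)))
  | seq c₁ c₂, d => .seq (c₁.compile d) (c₂.compile d)
  | ite e c₁ c₂, d => .seq (e.compile d) (.ite (tr d) (c₁.compile d) (c₂.compile d))
  | .iter x n c, d =>
    .seq (.const (tr (d + 1)) 0) <| .seq (.add (tr d) (vr n) (tr (d + 1))) <|
    .loop (tr d) <| .seq (.const (tr (d + 1)) 1) <| .seq (.sub (tr d) (tr d) (tr (d + 1))) <|
      .seq (.const (tr (d + 1)) 0) <| .seq (.add (vr x) (tr d) (tr (d + 1))) (c.compile (d + 1))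
  | emit e₁ e₂, d =>
    .seq (e₁.compile d) <| .seq (e₂.compile (d + 1)) <|
    .seq (.sub (tr (d + 2)) 1 (tr d)) (.ite (tr (d + 2)) (.store (tr d) (tr (d + 1))) .skip)

/-- The compiled command transforms a representation of `S` into one of `c.eval S`; if all loop
bounds are at most `m`, this takes `c.cost.eval m` unit steps. -/
theorem Cmd.compile_runs (c : Cmd) (d : ℕ) {X : List Var} {m : ℕ} {S : St} {σ : State}
    (hc : c.BoundedBy X = true) (hX : ∀ x ∈ X, S.v x ≤ m) (h : Rep S σ) :
    ∃ τ, Runs (c.compile d) σ (c.cost.eval m) τ ∧ Rep (c.eval S) τ ∧ Keeps d σ τ ∧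
      ∀ x ∈ X, (c.eval S).v x ≤ m := by
  induction c generalizing d S σ with
  | skip => exact ⟨σ, by simpa [cost, compile] using Runs.skip σ, h, .refl _ _, hX⟩
  | assign x e =>
    obtain ⟨σ₁, r₁, h₁, v₁, k₁⟩ := e.compile_runs d h
    refine ⟨_, (r₁.seq ((Runs.const _ _ _).seq (Runs.add _ _ _ _))).mono ?_, ?_,
      (k₁.setTr (by omega)).setVr, ?_⟩
    · simp [cost]
    · have := (h₁.setTr (d + 1) 0).setVr x (e.eval S)
      simpa [eval, setReg_reg_ne, v₁] using this
    · intro y hy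
      have : y ≠ x := by rintro rfl; simp [BoundedBy, hy] at hc
      simpa [eval, St.setv_v, this] using hX y hy
  | put k e₁ e₂ =>
    obtain ⟨σ₁, r₁, h₁, v₁, k₁⟩ := e₁.compile_runs d h
    obtain ⟨σ₂, r₂, h₂, v₂, k₂⟩ := addr_runs k d h₁
    obtain ⟨σ₃, r₃, h₃, v₃, k₃⟩ := e₂.compile_runs (d + 1) h₂
    refine ⟨_, (r₁.seq (r₂.seq (r₃.seq (Runs.store _ _ _)))).mono ?_, ?_,
      ((k₁.trans k₂ le_rfl).trans k₃ (by omega)).setMem, hX⟩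
    · simp only [cost, Polynomial.eval_natCast]; simp; omega
    · rw [k₃ d (by omega), v₂, v₁, v₃]
      exact h₃.setCell _ _ _
  | seq c₁ c₂ ih₁ ih₂ =>
    simp only [BoundedBy, Bool.and_eq_true] at hc
    obtain ⟨σ₁, r₁, h₁, k₁, X₁⟩ := ih₁ d hc.1 hX h
    obtain ⟨σ₂, r₂, h₂, k₂, X₂⟩ := ih₂ d hc.2 X₁ h₁
    exact ⟨σ₂, by simpa [cost, compile] using r₁.seq r₂, h₂, k₁.trans k₂ le_rfl, X₂⟩
  | ite e c₁ c₂ ih₁ ih₂ =>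
    simp only [BoundedBy, Bool.and_eq_true] at hc
    obtain ⟨σ₁, r₁, h₁, v₁, k₁⟩ := e.compile_runs d h
    rw [eval]
    by_cases he : e.eval S = 0
    · obtain ⟨σ₂, r₂, h₂, k₂, X₂⟩ := ih₂ d hc.2 hX h₁
      rw [if_neg (by simpa using he)]
      refine ⟨σ₂, (r₁.seq (Runs.ite (fun h' => ?_) fun _ => r₂)).mono ?_, h₂,
        k₁.trans k₂ le_rfl, X₂⟩
      · omega
      · simp [cost]; omega
    · obtain ⟨σ₂, r₂, h₂, k₂, X₂⟩ := ih₁ d hc.1 hX h₁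
      rw [if_pos he]
      refine ⟨σ₂, (r₁.seq (Runs.ite (fun _ => r₂) fun h' => ?_)).mono ?_, h₂,
        k₁.trans k₂ le_rfl, X₂⟩
      · omega
      · simp [cost]; omega
  | iter x n c ih =>
    simp only [BoundedBy, Bool.and_eq_true] at hc
    obtain ⟨⟨hn, hx⟩, hc⟩ := hc
    have hn : n ∈ X := by simpa using hn
    have hx : x ∉ X := by simpa using hx
    have key : ∀ i (S : St) (σ : State), (∀ x ∈ X, S.v x ≤ m) → Rep S σ → σ.reg (tr d) = i →
        ∃ τ, Runs (.loop (tr d) <| .seq (.const (tr (d + 1)) 1) <|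
          .seq (.sub (tr d) (tr d) (tr (d + 1))) <| .seq (.const (tr (d + 1)) 0) <|
          .seq (.add (vr x) (tr d) (tr (d + 1))) (c.compile (d + 1))) σ
          (1 + i * (c.cost.eval m + 7)) τ ∧ Rep (forEval c.eval x i S) τ ∧ Keeps d σ τ ∧
          ∀ y ∈ X, (forEval c.eval x i S).v y ≤ m := by
      intro i
      induction i with
      | zero =>
        intro S σ hX h hi
        exact ⟨σ, by simpa using Runs.loop_stop hi, h, .refl _ _, hX⟩
      | succ i ihi =>
        intro S σ hX h hi
        obtain ⟨σ₁, hσ₁⟩ : ∃ σ₁, σ₁ = (((σ.setReg (tr (d + 1)) 1).setReg (tr d) i).setReg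
          (tr (d + 1)) 0).setReg (vr x) i := ⟨_, rfl⟩
        have h₁ : Rep (S.setv x i) σ₁ := hσ₁ ▸ (((h.setTr _ _).setTr _ _).setTr _ _).setVr _ _
        have k₁ : Keeps d σ σ₁ :=
          hσ₁ ▸ ((((Keeps.refl _ _).setTr (by omega)).setTr le_rfl).setTr (by omega)).setVr
        have v₁ : σ₁.reg (tr d) = i := by simp [hσ₁, State.setReg]
        have X₁ : ∀ y ∈ X, (S.setv x i).v y ≤ m := by
          intro y hy
          have : y ≠ x := by rintro rfl; exact hx hy
          simpa [St.setv_v, this] using hX y hy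
        obtain ⟨σ₂, r₂, h₂, k₂, X₂⟩ := ih (d + 1) hc X₁ h₁
        obtain ⟨σ₃, r₃, h₃, k₃, X₃⟩ := ihi _ σ₂ X₂ h₂ ((k₂ d (by omega)).trans v₁)
        refine ⟨σ₃, ?_, h₃, (k₁.trans k₂ (by omega)).trans k₃ le_rfl, X₃⟩
        refine (Runs.loop_step (by omega) (Runs.seq (Runs.const _ _ _) <|
          Runs.seq (Runs.sub _ _ _ _) <| Runs.seq (Runs.const _ _ _) <|
          Runs.seq (Runs.add _ _ _ _) (σ₂ := σ₂) (l := c.cost.eval m) ?_) r₃).mono ?_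
        · simpa [setReg_reg_ne, hi, hσ₁] using r₂
        · ring_nf; omega
    obtain ⟨τ, r, hτ, kτ, Xτ⟩ := key (S.v n) S
      ((σ.setReg (tr (d + 1)) 0).setReg (tr d) (S.v n)) hX ((h.setTr _ _).setTr _ _) (by simp)
    refine ⟨τ, (Runs.seq (Runs.const _ _ _) <| Runs.seq (Runs.add _ _ _ _) (σ₂ := τ)
      (l := 1 + S.v n * (c.cost.eval m + 7)) ?_).mono ?_, hτ, Keeps.trans ?_ kτ le_rfl, Xτ⟩
    · simpa [setReg_reg_ne, h.v] using r
    · have := Nat.mul_le_mul_right (c.cost.eval m + 7) (hX n hn)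
      simp [cost]; omega
    · exact ((Keeps.refl _ _).setTr (by omega)).setTr le_rfl
  | emit e₁ e₂ =>
    obtain ⟨σ₁, r₁, h₁, v₁, k₁⟩ := e₁.compile_runs d h
    obtain ⟨σ₂, r₂, h₂, v₂, k₂⟩ := e₂.compile_runs (d + 1) h₁
    have v₃ : σ₂.reg (tr d) = e₁.eval S := by rw [k₂ d (by omega), v₁]
    have h₃ := h₂.setTr (d + 2) (S.base - e₁.eval S)
    have k₃ : Keeps d σ (σ₂.setReg (tr (d + 2)) (S.base - e₁.eval S)) :=
      (k₁.trans k₂ (by omega)).setTr (by omega)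
    have r : ∀ {q k τ}, Runs q (σ₂.setReg (tr (d + 2)) (S.base - e₁.eval S)) k τ →
        Runs (.seq (e₁.compile d) <| .seq (e₂.compile (d + 1)) <|
          .seq (.sub (tr (d + 2)) 1 (tr d)) q) σ (e₁.cost + (e₂.cost + (1 + k))) τ := by
      intro q k τ hq
      refine r₁.seq (r₂.seq ((Runs.sub _ _ _ _).seq ?_))
      simpa [v₃, h₂.base] using hq
    rw [eval]
    by_cases hb : e₁.eval S < S.base
    · rw [if_pos hb]
      refine ⟨_, (r (Runs.ite (k := 1) (fun _ => Runs.store _ _ _) fun h0 => ?_)).mono ?_,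
        ?_, k₃.setMem, hX⟩
      · rw [setReg_reg_self] at h0; omega
      · simp [cost]; omega
      · have := h₃.setIo (e₂.eval S) hb
        simpa [setReg_reg_ne, v₃, v₂] using this
    · rw [if_neg hb]
      refine ⟨_, (r (Runs.ite (k := 1) (fun h0 => ?_) fun _ => Runs.skip _)).mono ?_,
        h₃, k₃, hX⟩
      · rw [setReg_reg_self] at h0; omega
      · simp [cost]; omega

theorem Agree.inp {V : List Var} {A : List Arr} {S S' : St} (h : Agree V A false S S') (i : ℕ) :
    S'.inp i = S.inp i := by
  rw [St.inp, St.inp, h.base, h.io rfl]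

end LoopLang

/-! ### Partial schedules -/

namespace RCPSP

/-- The latest starting time in a partial schedule. A partial schedule is a function `f` on the
jobs: `f j = 0` if the job `j` has not been started, and `f j = s + 1` if it starts at `s`. -/
def clock (I : RCPSP) (f : Fin I.numJobs → ℕ) : ℕ := Finset.univ.sup fun j => f j - 1

/-- The maximum completion time of a partial schedule. -/
def span (I : RCPSP) (f : Fin I.numJobs → ℕ) : ℕ := Finset.univ.sup fun j => f j - 1 + I.proc j

/-- The times at which the next job may start: the clock and the completion times after it. They
are indexed by the jobs, where the jobs that have not been started stand for the clock. -/
def nextTime (I : RCPSP) (f : Fin I.numJobs → ℕ) (i : Fin I.numJobs) : ℕ :=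
  if f i = 0 then I.clock f else max (I.clock f) (f i - 1 + I.proc i)

/-- The job `j` can be started next, at the time `t`, without violating a constraint at that time
and without making a lag greater than `lam` inevitable. -/
structure Admissible (I : RCPSP) (lam : ℕ) (f : Fin I.numJobs → ℕ) (j : Fin I.numJobs) (t : ℕ) :
    Prop where
  pos : 0 < I.proc j
  unstarted : f j = 0
  prec : ∀ i, I.lt i j → 0 < I.proc i → f i ≠ 0 ∧ f i - 1 + I.proc i ≤ t
  deadline : ∀ k, 0 < I.proc k → f k = 0 → t ≤ I.earliest k + lam
  res : ∀ ρ, ∑ k, (if Function.update f j (t + 1) k ≠ 0 ∧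
    t < Function.update f j (t + 1) k - 1 + I.proc k then I.req k ρ else 0) ≤ I.avail ρ

/-- The partial schedule `f'` arises from `f` by starting one more job. -/
def Succ (I : RCPSP) (lam : ℕ) (f f' : Fin I.numJobs → ℕ) : Prop :=
  ∃ j i, I.Admissible lam f j (I.nextTime f i) ∧ f' = Function.update f j (I.nextTime f i + 1)

/-- All jobs of positive length have been started. -/
def Complete (I : RCPSP) (f : Fin I.numJobs → ℕ) : Prop := ∀ j, 0 < I.proc j → f j ≠ 0

/-- Partial schedules that satisfy all constraints, as far as the jobs of positive length are
concerned; the other ones are not started at all. -/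
structure Valid (I : RCPSP) (lam : ℕ) (f : Fin I.numJobs → ℕ) : Prop where
  zero : ∀ j, I.proc j = 0 → f j = 0
  prec : ∀ i j, I.lt i j → 0 < I.proc i → f j ≠ 0 → f i ≠ 0 ∧ f i - 1 + I.proc i ≤ f j - 1
  lag : ∀ j, f j ≠ 0 → f j - 1 ≤ I.earliest j + lam
  deadline : ∀ k, 0 < I.proc k → f k = 0 → I.clock f ≤ I.earliest k + lam
  res : ∀ t ρ, ∑ k, (if f k ≠ 0 ∧ f k - 1 ≤ t ∧ t < f k - 1 + I.proc k then I.req k ρ else 0)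
    ≤ I.avail ρ

theorem le_clock (I : RCPSP) (f : Fin I.numJobs → ℕ) (j : Fin I.numJobs) :
    f j - 1 ≤ I.clock f :=
  Finset.le_sup (f := fun j => f j - 1) (Finset.mem_univ j)

theorem clock_le_nextTime (I : RCPSP) (f : Fin I.numJobs → ℕ) (i : Fin I.numJobs) :
    I.clock f ≤ I.nextTime f i := by
  unfold nextTime; split_ifs <;> simp

theorem le_span (I : RCPSP) (f : Fin I.numJobs → ℕ) (j : Fin I.numJobs) :
    f j - 1 + I.proc j ≤ I.span f :=
  Finset.le_sup (f := fun j => f j - 1 + I.proc j) (Finset.mem_univ j)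

theorem clock_le_span (I : RCPSP) (f : Fin I.numJobs → ℕ) : I.clock f ≤ I.span f :=
  Finset.sup_mono_fun fun _ _ => Nat.le_add_right _ _

theorem clock_update (I : RCPSP) {f : Fin I.numJobs → ℕ} {j : Fin I.numJobs} {t : ℕ}
    (hj : f j = 0) (ht : I.clock f ≤ t) : I.clock (Function.update f j (t + 1)) = t := by
  apply _root_.le_antisymm
  · refine Finset.sup_le fun k _ => ?_
    by_cases hk : k = j
    · subst hk; simp
    · rw [Function.update_of_ne hk]; exact (I.le_clock f k).trans ht
  · have := I.le_clock (Function.update f j (t + 1)) j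
    simpa using this

theorem earliest_le_of_lt (I : RCPSP) {i j : Fin I.numJobs} (h : I.lt i j) :
    I.earliest i + I.proc i ≤ I.earliest j := by
  rw [I.earliest_eq j]
  exact Finset.le_sup (f := fun i => I.earliest i + I.proc i) (by simpa using h)

theorem lt_trans' (I : RCPSP) {i j k : Fin I.numJobs} (h : I.lt i j) (h' : I.lt j k) :
    I.lt i k :=
  ⟨I.le_trans _ _ _ h.1 h'.1, fun e => h.2 (I.le_antisymm _ _ h.1 (e ▸ h'.1))⟩

theorem earliest_le (I : RCPSP) {i : Fin I.numJobs} {b : ℕ}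
    (h : ∀ k, I.lt k i → I.earliest k + I.proc k ≤ b) : I.earliest i ≤ b := by
  rw [I.earliest_eq]
  exact Finset.sup_le fun k hk => h k (by simpa using hk)

/-- If the precedence constraints hold between jobs of positive length, then no job of positive
length starts before its earliest possible starting time. -/
theorem earliest_le_start (I : RCPSP) (D : Fin I.numJobs → Prop) (s : Fin I.numJobs → ℕ)
    (h : ∀ i j, I.lt i j → 0 < I.proc i → D j → D i ∧ s i + I.proc i ≤ s j) (j : Fin I.numJobs)
    (hj : D j) : I.earliest j ≤ s j := by
  suffices ∀ i j, (i = j ∨ I.lt i j) → D j → I.earliest i ≤ s j from this j j (.inl rfl) hj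
  intro i
  induction i using I.lt_wf.induction with
  | _ i ih =>
    intro j hij hj
    refine I.earliest_le fun k hk => ?_
    have hkj : I.lt k j := by
      rcases hij with rfl | hij
      · exact hk
      · exact I.lt_trans' hk hij
    rcases Nat.eq_zero_or_pos (I.proc k) with h0 | h0
    · rw [h0]; exact ih k hk j (.inr hkj) hj
    · have h1 := h k j hkj h0 hj
      have := ih k hk k (.inl rfl) h1.1
      omega

/-- In a valid partial schedule, the delay of a job is not truncated. -/
theorem Valid.earliest_le {I : RCPSP} {lam : ℕ} {f : Fin I.numJobs → ℕ} (h : I.Valid lam f)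
    {j : Fin I.numJobs} (hj : f j ≠ 0) : I.earliest j ≤ f j - 1 :=
  I.earliest_le_start (fun j => f j ≠ 0) (fun j => f j - 1) h.prec j hj

theorem earliest_le_sum (I : RCPSP) (j : Fin I.numJobs) : I.earliest j ≤ ∑ i, I.proc i := by
  classical
  suffices I.earliest j ≤ ∑ i with I.lt i j, I.proc i from
    this.trans (Finset.sum_le_sum_of_subset (Finset.filter_subset _ _))
  induction j using I.lt_wf.induction with
  | _ j ih =>
    refine I.earliest_le fun k hk => ?_
    have hk' : k ∉ Finset.univ.filter fun i => I.lt i k := by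
        simpa using fun h : I.lt k k => h.2 rfl
    calc I.earliest k + I.proc k
        ≤ ∑ i ∈ insert k (Finset.univ.filter fun i => I.lt i k), I.proc i := by
          rw [Finset.sum_insert hk', add_comm]
          exact Nat.add_le_add_left (ih k hk) _
      _ ≤ _ := Finset.sum_le_sum_of_subset fun i hi => by
          rcases Finset.mem_insert.1 hi with rfl | hi
          · simpa using hk
          · simpa using I.lt_trans' (by simpa using hi) hk

theorem valid_zero (I : RCPSP) (lam : ℕ) : I.Valid lam 0 := by
  refine ⟨fun _ _ => rfl, ?_, ?_, ?_, ?_⟩ <;> simp [clock]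

/-- Starting one more job preserves validity, since all other jobs start no later. -/
theorem Valid.succ {I : RCPSP} {lam : ℕ} {f f' : Fin I.numJobs → ℕ} (h : I.Valid lam f)
    (hs : I.Succ lam f f') : I.Valid lam f' := by
  obtain ⟨j, i, ha, rfl⟩ := hs
  obtain ⟨t, ht⟩ : ∃ t, t = I.nextTime f i := ⟨_, rfl⟩
  have hct : I.clock f ≤ t := ht ▸ I.clock_le_nextTime f i
  rw [← ht] at ha ⊢
  refine ⟨fun k hk => ?_, fun k l hkl hk hl => ?_, fun k hk => ?_, fun k hk hk0 => ?_,
    fun u ρ => ?_⟩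
  · have : k ≠ j := by rintro rfl; exact ha.pos.ne' hk
    rw [Function.update_of_ne this, h.zero k hk]
  · by_cases hlj : l = j
    · subst hlj
      rw [Function.update_of_ne hkl.2]
      simpa using ha.prec k hkl hk
    · rw [Function.update_of_ne hlj] at hl ⊢
      have h1 := h.prec k l hkl hk hl
      have : k ≠ j := by rintro rfl; exact h1.1 ha.unstarted
      rw [Function.update_of_ne this]
      exact h1
  · by_cases hkj : k = j
    · subst hkj; simpa using ha.deadline k ha.pos ha.unstarted
    · rw [Function.update_of_ne hkj] at hk ⊢
      exact h.lag k hk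
  · have : k ≠ j := by rintro rfl; simp at hk0
    rw [Function.update_of_ne this] at hk0
    rw [I.clock_update ha.unstarted hct]
    exact ha.deadline k hk hk0
  · by_cases hut : u < t
    -- before the time `t` the new job does not run
    · refine (Finset.sum_le_sum fun k _ => ?_).trans (h.res u ρ)
      by_cases hkj : k = j
      · subst hkj
        rw [Function.update_self, Nat.add_sub_cancel, if_neg (by omega)]
        exact Nat.zero_le _
      · rw [Function.update_of_ne hkj]
    -- all jobs start by the time `t`, so those that run later run at `t`, too
    · refine (Finset.sum_le_sum fun k _ => ?_).trans (ha.res ρ)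
      split_ifs with h1 h2
      · exact le_rfl
      · exact absurd ⟨h1.1, by omega⟩ h2
      · exact Nat.zero_le _
      · exact le_rfl

theorem valid_of_reach {I : RCPSP} {lam : ℕ} {f : Fin I.numJobs → ℕ}
    (h : Relation.ReflTransGen (I.Succ lam) 0 f) : I.Valid lam f := by
  induction h with
  | refl => exact I.valid_zero lam
  | tail _ hs ih => exact ih.succ hs

/-! ### Schedules from complete partial schedules -/

open Classical in
/-- Add the jobs of length zero to a complete partial schedule, each as early as possible. -/
noncomputable def fill (I : RCPSP) (f : Fin I.numJobs → ℕ) (j : Fin I.numJobs) : ℕ :=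
  if I.proc j = 0 then (Finset.univ.filter fun i => I.lt i j).sup fun i => f i - 1 + I.proc i
  else f j - 1

theorem fill_of_pos (I : RCPSP) (f : Fin I.numJobs → ℕ) {j : Fin I.numJobs} (hj : 0 < I.proc j) :
    I.fill f j = f j - 1 := if_neg hj.ne'

theorem fill_le (I : RCPSP) (f : Fin I.numJobs → ℕ) {j : Fin I.numJobs} (hj : I.proc j = 0)
    {b : ℕ} (h : ∀ i, I.lt i j → f i - 1 + I.proc i ≤ b) : I.fill f j ≤ b := by
  rw [fill, if_pos hj]
  exact Finset.sup_le fun i hi => h i (by simpa using hi)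

theorem le_fill (I : RCPSP) (f : Fin I.numJobs → ℕ) {i j : Fin I.numJobs} (hj : I.proc j = 0)
    (h : I.lt i j) : f i - 1 + I.proc i ≤ I.fill f j := by
  rw [fill, if_pos hj]
  exact Finset.le_sup (f := fun i => f i - 1 + I.proc i) (by simpa using h)

/-- At integral times the jobs that run determine those that run until the next integral time. -/
theorem feasible_iff (I : RCPSP) (s : Fin I.numJobs → ℕ) :
    I.Feasible s ↔ (∀ i j, I.lt i j → s i + I.proc i ≤ s j) ∧ ∀ (t : ℕ) ρ,
      ∑ k, (if s k ≤ t ∧ t < s k + I.proc k then I.req k ρ else 0) ≤ I.avail ρ := by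
  have key : ∀ (t : ℕ) ρ, ∑ k, (if s k ≤ t ∧ t < s k + I.proc k then I.req k ρ else 0) =
      ∑ k ∈ I.running s t, I.req k ρ := by
    intro t ρ
    rw [running, Finset.sum_filter]
    refine Finset.sum_congr rfl fun k _ => ?_
    congr 1
    rw [Set.mem_Ico, eq_iff_iff]
    norm_cast
  constructor
  · exact fun h => ⟨h.precedence, fun t ρ => (key t ρ).trans_le (h.resources t ρ)⟩
  · refine fun h => ⟨h.1, fun t ρ => ?_⟩
    rcases lt_or_ge t 0 with ht | ht
    · rw [running, Finset.filter_false_of_mem, Finset.sum_empty]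
      · exact Nat.zero_le _
      · intro k _ hk
        have : (0 : ℝ) ≤ s k := Nat.cast_nonneg _
        linarith [hk.1]
    · refine _root_.le_trans (le_of_eq ?_) (h.2 ⌊t⌋₊ ρ)
      rw [key]
      congr 1
      rw [running, running]
      refine Finset.filter_congr fun k _ => ?_
      rw [Set.mem_Ico, Set.mem_Ico]
      norm_cast
      rw [Nat.le_floor_iff ht, Nat.floor_lt ht]

theorem fill_feasible {I : RCPSP} {lam : ℕ} {f : Fin I.numJobs → ℕ} (h : I.Valid lam f)
    (hc : I.Complete f) : I.Feasible (I.fill f) := by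
  refine (I.feasible_iff _).2 ⟨fun i j hij => ?_, fun t ρ => ?_⟩
  · rcases Nat.eq_zero_or_pos (I.proc i) with hi | hi
    · rw [hi, add_zero]
      refine I.fill_le f hi fun k hk => ?_
      have hkj := I.lt_trans' hk hij
      rcases Nat.eq_zero_or_pos (I.proc j) with hj | hj
      · exact I.le_fill f hj hkj
      · rw [I.fill_of_pos f hj]
        rcases Nat.eq_zero_or_pos (I.proc k) with h0 | h0
        · simp [h.zero k h0, h0]
        · exact (h.prec k j hkj h0 (hc j hj)).2
    · rw [I.fill_of_pos f hi]
      rcases Nat.eq_zero_or_pos (I.proc j) with hj | hj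
      · exact I.le_fill f hj hij
      · rw [I.fill_of_pos f hj]
        exact (h.prec i j hij hi (hc j hj)).2
  · refine (Finset.sum_le_sum fun k _ => ?_).trans (h.res t ρ)
    rcases Nat.eq_zero_or_pos (I.proc k) with hk | hk
    · rw [if_neg (by omega)]; exact Nat.zero_le _
    · rw [I.fill_of_pos f hk]
      simp [hc k hk]

theorem lag_fill {I : RCPSP} {lam : ℕ} {f : Fin I.numJobs → ℕ} (h : I.Valid lam f)
    (hc : I.Complete f) : I.lag (I.fill f) ≤ lam := by
  refine Finset.sup_le fun j _ => Nat.sub_le_iff_le_add'.2 ?_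
  rcases Nat.eq_zero_or_pos (I.proc j) with hj | hj
  · refine I.fill_le f hj fun k hk => ?_
    rcases Nat.eq_zero_or_pos (I.proc k) with h0 | h0
    · simp [h.zero k h0, h0]
    · have := h.lag k (hc k h0)
      have := I.earliest_le_of_lt hk
      omega
  · rw [I.fill_of_pos f hj]
    exact h.lag j (hc j hj)

theorem makespan_fill {I : RCPSP} {lam : ℕ} {f : Fin I.numJobs → ℕ} (h : I.Valid lam f) :
    I.makespan (I.fill f) = I.span f := by
  apply _root_.le_antisymm
  · refine Finset.sup_le fun j _ => ?_
    rcases Nat.eq_zero_or_pos (I.proc j) with hj | hj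
    · rw [hj, add_zero]
      exact I.fill_le f hj fun k _ => I.le_span f k
    · rw [I.fill_of_pos f hj]; exact I.le_span f j
  · refine Finset.sup_le fun j _ => ?_
    rcases Nat.eq_zero_or_pos (I.proc j) with hj | hj
    · simp [h.zero j hj, hj]
    · refine _root_.le_trans ?_
        (Finset.le_sup (f := fun j => I.fill f j + I.proc j) (Finset.mem_univ j))
      simp [I.fill_of_pos f hj]

/-! ### Left-shifted schedules -/

/-- The constraints on the starting times of the jobs of positive length, including the bound on
the lag. -/
structure PosFeasible (I : RCPSP) (lam : ℕ) (s : Fin I.numJobs → ℕ) : Prop where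
  prec : ∀ i j, 0 < I.proc i → 0 < I.proc j → I.lt i j → s i + I.proc i ≤ s j
  res : ∀ (t : ℕ) ρ, ∑ k, (if s k ≤ t ∧ t < s k + I.proc k then I.req k ρ else 0) ≤ I.avail ρ
  lag : ∀ j, 0 < I.proc j → s j ≤ I.earliest j + lam

/-- Every job of positive length starts at time zero or when another one is completed. -/
def LeftShifted (I : RCPSP) (s : Fin I.numJobs → ℕ) : Prop :=
  ∀ j, 0 < I.proc j → s j = 0 ∨ ∃ i, 0 < I.proc i ∧ s i + I.proc i = s j

/-- A job that starts neither at time zero nor at the completion of another one may start one unit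
of time earlier. Repeating this leads to a left-shifted schedule. -/
theorem exists_leftShifted (I : RCPSP) (lam : ℕ) (s : Fin I.numJobs → ℕ)
    (h : I.PosFeasible lam s) :
    ∃ s', I.PosFeasible lam s' ∧ I.LeftShifted s' ∧ ∀ j, s' j ≤ s j := by
  induction hn : ∑ j, s j using Nat.strong_induction_on generalizing s with
  | _ n ih =>
    by_cases hl : I.LeftShifted s
    · exact ⟨s, h, hl, fun _ => le_rfl⟩
    · simp only [LeftShifted, not_forall, not_or, not_exists, not_and] at hl
      obtain ⟨j, hj, hj0, hjn⟩ := hl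
      have hle : ∀ k, Function.update s j (s j - 1) k ≤ s k := by
        intro k
        by_cases hk : k = j
        · subst hk; simp
        · rw [Function.update_of_ne hk]
      have hsum : ∑ k, Function.update s j (s j - 1) k < n := by
        rw [← hn]
        exact Finset.sum_lt_sum (fun k _ => hle k) ⟨j, Finset.mem_univ j, by simp; omega⟩
      suffices hp : I.PosFeasible lam (Function.update s j (s j - 1)) by
        obtain ⟨s', h1, h2, h3⟩ := ih _ hsum _ hp rfl
        exact ⟨s', h1, h2, fun k => (h3 k).trans (hle k)⟩
      refine ⟨?_, ?_, ?_⟩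
      · intro i k hi hk hik
        have h1 := h.prec i k hi hk hik
        by_cases hkj : k = j
        · subst hkj
          have := hjn i hi
          rw [Function.update_self, Function.update_of_ne hik.2]
          omega
        · rw [Function.update_of_ne hkj]
          have := hle i
          omega
      · intro t ρ
        by_cases ht : t = s j - 1
        -- no job is completed at `s j`, so every job that runs at `s j - 1` runs at `s j`
        · refine (Finset.sum_le_sum fun k _ => ?_).trans (h.res (s j) ρ)
          by_cases hk : k = j
          · subst hk
            rw [if_pos (c := s k ≤ s k ∧ _) (by omega)]
            split_ifs <;> simp
          · rw [Function.update_of_ne hk]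
            split_ifs with h1 h2
            · exact le_rfl
            · exact absurd ⟨by omega, by have := hjn k (by omega); omega⟩ h2
            · exact Nat.zero_le _
            · exact le_rfl
        · refine (Finset.sum_le_sum fun k _ => ?_).trans (h.res t ρ)
          by_cases hk : k = j
          · subst hk
            rw [Function.update_self]
            split_ifs with h1 h2
            · exact le_rfl
            · exact absurd ⟨by omega, by omega⟩ h2
            · exact Nat.zero_le _
            · exact le_rfl
          · rw [Function.update_of_ne hk]
      · exact fun k hk => (hle k).trans (h.lag k hk)

/-- In a left-shifted schedule, the starting time of a job is the sum of the lengths of some other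
jobs, which start at different times. -/
theorem LeftShifted.le_sum {I : RCPSP} {s : Fin I.numJobs → ℕ} (h : I.LeftShifted s)
    (j : Fin I.numJobs) (hj : 0 < I.proc j) : s j ≤ ∑ i, I.proc i := by
  suffices s j ≤ ∑ i with s i < s j, I.proc i from
    this.trans (Finset.sum_le_sum_of_subset (Finset.filter_subset _ _))
  induction hn : s j using Nat.strong_induction_on generalizing j with
  | _ n ih =>
    rcases h j hj with h0 | ⟨i, hi, hij⟩
    · omega
    · have h1 := ih (s i) (by omega) i hi rfl
      have hi' : i ∉ Finset.univ.filter fun k => s k < s i := by simp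
      calc n = I.proc i + s i := by omega
        _ ≤ ∑ k ∈ insert i (Finset.univ.filter fun k => s k < s i), I.proc k := by
          rw [Finset.sum_insert hi']; omega
        _ ≤ _ := Finset.sum_le_sum_of_subset fun k hk => by
          simp only [Finset.mem_insert, Finset.mem_filter, Finset.mem_univ, true_and] at hk ⊢
          rcases hk with rfl | hk <;> omega

/-- Every left-shifted schedule can be built by starting its jobs one by one, in the order of their
starting times. -/
theorem reach_of_leftShifted {I : RCPSP} {lam : ℕ} {s : Fin I.numJobs → ℕ}
    (h : I.PosFeasible lam s) (hl : I.LeftShifted s) :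
    ∃ f, Relation.ReflTransGen (I.Succ lam) 0 f ∧ I.Complete f ∧ ∀ j, f j ≠ 0 → f j = s j + 1 := by
  classical
  have key : ∀ n, ∃ f, Relation.ReflTransGen (I.Succ lam) 0 f ∧
      (∀ j, f j ≠ 0 → f j = s j + 1 ∧ 0 < I.proc j) ∧
      (∀ i j, f i ≠ 0 → f j = 0 → 0 < I.proc j → s i ≤ s j) ∧
      (I.Complete f ∨ (Finset.univ.filter fun j => f j ≠ 0).card = n) := by
    intro n
    induction n with
    | zero => exact ⟨0, .refl, by simp, by simp, .inr (by simp)⟩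
    | succ n ih =>
      obtain ⟨f, hf, h1, h2, h3⟩ := ih
      by_cases hc : I.Complete f
      · exact ⟨f, hf, h1, h2, .inl hc⟩
      have h3 := h3.resolve_left hc
      obtain ⟨b, hb, hmin⟩ := Finset.exists_min_image
        (Finset.univ.filter fun j => 0 < I.proc j ∧ f j = 0) s (by
          simp only [Complete, not_forall, not_not] at hc
          obtain ⟨j, hj, hj'⟩ := hc
          exact ⟨j, by simp [hj, hj']⟩)
      simp only [Finset.mem_filter, Finset.mem_univ, true_and] at hb hmin
      have hstarted : ∀ i, 0 < I.proc i → s i < s b → f i ≠ 0 := fun i hi his h0 => by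
        have := hmin i ⟨hi, h0⟩; omega
      have hclock : I.clock f ≤ s b := Finset.sup_le fun j _ => by
        by_cases hj : f j = 0
        · simp [hj]
        · have := (h1 j hj).1; have := h2 j b hj hb.2 hb.1; omega
      obtain ⟨i, hi⟩ : ∃ i, I.nextTime f i = s b := by
        rcases hl b hb.1 with h0 | ⟨i, hi, hib⟩
        · exact ⟨b, by rw [nextTime, if_pos hb.2]; omega⟩
        · have h4 := hstarted i hi (by omega)
          have h5 := (h1 i h4).1
          refine ⟨i, ?_⟩
          rw [nextTime, if_neg h4, h5, Nat.add_sub_cancel, hib]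
          exact max_eq_right hclock
      have hadm : I.Admissible lam f b (s b) := by
        refine ⟨hb.1, hb.2, fun k hk hk0 => ?_, fun k hk hk0 => ?_, fun ρ => ?_⟩
        · have h4 := h.prec k b hk0 hb.1 hk
          have h5 := hstarted k hk0 (by omega)
          have := (h1 k h5).1
          exact ⟨h5, by omega⟩
        · exact (hmin k ⟨hk, hk0⟩).trans (h.lag k hk)
        · refine (Finset.sum_le_sum fun k _ => ?_).trans (h.res (s b) ρ)
          by_cases hkb : k = b
          · subst hkb
            simp
          · rw [Function.update_of_ne hkb]
            split_ifs with h4 h5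
            · exact le_rfl
            · have := (h1 k h4.1).1
              have := h2 k b h4.1 hb.2 hb.1
              exact absurd ⟨by omega, by omega⟩ h5
            · exact Nat.zero_le _
            · exact le_rfl
      refine ⟨Function.update f b (s b + 1), hf.tail ⟨b, i, by rwa [hi], by rw [hi]⟩,
        fun j hj => ?_, fun j k hj hk hk0 => ?_, .inr ?_⟩
      · by_cases hjb : j = b
        · subst hjb; simp [hb.1]
        · rw [Function.update_of_ne hjb] at hj ⊢; exact h1 j hj
      · have hkb : k ≠ b := by rintro rfl; simp at hk
        rw [Function.update_of_ne hkb] at hk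
        by_cases hjb : j = b
        · subst hjb; exact hmin k ⟨hk0, hk⟩
        · rw [Function.update_of_ne hjb] at hj; exact h2 j k hj hk hk0
      · have : (Finset.univ.filter fun j => Function.update f b (s b + 1) j ≠ 0) =
            insert b (Finset.univ.filter fun j => f j ≠ 0) := by
          ext j
          by_cases hjb : j = b
          · subst hjb; simp
          · simp [hjb]
        rw [this, Finset.card_insert_of_notMem (by simp [hb.2]), h3]
  obtain ⟨f, hf, h1, -, h3⟩ := key (I.numJobs + 1)
  refine ⟨f, hf, h3.resolve_right fun hcard => ?_, fun j hj => (h1 j hj).1⟩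
  have := Finset.card_le_univ (Finset.univ.filter fun j => f j ≠ 0)
  rw [hcard, Fintype.card_fin] at this
  omega

/-- The search space is complete: for every feasible schedule of lag at most `lam`, a complete
partial schedule that ends no later can be reached, even if `lam` is capped. -/
theorem exists_reach_of_feasible {I : RCPSP} {lam : ℕ} {s : Fin I.numJobs → ℕ} (h : I.Feasible s)
    (hlag : I.lag s ≤ lam) :
    ∃ f, Relation.ReflTransGen (I.Succ (min lam (∑ i, I.proc i))) 0 f ∧ I.Complete f ∧
      I.span f ≤ I.makespan s := by
  have h' := (I.feasible_iff s).1 h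
  obtain ⟨s', h1, h2, h3⟩ :=
    I.exists_leftShifted lam s ⟨fun i j _ _ => h'.1 i j, h'.2, fun j _ => by
    have : s j - I.earliest j ≤ I.lag s :=
      Finset.le_sup (f := fun j => s j - I.earliest j) (Finset.mem_univ j)
    omega⟩
  have h4 : I.PosFeasible (min lam (∑ i, I.proc i)) s' := ⟨h1.prec, h1.res, fun j hj => by
    have := h2.le_sum j hj
    have := h1.lag j hj
    omega⟩
  obtain ⟨f, hf, hc, hfs⟩ := reach_of_leftShifted h4 h2
  refine ⟨f, hf, hc, Finset.sup_le fun j _ => ?_⟩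
  refine _root_.le_trans ?_ (Finset.le_sup (f := fun j => s j + I.proc j) (Finset.mem_univ j))
  have := h3 j
  by_cases hj : f j = 0
  · omega
  · have := hfs j hj; omega

/-! ### Equivalent partial schedules -/

/-- What matters for the continuation of a partial schedule: whether a job has not been started
(`0`), is completed at the clock time (`1`), or runs, in which case its starting time counts. -/
def digit (I : RCPSP) (f : Fin I.numJobs → ℕ) (k : Fin I.numJobs) : ℕ :=
  if f k = 0 then 0 else if f k - 1 + I.proc k ≤ I.clock f then 1 else f k + 1

/-- Partial schedules that can be continued in the same way. -/
def Equivalent (I : RCPSP) (f g : Fin I.numJobs → ℕ) : Prop :=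
  I.clock f = I.clock g ∧ ∀ k, I.digit f k = I.digit g k

theorem Equivalent.cases {I : RCPSP} {f g : Fin I.numJobs → ℕ} (h : I.Equivalent f g)
    (k : Fin I.numJobs) : f k = g k ∨ (f k ≠ 0 ∧ g k ≠ 0 ∧
      f k - 1 + I.proc k ≤ I.clock f ∧ g k - 1 + I.proc k ≤ I.clock f) := by
  have h1 := h.2 k
  have h2 := h.1
  unfold digit at h1
  split_ifs at h1 <;> omega

theorem Equivalent.symm {I : RCPSP} {f g : Fin I.numJobs → ℕ} (h : I.Equivalent f g) :
    I.Equivalent g f := ⟨h.1.symm, fun k => (h.2 k).symm⟩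

theorem Equivalent.trans {I : RCPSP} {f g e : Fin I.numJobs → ℕ} (h : I.Equivalent f g)
    (h' : I.Equivalent g e) : I.Equivalent f e :=
  ⟨h.1.trans h'.1, fun k => (h.2 k).trans (h'.2 k)⟩

theorem Equivalent.complete {I : RCPSP} {f g : Fin I.numJobs → ℕ} (h : I.Equivalent f g)
    (hf : I.Complete f) : I.Complete g := fun j hj => by
  have := hf j hj
  have := h.cases j
  omega

theorem Equivalent.span_le {I : RCPSP} {f g : Fin I.numJobs → ℕ} (h : I.Equivalent f g) :
    I.span f ≤ I.span g := by
  refine Finset.sup_le fun j _ => ?_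
  have := I.le_span g j
  have := I.clock_le_span g
  have := h.1
  rcases h.cases j with h1 | h1 <;> omega

theorem Equivalent.nextTime {I : RCPSP} {f g : Fin I.numJobs → ℕ} (h : I.Equivalent f g)
    (i : Fin I.numJobs) : I.nextTime f i = I.nextTime g i := by
  have := h.1
  unfold RCPSP.nextTime
  rcases h.cases i with h1 | h1
  · rw [h1, this]
  · rw [if_neg h1.1, if_neg h1.2.1]; omega

/-- Equivalent partial schedules can be continued in the same way. -/
theorem Equivalent.succ {I : RCPSP} {lam : ℕ} {f g g' : Fin I.numJobs → ℕ}
    (h : I.Equivalent f g) (hs : I.Succ lam g g') : ∃ f', I.Succ lam f f' ∧ I.Equivalent f' g' := by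
  obtain ⟨j, i, ha, rfl⟩ := hs
  have hct := I.clock_le_nextTime g i
  have hcl := h.1
  refine ⟨_, ⟨j, i, ?_, rfl⟩, ?_⟩
  · rw [h.nextTime i]
    refine ⟨ha.pos, ?_, fun k hk hk0 => ?_, fun k hk hk0 => ?_, fun ρ => ?_⟩
    · have := ha.unstarted; have := h.cases j; omega
    · have := ha.prec k hk hk0
      have := h.cases k
      omega
    · refine ha.deadline k hk ?_
      have := h.cases k
      omega
    · refine (Finset.sum_le_sum fun k _ => ?_).trans (ha.res ρ)
      by_cases hk : k = j
      · subst hk; simp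
      · rw [Function.update_of_ne hk, Function.update_of_ne hk]
        have := h.cases k
        split_ifs <;> omega
  · have hfj : f j = 0 := by have := ha.unstarted; have := h.cases j; omega
    rw [h.nextTime i]
    have c1 := I.clock_update hfj (hcl.trans_le hct)
    have c2 := I.clock_update ha.unstarted hct
    refine ⟨c1.trans c2.symm, fun k => ?_⟩
    rw [digit, digit, c1, c2]
    by_cases hk : k = j
    · subst hk; simp
    · rw [Function.update_of_ne hk, Function.update_of_ne hk]
      have := h.cases k
      split_ifs <;> omega

/-- A set of partial schedules that contains the empty one and, up to equivalence, all successors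
of its members, contains all reachable partial schedules, up to equivalence. -/
theorem exists_equivalent_of_closed {I : RCPSP} {lam : ℕ} {E : Set (Fin I.numJobs → ℕ)}
    (h0 : 0 ∈ E) (hE : ∀ f ∈ E, ∀ f', I.Succ lam f f' → ∃ g ∈ E, I.Equivalent g f')
    {g : Fin I.numJobs → ℕ} (hg : Relation.ReflTransGen (I.Succ lam) 0 g) :
    ∃ f ∈ E, I.Equivalent f g := by
  induction hg with
  | refl => exact ⟨0, h0, rfl, fun _ => rfl⟩
  | tail _ hs ih =>
    obtain ⟨f, hf, hfg⟩ := ih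
    obtain ⟨f', hs', he⟩ := hfg.succ hs
    obtain ⟨e, heE, hee⟩ := hE f hf f' hs'
    exact ⟨e, heE, hee.trans he⟩

end RCPSP

/-! ### Dilworth's theorem -/

/-- **Dilworth's theorem**: a finite partially ordered set can be covered by as many chains as some
antichain has elements. This is Galvin's proof, by induction on the size of the set: a maximal
element `a` is removed, and in each of the chains that cover the rest, the largest element that
belongs to a largest antichain is considered. -/
theorem exists_antichain_chain_cover {α : Type*} [PartialOrder α] (s : Finset α) :
    ∃ A ⊆ s, IsAntichain (· ≤ ·) (A : Set α) ∧ ∃ c : α → ℕ, (∀ a ∈ s, c a < A.card) ∧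
      ∀ a ∈ s, ∀ b ∈ s, c a = c b → a ≤ b ∨ b ≤ a := by
  classical
  induction hn : s.card using Nat.strong_induction_on generalizing s with
  | _ n ih =>
    rcases s.eq_empty_or_nonempty with rfl | hs
    · exact ⟨∅, by simp, by simp, fun _ => 0, by simp, by simp⟩
    obtain ⟨a, has, hmax⟩ := s.exists_maximal hs
    obtain ⟨A₀, hA₀, hA₀a, c, hc, hcc⟩ := ih (s.erase a).card
      (hn ▸ Finset.card_erase_lt_of_mem has) (s.erase a) rfl
    have hinj : ∀ B ⊆ s.erase a, IsAntichain (· ≤ ·) (B : Set α) → Set.InjOn c B := by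
      intro B hB hBa x hx y hy hxy
      by_contra hne
      rcases hcc x (hB hx) y (hB hy) hxy with h | h
      · exact hBa hx hy hne h
      · exact hBa hy hx (Ne.symm hne) h
    -- every antichain of the largest size meets every chain
    have hmeet : ∀ B ⊆ s.erase a, IsAntichain (· ≤ ·) (B : Set α) → B.card = A₀.card →
        ∀ i < A₀.card, ∃ y ∈ B, c y = i := by
      intro B hB hBa hcard i hi
      have : B.image c = Finset.range A₀.card := by
        refine Finset.eq_of_subset_of_card_le (fun j hj => ?_) ?_
        · obtain ⟨y, hy, rfl⟩ := Finset.mem_image.1 hj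
          exact Finset.mem_range.2 (hc y (hB hy))
        · rw [Finset.card_image_of_injOn (hinj B hB hBa), hcard, Finset.card_range]
      simpa using this.ge (Finset.mem_range.2 hi)
    -- the largest element `x i` of the chain `i` that belongs to a largest antichain
    have hx : ∀ i, ∃ x, i < A₀.card → (c x = i ∧ ∃ B ⊆ s.erase a,
        IsAntichain (· ≤ ·) (B : Set α) ∧ B.card = A₀.card ∧ x ∈ B) ∧
        ∀ B ⊆ s.erase a, IsAntichain (· ≤ ·) (B : Set α) → B.card = A₀.card →
          ∀ y ∈ B, c y = i → y ≤ x := by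
      intro i
      by_cases hi : i < A₀.card
      swap
      · exact ⟨a, fun h => absurd h hi⟩
      obtain ⟨y, hy, hyi⟩ := hmeet A₀ hA₀ hA₀a rfl i hi
      obtain ⟨x, hx, hxmax⟩ := ((s.erase a).filter fun x => c x = i ∧ ∃ B ⊆ s.erase a,
        IsAntichain (· ≤ ·) (B : Set α) ∧ B.card = A₀.card ∧ x ∈ B).exists_maximal
        ⟨y, Finset.mem_filter.2 ⟨hA₀ hy, hyi, A₀, hA₀, hA₀a, rfl, hy⟩⟩
      rw [Finset.mem_filter] at hx
      refine ⟨x, fun _ => ⟨hx.2, fun B hB hBa hcard z hz hzi => ?_⟩⟩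
      rcases hcc x hx.1 z (hB hz) (hx.2.1.trans hzi.symm) with h | h
      · exact hxmax (Finset.mem_filter.2 ⟨hB hz, hzi, B, hB, hBa, hcard, hz⟩) h
      · exact h
    choose x hx using hx
    have hxs : ∀ i < A₀.card, x i ∈ s.erase a := fun i hi => by
      obtain ⟨⟨-, B, hB, -, -, h⟩, -⟩ := hx i hi
      exact hB h
    have hxanti : ∀ i < A₀.card, ∀ j < A₀.card, i ≠ j → ¬ x i ≤ x j := by
      intro i hi j hj hij hle
      obtain ⟨⟨hcj, B, hB, hBa, hcard, hxB⟩, -⟩ := hx j hj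
      obtain ⟨y, hy, hyi⟩ := hmeet B hB hBa hcard i hi
      have := (hx i hi).2 B hB hBa hcard y hy hyi
      refine hBa hy hxB ?_ (this.trans hle)
      rintro rfl
      exact hij (hyi.symm.trans hcj)
    -- the elements `x i` form an antichain; if `a` is above one of them, then the part of its chain
    -- up to it, together with `a`, meets every largest antichain, and otherwise `a` extends the
    -- antichain
    by_cases hcomp : ∃ i < A₀.card, x i ≤ a
    · obtain ⟨i, hi, hia⟩ := hcomp
      obtain ⟨K, hK⟩ : ∃ K, K = insert a ((s.erase a).filter fun z => c z = i ∧ z ≤ x i) :=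
        ⟨_, rfl⟩
      have haK : a ∈ K := by simp [hK]
      obtain ⟨A₁, hA₁, hA₁a, c₁, hc₁, hcc₁⟩ := ih (s \ K).card (by
        rw [← hn]
        exact Finset.card_lt_card ⟨Finset.sdiff_subset, fun h =>
          (Finset.mem_sdiff.1 (h has)).2 haK⟩) (s \ K) rfl
      have hA₁s : A₁ ⊆ s.erase a := fun z hz => by
        have := Finset.mem_sdiff.1 (hA₁ hz)
        exact Finset.mem_erase.2 ⟨by rintro rfl; exact this.2 haK, this.1⟩
      have hcard : A₁.card < A₀.card := by
        refine lt_of_le_of_ne ?_ fun h => ?_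
        · rw [← Finset.card_image_of_injOn (hinj A₁ hA₁s hA₁a), ← Finset.card_range A₀.card]
          refine Finset.card_le_card fun j hj => ?_
          obtain ⟨y, hy, rfl⟩ := Finset.mem_image.1 hj
          exact Finset.mem_range.2 (hc y (hA₁s hy))
        · obtain ⟨y, hy, hyi⟩ := hmeet A₁ hA₁s hA₁a h i hi
          refine (Finset.mem_sdiff.1 (hA₁ hy)).2 ?_
          rw [hK]
          exact Finset.mem_insert_of_mem (Finset.mem_filter.2 ⟨hA₁s hy, hyi,
            (hx i hi).2 A₁ hA₁s hA₁a h y hy hyi⟩)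
      have hchain : ∀ u ∈ K, ∀ v ∈ K, u ≤ v ∨ v ≤ u := by
        intro u hu v hv
        rw [hK, Finset.mem_insert, Finset.mem_filter] at hu hv
        rcases hu with rfl | hu <;> rcases hv with rfl | hv
        · exact .inl le_rfl
        · exact .inr (hv.2.2.trans hia)
        · exact .inl (hu.2.2.trans hia)
        · exact hcc u hu.1 v hv.1 (hu.2.1.trans hv.2.1.symm)
      refine ⟨A₀, hA₀.trans (Finset.erase_subset _ _), hA₀a,
        fun z => if z ∈ K then A₁.card else c₁ z, fun z hz => ?_, fun u hu v hv huv => ?_⟩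
      · dsimp only
        split_ifs with hzK
        · exact hcard
        · exact (hc₁ z (Finset.mem_sdiff.2 ⟨hz, hzK⟩)).trans hcard
      · dsimp only at huv
        split_ifs at huv with h1 h2 h2
        · exact hchain u h1 v h2
        · exact absurd huv (hc₁ v (Finset.mem_sdiff.2 ⟨hv, h2⟩)).ne'
        · exact absurd huv (hc₁ u (Finset.mem_sdiff.2 ⟨hu, h1⟩)).ne
        · exact hcc₁ u (Finset.mem_sdiff.2 ⟨hu, h1⟩) v (Finset.mem_sdiff.2 ⟨hv, h2⟩) huv
    · push Not at hcomp
      have hxinj : Set.InjOn x (Finset.range A₀.card) := by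
        intro i hi j hj hij
        by_contra hne
        exact hxanti i (by simpa using hi) j (by simpa using hj) hne hij.le
      have haA : a ∉ (Finset.range A₀.card).image x := by
        intro h
        obtain ⟨i, hi, hia⟩ := Finset.mem_image.1 h
        exact Finset.ne_of_mem_erase (hxs i (Finset.mem_range.1 hi)) hia
      have hcard : (insert a ((Finset.range A₀.card).image x)).card = A₀.card + 1 := by
        rw [Finset.card_insert_of_notMem haA, Finset.card_image_of_injOn hxinj,
          Finset.card_range]
      refine ⟨insert a ((Finset.range A₀.card).image x), ?_, ?_,
        fun z => if z = a then A₀.card else c z, fun z hz => ?_, fun u hu v hv huv => ?_⟩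
      · intro z hz
        rcases Finset.mem_insert.1 hz with rfl | hz
        · exact has
        · obtain ⟨i, hi, rfl⟩ := Finset.mem_image.1 hz
          exact Finset.mem_of_mem_erase (hxs i (Finset.mem_range.1 hi))
      · rintro u hu v hv huv hle
        rw [Finset.coe_insert, Set.mem_insert_iff, Finset.mem_coe, Finset.mem_image] at hu hv
        rcases hu with rfl | ⟨i, hi, rfl⟩ <;> rcases hv with rfl | ⟨j, hj, rfl⟩
        · exact huv rfl
        · rw [Finset.mem_range] at hj
          exact hcomp j hj (hmax (Finset.mem_of_mem_erase (hxs j hj)) hle)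
        · exact hcomp i (Finset.mem_range.1 hi) hle
        · exact hxanti i (Finset.mem_range.1 hi) j (Finset.mem_range.1 hj)
            (fun h => huv (by rw [h])) hle
      · rw [hcard]
        dsimp only
        split_ifs with hza
        · exact Nat.lt_succ_self _
        · exact (hc z (Finset.mem_erase.2 ⟨hza, hz⟩)).trans (Nat.lt_succ_self _)
      · dsimp only at huv
        split_ifs at huv with h1 h2 h2
        · exact .inl (h1.trans h2.symm).le
        · exact absurd huv (hc v (Finset.mem_erase.2 ⟨h2, hv⟩)).ne'
        · exact absurd huv (hc u (Finset.mem_erase.2 ⟨h1, hu⟩)).ne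
        · exact hcc u (Finset.mem_erase.2 ⟨h1, hu⟩) v (Finset.mem_erase.2 ⟨h2, hv⟩) huv

namespace RCPSP

/-- The jobs can be partitioned into `width` chains. -/
theorem exists_chains (I : RCPSP) : ∃ c : Fin I.numJobs → Fin I.width,
    ∀ i j, c i = c j → i = j ∨ I.lt i j ∨ I.lt j i := by
  classical
  let P : PartialOrder (Fin I.numJobs) :=
    { le := I.le, lt := fun i j => I.le i j ∧ ¬ I.le j i, le_refl := I.le_refl,
      le_trans := I.le_trans, le_antisymm := I.le_antisymm,
      lt_iff_le_not_ge := fun _ _ => Iff.rfl }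
  obtain ⟨A, -, hA, c, hc, hcc⟩ := @exists_antichain_chain_cover _ P Finset.univ
  have hw : A.card ≤ I.width := by
    refine Finset.le_sup (f := Finset.card) ?_
    rw [Finset.mem_filter]
    exact ⟨Finset.mem_univ _, hA⟩
  refine ⟨fun j => ⟨c j, (hc j (Finset.mem_univ j)).trans_le hw⟩, fun i j hij => ?_⟩
  by_cases hne : i = j
  · exact .inl hne
  · rcases hcc i (Finset.mem_univ i) j (Finset.mem_univ j) (Fin.mk.inj_iff.1 hij) with h | h
    · exact .inr (.inl ⟨h, hne⟩)
    · exact .inr (.inr ⟨h, Ne.symm hne⟩)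

theorem width_pos (I : RCPSP) (h : 0 < I.numJobs) : 0 < I.width := by
  obtain ⟨c, -⟩ := I.exists_chains
  exact (c ⟨0, h⟩).pos

/-! ### The number of partial schedules up to equivalence -/

/-- The job `k` runs at the clock time. -/
def RunsNow (I : RCPSP) (f : Fin I.numJobs → ℕ) (k : Fin I.numJobs) : Prop :=
  f k ≠ 0 ∧ I.clock f < f k - 1 + I.proc k

open Classical in
/-- The progress of a chain in which no job runs: the earliest possible completion time of its last
completed job, but at least the clock time minus `lam`. -/
noncomputable def progress (I : RCPSP) (lam : ℕ) (f : Fin I.numJobs → ℕ)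
    (C : Set (Fin I.numJobs)) : ℕ :=
  max (I.clock f - lam)
    ((Finset.univ.filter fun k => k ∈ C ∧ f k ≠ 0).sup fun k => I.earliest k + I.proc k)

open Classical in
/-- A number below `2 * lam + 2` that describes the state of a chain at a known clock time: the
delay of the running job, or `lam + 1` plus a number that represents the progress. -/
noncomputable def chainState (I : RCPSP) (lam : ℕ) (f : Fin I.numJobs → ℕ)
    (C : Set (Fin I.numJobs)) : ℕ :=
  if h : ∃ k ∈ C, I.RunsNow f k then f h.choose - 1 - I.earliest h.choose
  else lam + 1 + (I.progress lam f C - (I.clock f - lam))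

section

variable {I : RCPSP} {lam : ℕ} {f g : Fin I.numJobs → ℕ} {C : Set (Fin I.numJobs)}

theorem le_progress {k : Fin I.numJobs} (hk : k ∈ C) (hf : f k ≠ 0) :
    I.earliest k + I.proc k ≤ I.progress lam f C := by
  classical
  refine _root_.le_trans (Finset.le_sup (f := fun k => I.earliest k + I.proc k) ?_)
    (le_max_right _ _)
  rw [Finset.mem_filter]
  exact ⟨Finset.mem_univ _, hk, hf⟩

theorem progress_le {b : ℕ} (h : I.clock f - lam ≤ b)
    (h' : ∀ k ∈ C, f k ≠ 0 → I.earliest k + I.proc k ≤ b) : I.progress lam f C ≤ b := by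
  classical
  refine max_le h (Finset.sup_le fun k hk => ?_)
  rw [Finset.mem_filter] at hk
  exact h' k hk.2.1 hk.2.2

theorem Valid.pos (hf : I.Valid lam f) {k : Fin I.numJobs} (hk : f k ≠ 0) : 0 < I.proc k := by
  rcases Nat.eq_zero_or_pos (I.proc k) with h | h
  · exact absurd (hf.zero k h) hk
  · exact h

/-- In a chain, the delay of the running job determines this job, because the clock time minus the
delay lies between its earliest possible starting time and its earliest possible completion time,
and these intervals are disjoint. -/
theorem eq_of_delay_eq (hf : I.Valid lam f) (hg : I.Valid lam g) (hclock : I.clock f = I.clock g)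
    {k l : Fin I.numJobs} (hkl : k = l ∨ I.lt k l ∨ I.lt l k) (hk : I.RunsNow f k)
    (hl : I.RunsNow g l) (h : f k - 1 - I.earliest k = g l - 1 - I.earliest l) :
    k = l ∧ f k = g l := by
  have h1 := hf.earliest_le hk.1
  have h2 := hg.earliest_le hl.1
  have h3 := I.le_clock f k
  have h4 := I.le_clock g l
  have h5 := hk.1
  have h6 := hl.1
  have h7 := hk.2
  have h8 := hl.2
  rcases hkl with rfl | h' | h'
  · exact ⟨rfl, by omega⟩
  · have := I.earliest_le_of_lt h'; omega
  · have := I.earliest_le_of_lt h'; omega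

/-- In a chain, a running job determines the states of all jobs. -/
theorem digit_eq_of_runsNow (hf : I.Valid lam f) (hg : I.Valid lam g)
    (hclock : I.clock f = I.clock g) {k l : Fin I.numJobs} (hkl : k = l ∨ I.lt k l ∨ I.lt l k)
    (hk : I.RunsNow f k) (hfg : f k = g k) : I.digit f l = I.digit g l := by
  have h5 := hk.1
  have h7 := hk.2
  have h3 := I.le_clock f k
  unfold digit
  rcases hkl with rfl | h' | h'
  · rw [hfg, hclock]
  · have hl : f l = 0 := by
      by_contra hl
      have := hf.prec k l h' (hf.pos hk.1) hl
      have := I.le_clock f l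
      omega
    have hl' : g l = 0 := by
      by_contra hl
      have := hg.prec k l h' (hf.pos hk.1) hl
      have := I.le_clock g l
      omega
    rw [hl, hl']; simp
  · rcases Nat.eq_zero_or_pos (I.proc l) with h0 | h0
    · rw [hf.zero l h0, hg.zero l h0]; simp
    · have h1 := hf.prec l k h' h0 h5
      have h2 := hg.prec l k h' h0 (by omega)
      rw [if_neg h1.1, if_neg h2.1, if_pos (by omega), if_pos (by omega)]

/-- In a chain in which no job runs, the progress determines which jobs are completed. -/
theorem ne_zero_of_progress_le (hf : I.Valid lam f) (hg : I.Valid lam g)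
    (hC : ∀ k ∈ C, ∀ l ∈ C, k = l ∨ I.lt k l ∨ I.lt l k)
    (h : I.progress lam f C ≤ I.progress lam g C) {k : Fin I.numJobs} (hk : k ∈ C)
    (hfk : f k ≠ 0) : g k ≠ 0 := by
  intro hgk
  have hp := hf.pos hfk
  have h1 : I.earliest k + I.proc k ≤ I.progress lam f C := le_progress hk hfk
  have h2 : I.progress lam g C ≤ I.earliest k := by
    refine progress_le ?_ fun l hl hgl => ?_
    · have := hg.deadline k hp hgk; omega
    · rcases hC k hk l hl with rfl | h' | h'
      · exact absurd hgk hgl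
      · exact absurd hgk (hg.prec k l h' hp hgl).1
      · exact I.earliest_le_of_lt h'
  omega

/-- The progress of a chain in which no job runs lies between the clock time minus `lam` and the
clock time. -/
theorem chainState_lt (hf : I.Valid lam f) : I.chainState lam f C < 2 * lam + 2 := by
  unfold chainState
  split_ifs with h
  · have := hf.lag _ h.choose_spec.2.1
    omega
  · have : I.progress lam f C ≤ I.clock f := by
      refine progress_le (Nat.sub_le _ _) fun k hk hfk => ?_
      have h1 : ¬ I.RunsNow f k := fun h' => h ⟨k, hk, h'⟩
      have := hf.earliest_le hfk
      simp only [RunsNow, not_and, not_lt] at h1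
      have := h1 hfk
      omega
    omega

theorem digit_eq_of_chainState_eq (hf : I.Valid lam f) (hg : I.Valid lam g)
    (hclock : I.clock f = I.clock g)
    (hC : ∀ k ∈ C, ∀ l ∈ C, k = l ∨ I.lt k l ∨ I.lt l k)
    (h : I.chainState lam f C = I.chainState lam g C) {l : Fin I.numJobs} (hl : l ∈ C) :
    I.digit f l = I.digit g l := by
  unfold chainState at h
  split_ifs at h with h1 h2 h2
  · have h3 := eq_of_delay_eq hf hg hclock (hC _ h1.choose_spec.1 _ h2.choose_spec.1)
      h1.choose_spec.2 h2.choose_spec.2 h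
    refine digit_eq_of_runsNow hf hg hclock (hC _ h1.choose_spec.1 _ hl) h1.choose_spec.2 ?_
    rw [h3.2, h3.1]
  · have := hf.lag _ h1.choose_spec.2.1
    omega
  · have := hg.lag _ h2.choose_spec.2.1
    omega
  · have hle : ∀ f, I.clock f - lam ≤ I.progress lam f C := fun f => le_max_left _ _
    have h3 := hle f
    have h4 := hle g
    have h5 : f l ≠ 0 → g l ≠ 0 := ne_zero_of_progress_le hf hg hC (by omega) hl
    have h6 : g l ≠ 0 → f l ≠ 0 := ne_zero_of_progress_le hg hf hC (by omega) hl
    have h7 : ¬ I.RunsNow f l := fun h' => h1 ⟨l, hl, h'⟩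
    have h8 : ¬ I.RunsNow g l := fun h' => h2 ⟨l, hl, h'⟩
    simp only [RunsNow, not_and, not_lt] at h7 h8
    unfold digit
    by_cases hfl : f l = 0
    · rw [if_pos hfl, if_pos (by tauto)]
    · rw [if_neg hfl, if_neg (h5 hfl), if_pos (h7 hfl), if_pos (h8 (h5 hfl))]

end

/-- Pairwise inequivalent partial schedules in which some job starts at the clock time are
determined by the choice of such a job and by one number per chain: the delay of this job for its
own chain, from which the clock time follows, and the state of the chain for the other ones. -/
theorem card_le_of_inequivalent {I : RCPSP} {lam : ℕ} (E : Finset (Fin I.numJobs → ℕ))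
    (hE : ∀ f ∈ E, I.Valid lam f ∧ ∃ j, f j = I.clock f + 1)
    (hinj : ∀ f ∈ E, ∀ g ∈ E, I.Equivalent f g → f = g) :
    E.card ≤ I.numJobs * (2 * lam + 2) ^ I.width := by
  classical
  obtain ⟨c, hc⟩ := I.exists_chains
  rcases E.eq_empty_or_nonempty with rfl | ⟨f₀, hf₀⟩
  · simp
  obtain ⟨j₀, -⟩ := (hE f₀ hf₀).2
  have hlast : ∀ f, ∃ j, f ∈ E → f j = I.clock f + 1 := by
    intro f
    by_cases hf : f ∈ E
    · obtain ⟨j, hj⟩ := (hE f hf).2; exact ⟨j, fun _ => hj⟩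
    · exact ⟨j₀, fun h => absurd h hf⟩
  choose J hJ using hlast
  -- the clock time follows from the first component and from the number of the chain of that job
  let sig : (Fin I.numJobs → ℕ) → Fin I.numJobs × (Fin I.width → ℕ) := fun f =>
    (J f, fun i => if i = c (J f) then I.clock f - I.earliest (J f)
      else I.chainState lam f {k | c k = i})
  have hcard : ((Finset.univ : Finset (Fin I.numJobs)) ×ˢ
      Fintype.piFinset fun _ : Fin I.width => Finset.range (2 * lam + 2)).card =
      I.numJobs * (2 * lam + 2) ^ I.width := by
    simp
  rw [← hcard]
  refine Finset.card_le_card_of_injOn sig (fun f hf => ?_) fun f hf g hg hfg => ?_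
  · have hv := (hE f hf).1
    have hj := hJ f hf
    refine Finset.mem_coe.2 (Finset.mem_product.2 ⟨Finset.mem_univ _,
      Fintype.mem_piFinset.2 fun i => Finset.mem_range.2 ?_⟩)
    dsimp only [sig]
    split_ifs
    · have := hv.lag (J f) (by omega)
      omega
    · exact chainState_lt hv
  · have hv := (hE f hf).1
    have hv' := (hE g hg).1
    have hj := hJ f hf
    have hj' := hJ g hg
    rw [Prod.mk.injEq] at hfg
    obtain ⟨h1, h2⟩ := hfg
    rw [← h1] at h2 hj'
    have h3 := hv.earliest_le (j := J f) (by omega)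
    have h4 := hv'.earliest_le (j := J f) (by omega)
    have hclock : I.clock f = I.clock g := by
      have := congrFun h2 (c (J f))
      simp only [if_true] at this
      omega
    refine hinj f hf g hg ⟨hclock, fun l => ?_⟩
    by_cases hl : c l = c (J f)
    · refine digit_eq_of_runsNow hv hv' hclock (hc _ _ hl.symm) ⟨by omega, ?_⟩ (by omega)
      have := hv.pos (k := J f) (by omega)
      omega
    · have := congrFun h2 (c l)
      simp only [if_neg hl] at this
      exact digit_eq_of_chainState_eq hv hv' hclock
        (fun k hk l hl => hc k l (hk.trans hl.symm)) this (l := l) rfl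

end RCPSP

/-! ### Rules for loops -/

namespace LoopLang

instance : Coe Var Expr := ⟨.var⟩
instance : Add Expr := ⟨.add⟩
instance : Sub Expr := ⟨.sub⟩

namespace Expr

/-- Truth values are numbers; every number but zero is true. -/
def neg (e : Expr) : Expr := lit 1 - e
def conj (e₁ e₂ : Expr) : Expr := neg (e₁.neg + e₂.neg)
def disj (e₁ e₂ : Expr) : Expr := e₁ + e₂
def less (e₁ e₂ : Expr) : Expr := e₂ - e₁
def differ (e₁ e₂ : Expr) : Expr := (e₁ - e₂) + (e₂ - e₁)

@[simp] theorem eval_add (S : St) (e₁ e₂ : Expr) : (e₁ + e₂).eval S = e₁.eval S + e₂.eval S := rfl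
@[simp] theorem eval_sub (S : St) (e₁ e₂ : Expr) : (e₁ - e₂).eval S = e₁.eval S - e₂.eval S := rfl
@[simp] theorem eval_lit (S : St) (n : ℕ) : (lit n).eval S = n := rfl
@[simp] theorem eval_var (S : St) (x : Var) : (var x).eval S = S.v x := rfl
@[simp] theorem eval_get (S : St) (k : Arr) (e : Expr) : (get k e).eval S = S.a k (e.eval S) := rfl
@[simp] theorem eval_inp (S : St) (e : Expr) : (inp e).eval S = S.inp (e.eval S) := rfl

@[simp] theorem eval_neg (S : St) (e : Expr) : e.neg.eval S = 0 ↔ e.eval S ≠ 0 := by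
  simp only [neg, eval_sub, eval_lit]; omega

@[simp] theorem eval_conj (S : St) (e₁ e₂ : Expr) :
    (conj e₁ e₂).eval S = 0 ↔ ¬ (e₁.eval S ≠ 0 ∧ e₂.eval S ≠ 0) := by
  simp only [conj, neg, eval_add, eval_sub, eval_lit]; omega

@[simp] theorem eval_disj (S : St) (e₁ e₂ : Expr) :
    (disj e₁ e₂).eval S = 0 ↔ ¬ (e₁.eval S ≠ 0 ∨ e₂.eval S ≠ 0) := by
  simp only [disj, eval_add]; omega

@[simp] theorem eval_less (S : St) (e₁ e₂ : Expr) :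
    (less e₁ e₂).eval S = 0 ↔ ¬ e₁.eval S < e₂.eval S := by
  simp only [less, eval_sub]; omega

@[simp] theorem eval_differ (S : St) (e₁ e₂ : Expr) :
    (differ e₁ e₂).eval S = 0 ↔ ¬ e₁.eval S ≠ e₂.eval S := by
  simp only [differ, eval_add, eval_sub]; omega

end Expr

section

variable {x n : Var} {b : Cmd} {S : St} {m : ℕ}

/-- A loop that resets a flag when a condition holds. -/
theorem iter_check (y : Var) (hn : S.v n = m) (C : Fin m → Prop)
    (h : ∀ (k : Fin m) (S' : St), Agree (x :: b.vars) b.arrs b.emits S (S'.setv x k) →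
      ((b.eval (S'.setv x k)).v y ≠ 0 ↔ ¬ C k ∧ S'.v y ≠ 0)) :
    ((Cmd.iter x n b).eval S).v y ≠ 0 ↔ (∀ k, ¬ C k) ∧ S.v y ≠ 0 := by
  have := iter_induction x n b S
    (fun l S' => S'.v y ≠ 0 ↔ (∀ k : Fin m, l ≤ k → ¬ C k) ∧ S.v y ≠ 0) ?_ ?_
  · simpa using this
  · exact ⟨fun h => ⟨fun k hk => by omega, h⟩, fun h => h.2⟩
  · intro l hl S' hS' hP
    rw [hn] at hl
    rw [h ⟨l, hl⟩ S' (hS'.trans (.setv _ (by simp))), hP, ← and_assoc]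
    refine and_congr_left fun _ => ⟨fun h k hk => ?_, fun h => ⟨h _ le_rfl, fun k hk => ?_⟩⟩
    · by_cases hkl : (k : ℕ) = l
      · convert h.1
      · exact h.2 k (by omega)
    · exact h k (by omega)

/-- A loop that computes a maximum. -/
theorem iter_max (y : Var) (hn : S.v n = m) (g : Fin m → ℕ)
    (h : ∀ (k : Fin m) (S' : St), Agree (x :: b.vars) b.arrs b.emits S (S'.setv x k) →
      (b.eval (S'.setv x k)).v y = max (S'.v y) (g k)) :
    ((Cmd.iter x n b).eval S).v y = max (S.v y) (Finset.univ.sup g) := by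
  have := iter_induction x n b S
    (fun l S' => S'.v y = max (S.v y) ((Finset.univ.filter fun k : Fin m => l ≤ k).sup g)) ?_ ?_
  · simpa using this
  · rw [Finset.filter_false_of_mem fun k _ => by omega]
    simp
  · intro l hl S' hS' hP
    rw [hn] at hl
    rw [h ⟨l, hl⟩ S' (hS'.trans (.setv _ (by simp))), hP]
    have : (Finset.univ.filter fun k : Fin m => l ≤ k) =
        insert ⟨l, hl⟩ (Finset.univ.filter fun k : Fin m => l + 1 ≤ k) := by
      ext k; simp [Fin.ext_iff]; omega
    rw [this, Finset.sup_insert]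
    simp only [max_comm, max_left_comm]

/-- A loop that computes a sum. -/
theorem iter_sum (y : Var) (hn : S.v n = m) (g : Fin m → ℕ)
    (h : ∀ (k : Fin m) (S' : St), Agree (x :: b.vars) b.arrs b.emits S (S'.setv x k) →
      (b.eval (S'.setv x k)).v y = S'.v y + g k) :
    ((Cmd.iter x n b).eval S).v y = S.v y + ∑ k, g k := by
  have := iter_induction x n b S
    (fun l S' => S'.v y = S.v y + ∑ k with l ≤ (k : Fin m).val, g k) ?_ ?_
  · simpa using this
  · rw [Finset.filter_false_of_mem fun k _ => by omega]
    simp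
  · intro l hl S' hS' hP
    rw [hn] at hl
    rw [h ⟨l, hl⟩ S' (hS'.trans (.setv _ (by simp))), hP]
    have : (Finset.univ.filter fun k : Fin m => l ≤ k) =
        insert ⟨l, hl⟩ (Finset.univ.filter fun k : Fin m => l + 1 ≤ k) := by
      ext k; simp [Fin.ext_iff]; omega
    rw [this, Finset.sum_insert (by simp)]
    omega

/-- A loop that fills a part of an array. -/
theorem iter_put (A : Arr) (hn : S.v n = m) (o : ℕ) (g : Fin m → ℕ)
    (h : ∀ (k : Fin m) (S' : St), Agree (x :: b.vars) b.arrs b.emits S (S'.setv x k) →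
      (∀ i, i < o ∨ o + m ≤ i → S'.a A i = S.a A i) → ∀ i,
      (b.eval (S'.setv x k)).a A i = if i = o + k then g k else S'.a A i) :
    (∀ k : Fin m, ((Cmd.iter x n b).eval S).a A (o + k) = g k) ∧
      ∀ i, i < o ∨ o + m ≤ i → ((Cmd.iter x n b).eval S).a A i = S.a A i := by
  have := iter_induction x n b S
    (fun l S' => (∀ k : Fin m, l ≤ k → S'.a A (o + k) = g k) ∧
      ∀ i, i < o ∨ o + m ≤ i → S'.a A i = S.a A i) ?_ ?_
  · exact ⟨fun k => this.1 k (Nat.zero_le _), this.2⟩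
  · exact ⟨fun k hk => by omega, fun i _ => rfl⟩
  · intro l hl S' hS' hP
    rw [hn] at hl
    have := h ⟨l, hl⟩ S' (hS'.trans (.setv _ (by simp))) hP.2
    refine ⟨fun k hk => ?_, fun i hi => ?_⟩
    · rw [this]
      by_cases hkl : (k : ℕ) = l
      · rw [if_pos (by rw [hkl])]
        congr 1
        exact Fin.ext hkl.symm
      · rw [if_neg (by simpa using hkl)]
        exact hP.1 k (by omega)
    · rw [this, if_neg (by dsimp only; omega)]
      exact hP.2 i hi

end

/-- One command after the other. -/
infixr:50 " ;; " => Cmd.seq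

/-- Run a command if the value of an expression is not zero. -/
def Cmd.when (e : Expr) (c : Cmd) : Cmd := .ite e c .skip

theorem Cmd.when_of_ne_zero {e : Expr} {S : St} (h : e.eval S ≠ 0) (c : Cmd) :
    (Cmd.when e c).eval S = c.eval S := if_pos h

theorem Cmd.when_of_eq_zero {e : Expr} {S : St} (h : e.eval S = 0) (c : Cmd) :
    (Cmd.when e c).eval S = S := if_neg (not_not.2 h)

theorem Cmd.reset_eval {e : Expr} {S : St} {C : Prop} (y : Var) (h : e.eval S ≠ 0 ↔ C) :
    ((Cmd.when e (.assign y (.lit 0))).eval S).v y ≠ 0 ↔ ¬ C ∧ S.v y ≠ 0 := by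
  by_cases hc : e.eval S = 0
  · rw [when_of_eq_zero hc, ← h, not_not, and_iff_right hc]
  · rw [when_of_ne_zero hc, ← h]
    simp [eval, St.setv_v, hc]

theorem Cmd.max_eval {e : Expr} {S : St} (y : Var) :
    ((Cmd.when (.less (.var y) e) (.assign y e)).eval S).v y = max (S.v y) (e.eval S) := by
  by_cases hc : S.v y < e.eval S
  · rw [when_of_ne_zero (by simpa using hc)]
    simp [eval, St.setv_v, hc.le]
  · rw [when_of_eq_zero (by simpa using hc)]
    omega

/-- `Var.prod` is set to the product of two variables. -/
def Cmd.mul (y z : Var) : Cmd :=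
  .assign .prod (.lit 0) ;; .iter .c z (.assign .prod (.var .prod + y))

theorem Cmd.mul_eval (y z : Var) (S : St) (hy : y ≠ .prod) (hy' : y ≠ .c) (hz : z ≠ .prod) :
    ((Cmd.mul y z).eval S).v .prod = S.v y * S.v z := by
  have hz' : (S.setv .prod 0).v z = S.v z := by rw [St.setv_v, if_neg hz]
  have := iter_sum (x := .c) (n := z) (b := .assign .prod (.var .prod + y)) (S := S.setv .prod 0)
    .prod hz' (fun _ => S.v y) fun k S' h => ?_
  · rw [Cmd.mul, Cmd.eval, Cmd.eval]
    refine this.trans ?_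
    simp [St.setv_v, mul_comm]
  · have h1 := h.v y (by simp [Cmd.vars, hy, hy'])
    rw [St.setv_v, if_neg hy', St.setv_v, if_neg hy] at h1
    simp [Cmd.eval, St.setv_v, hy', h1]

end LoopLang

/-! ### The programs -/

namespace Solver

open LoopLang LoopLang.Expr

/-- The processing time of a job. -/
def proc (x : Var) : Expr := .inp (.var .offP + x)

/-- The entry of a job in the partial schedule at the head of the queue. -/
def cur (x : Var) : Expr := .get .queue (.var .head + x)

/-- The entry of a job in the candidate for the next partial schedule, behind the queue. -/
def new (x : Var) : Expr := .get .queue (.var .tail + x)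

/-- Whether the jobs `x` and `y` are comparable, `Var.prod` being the offset of the row of `x`. -/
def leq (y : Var) : Expr := .inp (.lit 2 + .var .prod + y)

/-- The offsets of the parts of the input. -/
def setOffsets : Cmd :=
  Cmd.mul .N .N ;; .assign .offP (.lit 2 + .var .prod) ;; .assign .offA (.var .offP + .var .N) ;;
    .assign .offR (.var .offA + .var .R)

/-- The sum of the processing times. -/
def sumProc : Cmd := .iter .j .N (.assign .P (.var .P + proc .j))

/-- Increase the approximate earliest possible starting time of the job `j` if the one of the job
`i` requires this. -/
def relaxStep : Cmd :=
  Cmd.mul .i .N ;;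
  .when (conj (leq .j) (differ (.var .i) (.var .j)))
    (.when (less (.get .es (.var .j)) (.get .es (.var .i) + proc .i))
    (.put .es (.var .j) (.get .es (.var .i) + proc .i)))

/-- As many rounds as there are jobs: after `r` rounds, the values are correct for the jobs with
fewer than `r` strict predecessors. -/
def relax : Cmd := .iter .r .N (.iter .j .N (.iter .i .N relaxStep))

/-- Search for the least `K` with `2 * P + 3 ≤ 2 ^ K`: `Var.power` is `2 ^ K`. -/
def startBits : Cmd := .assign .power (.lit 1) ;; .assign .gap (.var .P + .var .P + .lit 2)

/-- The step of this search: `Var.gap` is zero when `2 ^ K` is large enough. -/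
def nextBit : Cmd :=
  .assign .K (.var .K + .lit 1) ;; .assign .power (.var .power + .var .power) ;;
    .assign .gap (.var .P + .var .P + .lit 3 - .var .power)

/-- The queue holds the empty partial schedule. -/
def startQueue : Cmd := .assign .tail (.var .N) ;; .assign .pending (.lit 1)

/-- The clock of the partial schedule at the head of the queue. -/
def setClock : Cmd :=
  .assign .clock (.lit 0) ;;
  .iter .k .N (.when (less (.var .clock) (cur .k - .lit 1)) (.assign .clock (cur .k - .lit 1)))

/-- Whether the partial schedule at the head of the queue is complete. -/
def setComplete : Cmd :=
  .assign .ok (.lit 1) ;; .iter .k .N (.when (conj (proc .k) (cur .k).neg) (.assign .ok (.lit 0)))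

/-- The maximum completion time of the partial schedule at the head of the queue. -/
def setSpan : Cmd :=
  .assign .span (.lit 0) ;;
  .iter .k .N (.when (less (.var .span) (cur .k - .lit 1 + proc .k))
    (.assign .span (cur .k - .lit 1 + proc .k)))

/-- Keep the partial schedule at the head of the queue if it is complete and better than the best
one so far. -/
def record : Cmd :=
  .when (conj (.var .ok) (disj (neg (.var .found)) (less (.var .span) (.var .best))))
    (.assign .found (.lit 1) ;; .assign .best (.var .span) ;;
      .iter .k .N (.put .best (.var .k) (cur .k)))

/-- The next starting time, as indexed by the job `i`. -/
def setTime : Cmd :=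
  .assign .time (.var .clock) ;;
  .when (cur .i) (.when (less (.var .clock) (cur .i - .lit 1 + proc .i))
    (.assign .time (cur .i - .lit 1 + proc .i)))

/-- Write the candidate that arises by starting the job `j` behind the queue, without making it an
entry of the queue. -/
def makeNew : Cmd :=
  .iter .k .N (.put .queue (.var .tail + .var .k) (cur .k)) ;;
  .put .queue (.var .tail + .var .j) (.var .time + .lit 1)

/-- Reject the candidate if a predecessor of the job `j` is not completed in time. -/
def checkPrec : Cmd :=
  .iter .k .N (Cmd.mul .k .N ;;
    .when (conj (leq .j) (conj (differ (.var .k) (.var .j)) (conj (proc .k)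
      (disj (cur .k).neg (less (.var .time) (cur .k - .lit 1 + proc .k)))))) (.assign .ok (.lit 0)))

/-- Reject the candidate if the lag of a job that has not been started would be too large. As jobs
are started in the order of their starting times, no such job can start before `Var.time`. -/
def checkDeadline : Cmd :=
  .iter .k .N (.when (conj (proc .k) (conj (cur .k).neg
    (less (.get .es (.var .k) + .var .lam) (.var .time)))) (.assign .ok (.lit 0)))

/-- The amount of the resource `r` that the jobs of the candidate consume at `Var.time`. -/
def sumReq : Cmd :=
  .assign .acc (.lit 0) ;;
  .iter .k .N (Cmd.mul .k .R ;;
    .when (conj (new .k) (less (.var .time) (new .k - .lit 1 + proc .k)))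
    (.assign .acc (.var .acc + .inp (.var .offR + .var .prod + .var .r))))

/-- Reject the candidate if it needs too much of some resource at `Var.time`. -/
def checkRes : Cmd :=
  .iter .r .R (sumReq ;;
    .when (less (.inp (.var .offA + .var .r)) (.var .acc)) (.assign .ok (.lit 0)))

/-- The three tests together. -/
def checkAll : Cmd := .assign .ok (.lit 1) ;; checkPrec ;; checkDeadline ;; checkRes

/-- The code of the candidate, whose clock is `Var.time`. -/
def setCode : Cmd :=
  .assign .code (.var .time) ;;
  .iter .k .N (.iter .r .K (.assign .code (.var .code + .var .code)) ;;
    .when (new .k) (.ite (less (.var .time) (new .k - .lit 1 + proc .k))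
      (.assign .code (.var .code + (new .k + .lit 1))) (.assign .code (.var .code + .lit 1))))

/-- Make the candidate an entry of the queue unless its code has been seen. -/
def push : Cmd :=
  .when (neg (.get .seen (.var .code))) (.put .seen (.var .code) (.lit 1) ;;
    .assign .tail (.var .tail + .var .N) ;; .assign .pending (.var .pending + .lit 1))

/-- Start the job `j` next, at the time indexed by the job `i`, if this is possible. -/
def tryStart : Cmd :=
  .when (conj (proc .j) (cur .j).neg)
    (setTime ;; makeNew ;; checkAll ;;
      .when (.var .ok) (setCode ;; push))

/-- Try all jobs and all next starting times. -/
def expand : Cmd := .iter .j .N (.iter .i .N tryStart)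

/-- Treat the partial schedule at the head of the queue. -/
def visit : Cmd :=
  setClock ;; setComplete ;; setSpan ;; record ;; expand ;;
    .assign .head (.var .head + .var .N) ;; .assign .pending (.var .pending - .lit 1)

/-- The time at which all predecessors of the job `j` are completed. -/
def maxPred : Cmd :=
  .assign .span (.lit 0) ;;
  .iter .i .N (Cmd.mul .i .N ;; .when (conj (leq .j) (differ (.var .i) (.var .j)))
    (.when (less (.var .span) (.get .best (.var .i) - .lit 1 + proc .i))
      (.assign .span (.get .best (.var .i) - .lit 1 + proc .i))))

/-- Replace the array `Arr.es` by the schedule that arises from the best partial schedule when the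
jobs of length zero are added. -/
def finish : Cmd :=
  .iter .j .N (.ite (proc .j) (.put .es (.var .j) (.get .best (.var .j) - .lit 1))
    (maxPred ;; .put .es (.var .j) (.var .span)))

/-- Write the resulting schedule to the first memory cells. -/
def output : Cmd := .iter .j .N (.emit (.var .j) (.get .es (.var .j)))

/-! ### The input -/

/-- The state holds the instance `I`. -/
structure Input (I : RCPSP) (S : St) : Prop where
  N : S.v .N = I.numJobs
  R : S.v .R = I.numRes
  le : ∀ i j : Fin I.numJobs, S.inp (2 + i * I.numJobs + j) ≠ 0 ↔ I.le i j
  proc : ∀ j : Fin I.numJobs, S.inp (S.v .offP + j) = I.proc j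
  avail : ∀ ρ : Fin I.numRes, S.inp (S.v .offA + ρ) = I.avail ρ
  req : ∀ (j : Fin I.numJobs) (ρ : Fin I.numRes),
    S.inp (S.v .offR + j * I.numRes + ρ) = I.req j ρ

theorem Input.agree {I : RCPSP} {S S' : St} {V : List Var} {A : List Arr} (h : Input I S)
    (hS : Agree V A false S S') (hV : ∀ x ∈ [Var.N, .R, .offP, .offA, .offR], x ∉ V) :
    Input I S' := by
  have h1 : ∀ x ∈ [Var.N, .R, .offP, .offA, .offR], S'.v x = S.v x := fun x hx =>
    hS.v x (hV x hx)
  have hi := hS.inp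
  refine ⟨?_, ?_, ?_, ?_, ?_, ?_⟩
  · rw [h1 _ (by simp), h.N]
  · rw [h1 _ (by simp), h.R]
  · intro i j; rw [hi]; exact h.le i j
  · intro j; rw [hi, h1 _ (by simp)]; exact h.proc j
  · intro j; rw [hi, h1 _ (by simp)]; exact h.avail j
  · intro j ρ; rw [hi, h1 _ (by simp)]; exact h.req j ρ

/-- The state holds the instance `I`, the bound `lam` on the lag, the earliest possible starting
times, the partial schedule `f` at the head of the queue, and its clock. -/
structure Head (I : RCPSP) (lam : ℕ) (f : Fin I.numJobs → ℕ) (S : St) : Prop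
    extends Input I S where
  lam : S.v .lam = lam
  clock : S.v .clock = I.clock f
  es : ∀ k : Fin I.numJobs, S.a .es k = I.earliest k
  cur : ∀ k : Fin I.numJobs, S.a .queue (S.v .head + k) = f k

theorem Head.agree {I : RCPSP} {lam : ℕ} {f : Fin I.numJobs → ℕ} {S S' : St} {V : List Var}
    {A : List Arr} (h : Head I lam f S) (hS : Agree V A false S S')
    (hV : ∀ x ∈ [Var.N, .R, .offP, .offA, .offR, .lam, .clock, .head], x ∉ V) (hes : Arr.es ∉ A)
    (hcur : ∀ k : Fin I.numJobs, S'.a .queue (S.v .head + k) = S.a .queue (S.v .head + k)) :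
    Head I lam f S' := by
  have h1 : ∀ x ∈ [Var.lam, .clock, .head], S'.v x = S.v x := fun x hx =>
    hS.v x (hV x (by simp at hx ⊢; tauto))
  refine ⟨h.toInput.agree hS fun x hx => hV x (by simp at hx ⊢; tauto), ?_, ?_, ?_, ?_⟩
  · rw [h1 _ (by simp), h.lam]
  · rw [h1 _ (by simp), h.clock]
  · intro k; rw [hS.a _ hes, h.es]
  · intro k; rw [h1 _ (by simp), hcur, h.cur]

/-- The state holds, in addition, the job `J`, the time `t`, and the candidate that arises from `f`
by starting `J` at `t`. -/
structure Candidate (I : RCPSP) (lam : ℕ) (f : Fin I.numJobs → ℕ) (J : Fin I.numJobs) (t : ℕ)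
    (S : St) : Prop extends Head I lam f S where
  j : S.v .j = J
  time : S.v .time = t
  new : ∀ k : Fin I.numJobs, S.a .queue (S.v .tail + k) = Function.update f J (t + 1) k

theorem Candidate.agree {I : RCPSP} {lam : ℕ} {f : Fin I.numJobs → ℕ} {j : Fin I.numJobs} {t : ℕ}
    {S S' : St} {V : List Var} {A : List Arr} (h : Candidate I lam f j t S)
    (hS : Agree V A false S S') (hV : ∀ x ∈ [Var.N, .R, .offP, .offA, .offR, .lam, .clock, .head,
      .j, .time, .tail], x ∉ V) (hes : Arr.es ∉ A) (hq : Arr.queue ∉ A) :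
    Candidate I lam f j t S' := by
  have h1 : ∀ x ∈ [Var.j, .time, .tail], S'.v x = S.v x := fun x hx =>
    hS.v x (hV x (by simp at hx ⊢; tauto))
  refine ⟨h.toHead.agree hS (fun x hx => hV x (by simp at hx ⊢; tauto)) hes fun k => by
    rw [hS.a _ hq], ?_, ?_, ?_⟩
  · rw [h1 _ (by simp), h.j]
  · rw [h1 _ (by simp), h.time]
  · intro k; rw [hS.a _ hq, h1 _ (by simp), h.new]

attribute [simp] Cmd.eval Cmd.when proc cur new leq St.setv_v St.seta_a

/-! ### Tests of a candidate -/

section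

variable {I : RCPSP} {lam : ℕ} {f : Fin I.numJobs → ℕ} {j : Fin I.numJobs} {t : ℕ} {S : St}

theorem checkPrec_eval (h : Candidate I lam f j t S) :
    (checkPrec.eval S).v .ok ≠ 0 ↔ (∀ i, ¬ (I.lt i j ∧ 0 < I.proc i ∧
      (f i = 0 ∨ t < f i - 1 + I.proc i))) ∧ S.v .ok ≠ 0 := by
  refine iter_check .ok h.N _ fun k S' hS' => ?_
  have hk : (S'.setv .k k).v .k = k := by simp
  have hok : (S'.setv .k k).v .ok = S'.v .ok := by simp
  rw [← hok]
  generalize S'.setv .k k = S₁ at *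
  have h₁ := h.agree hS' (by decide) (by decide) (by decide)
  have hm := Cmd.mul_eval .k .N S₁ (by decide) (by decide) (by decide)
  have hag := (Cmd.mul .k .N).agree S₁
  have h₂ := h₁.agree hag (by decide) (by decide) (by decide)
  have hk₂ := hag.v .k (by decide)
  have hok₂ := hag.v .ok (by decide)
  rw [Cmd.eval]
  generalize (Cmd.mul .k .N).eval S₁ = S₂ at *
  rw [hk, h₁.N] at hm
  rw [hk] at hk₂
  have e1 : ¬ S₂.inp _ = 0 ↔ _ := h₂.le k j
  have e2 := h₂.proc k
  have e3 := h₂.cur k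
  have e4 : ¬ (k : ℕ) = j ↔ k ≠ j := by rw [ne_eq, Fin.ext_iff]
  rw [← hok₂]
  refine Cmd.reset_eval .ok ?_
  simp only [proc, cur, leq, ne_eq, eval_conj, eval_disj, eval_neg, eval_differ,
    eval_less, eval_inp, eval_get, eval_add, eval_var, eval_lit, eval_sub, hk₂, h₂.j, h₂.time, hm,
    e1, e2, e3, e4, not_not, RCPSP.lt, Nat.pos_iff_ne_zero, and_assoc]

theorem checkDeadline_eval (h : Candidate I lam f j t S) :
    (checkDeadline.eval S).v .ok ≠ 0 ↔
      (∀ k, ¬ (0 < I.proc k ∧ f k = 0 ∧ I.earliest k + lam < t)) ∧ S.v .ok ≠ 0 := by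
  refine iter_check .ok h.N _ fun k S' hS' => ?_
  have hk : (S'.setv .k k).v .k = k := by simp
  have hok : (S'.setv .k k).v .ok = S'.v .ok := by simp
  rw [← hok]
  generalize S'.setv .k k = S₁ at *
  have h₁ := h.agree hS' (by decide) (by decide) (by decide)
  have e2 := h₁.proc k
  have e3 := h₁.cur k
  have e4 := h₁.es k
  refine Cmd.reset_eval .ok ?_
  simp only [proc, cur, ne_eq, eval_conj, eval_neg, eval_less, eval_inp,
    eval_get, eval_add, eval_var, hk, h₁.time, h₁.lam, e2, e3, e4, not_not,
    Nat.pos_iff_ne_zero]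

theorem sumReq_eval (h : Candidate I lam f j t S) (ρ : Fin I.numRes) (hρ : S.v .r = ρ) :
    (sumReq.eval S).v .acc = ∑ k, (if Function.update f j (t + 1) k ≠ 0 ∧
      t < Function.update f j (t + 1) k - 1 + I.proc k then I.req k ρ else 0) := by
  have h₀ := h.agree (Agree.setv (V := [.acc]) (A := []) (o := false) 0 (x := .acc) (by simp))
    (by decide) (by decide) (by decide)
  have hρ₀ : (S.setv .acc 0).v .r = ρ := by simp [hρ]
  have ha₀ : (S.setv .acc 0).v .acc = 0 := by simp
  rw [sumReq, Cmd.eval, Cmd.eval, eval_lit]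
  generalize S.setv .acc 0 = S₀ at *
  refine (iter_sum .acc h₀.N _ fun k S' hS' => ?_).trans (by rw [ha₀, zero_add])
  have hk : (S'.setv .k k).v .k = k := by simp
  have hok : (S'.setv .k k).v .acc = S'.v .acc := by simp
  rw [← hok]
  generalize S'.setv .k k = S₁ at *
  have h₁ := h₀.agree hS' (by decide) (by decide) (by decide)
  have hρ₁ := hS'.v .r (by decide)
  have hm := Cmd.mul_eval .k .R S₁ (by decide) (by decide) (by decide)
  have hag := (Cmd.mul .k .R).agree S₁
  have h₂ := h₁.agree hag (by decide) (by decide) (by decide)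
  have hk₂ := hag.v .k (by decide)
  have hρ₂ := hag.v .r (by decide)
  have hok₂ := hag.v .acc (by decide)
  rw [Cmd.eval]
  generalize (Cmd.mul .k .R).eval S₁ = S₂ at *
  rw [hk, h₁.R] at hm
  rw [hk] at hk₂
  rw [hρ₁, hρ₀] at hρ₂
  have e1 := h₂.req k ρ
  have e2 := h₂.proc k
  have e3 := h₂.new k
  simp only [Cmd.when, Cmd.eval, proc, new, ne_eq, eval_conj,
    eval_less, eval_inp, eval_get, eval_add, eval_var, eval_lit, eval_sub, hk₂, h₂.time, hm,
    hρ₂, e1, e2, e3, not_not]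
  split_ifs with hc
  · simp [hok₂]
  · simp [hok₂]

theorem checkRes_eval (h : Candidate I lam f j t S) :
    (checkRes.eval S).v .ok ≠ 0 ↔
      (∀ ρ, ¬ I.avail ρ < ∑ k, (if Function.update f j (t + 1) k ≠ 0 ∧
        t < Function.update f j (t + 1) k - 1 + I.proc k then I.req k ρ else 0)) ∧
      S.v .ok ≠ 0 := by
  refine iter_check .ok h.R _ fun ρ S' hS' => ?_
  have hk : (S'.setv .r ρ).v .r = ρ := by simp
  have hok : (S'.setv .r ρ).v .ok = S'.v .ok := by simp
  rw [← hok]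
  generalize S'.setv .r ρ = S₁ at *
  have h₁ := h.agree hS' (by decide) (by decide) (by decide)
  have hm := sumReq_eval h₁ ρ hk
  have hag := sumReq.agree S₁
  have h₂ := h₁.agree hag (by decide) (by decide) (by decide)
  have hk₂ := hag.v .r (by decide)
  have hok₂ := hag.v .ok (by decide)
  rw [Cmd.eval]
  generalize sumReq.eval S₁ = S₂ at *
  rw [hk] at hk₂
  have e1 := h₂.avail ρ
  rw [← hok₂]
  refine Cmd.reset_eval .ok ?_
  simp only [ne_eq, eval_less, eval_inp, eval_add, eval_var, hk₂, hm,
    e1, not_not]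

theorem checkAll_eval (h : Candidate I lam f j t S) (hpos : 0 < I.proc j) (hj : f j = 0) :
    (checkAll.eval S).v .ok ≠ 0 ↔ I.Admissible lam f j t := by
  have h₀ := h.agree (Agree.setv (V := [.ok]) (A := []) (o := false) 1 (x := .ok) (by simp))
    (by decide) (by decide) (by decide)
  have hok₀ : (S.setv .ok 1).v .ok = 1 := by simp
  simp only [checkAll, Cmd.eval, eval_lit]
  generalize S.setv .ok 1 = S₀ at *
  have h₁ := h₀.agree (checkPrec.agree S₀) (by decide) (by decide) (by decide)
  have h₂ := h₁.agree (checkDeadline.agree _) (by decide) (by decide) (by decide)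
  rw [checkRes_eval h₂, checkDeadline_eval h₁, checkPrec_eval h₀, hok₀]
  constructor
  · rintro ⟨h3, h4, h5, -⟩
    refine ⟨hpos, hj, fun i hi hi0 => ?_, fun k hk hk0 => ?_, fun ρ => not_lt.1 (h3 ρ)⟩
    · have := h5 i
      simp only [hi, hi0, true_and] at this
      omega
    · have := h4 k
      simp only [hk, hk0, true_and] at this
      omega
  · rintro ⟨-, -, h3, h4, h5⟩
    refine ⟨fun ρ => not_lt.2 (h5 ρ), fun k hk => ?_, fun i hi => ?_, by simp⟩
    · have := h4 k hk.1 hk.2.1; omega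
    · have := h3 i hi.1 hi.2.1; omega

end

end Solver

/-! ### Codes of partial schedules -/

namespace RCPSP

/-- Append the digits `d (k - 1)`, …, `d 0` to the number `c` in the base `B`. -/
def enc (B : ℕ) (d : ℕ → ℕ) : ℕ → ℕ → ℕ
  | 0, c => c
  | k + 1, c => enc B d k (c * B + d k)

theorem enc_inj {B : ℕ} {d e : ℕ → ℕ} (n : ℕ) (hd : ∀ k < n, d k < B) (he : ∀ k < n, e k < B)
    {a b : ℕ} (h : enc B d n a = enc B e n b) : a = b ∧ ∀ k < n, d k = e k := by
  induction n generalizing a b with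
  | zero => exact ⟨h, fun k hk => absurd hk (Nat.not_lt_zero k)⟩
  | succ n ih =>
    obtain ⟨h1, h2⟩ := ih (fun k hk => hd k (by omega)) (fun k hk => he k (by omega)) h
    have h3 := hd n (by omega)
    have h4 := he n (by omega)
    have h5 : a = b := by
      have := congrArg (· / B) h1
      simpa [Nat.add_div_of_dvd_right, Nat.div_eq_of_lt h3, Nat.div_eq_of_lt h4,
        Nat.mul_div_cancel _ (by omega : 0 < B)] using this
    subst h5
    refine ⟨rfl, fun k hk => ?_⟩
    rcases Nat.lt_succ_iff_lt_or_eq.1 hk with hk | rfl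
    · exact h2 k hk
    · omega

/-- A number that represents a partial schedule up to equivalence: its clock, followed by the
`digit`s of the jobs in the base `2 ^ K`. -/
def code (I : RCPSP) (K : ℕ) (f : Fin I.numJobs → ℕ) : ℕ :=
  enc (2 ^ K) (fun k => if h : k < I.numJobs then I.digit f ⟨k, h⟩ else 0) I.numJobs (I.clock f)

theorem equivalent_of_code_eq {I : RCPSP} {K : ℕ} {f g : Fin I.numJobs → ℕ}
    (hf : ∀ k, I.digit f k < 2 ^ K) (hg : ∀ k, I.digit g k < 2 ^ K)
    (h : I.code K f = I.code K g) : I.Equivalent f g := by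
  obtain ⟨h1, h2⟩ := enc_inj _ (fun k hk => by simpa [hk] using hf ⟨k, hk⟩)
    (fun k hk => by simpa [hk] using hg ⟨k, hk⟩) h
  exact ⟨h1, fun k => by simpa using h2 k k.2⟩

theorem Equivalent.code_eq {I : RCPSP} {f g : Fin I.numJobs → ℕ} (h : I.Equivalent f g) (K : ℕ) :
    I.code K f = I.code K g := by
  unfold code
  rw [h.1]
  congr 1
  funext k
  split_ifs
  · exact h.2 _
  · rfl

theorem Valid.le_sum {I : RCPSP} {lam : ℕ} {f : Fin I.numJobs → ℕ} (h : I.Valid lam f)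
    (hlam : lam ≤ ∑ i, I.proc i) (k : Fin I.numJobs) : f k - 1 ≤ 2 * ∑ i, I.proc i := by
  by_cases hk : f k = 0
  · omega
  · have := h.lag k hk
    have := I.earliest_le_sum k
    omega

theorem Valid.clock_le_sum {I : RCPSP} {lam : ℕ} {f : Fin I.numJobs → ℕ} (h : I.Valid lam f)
    (hlam : lam ≤ ∑ i, I.proc i) : I.clock f ≤ 2 * ∑ i, I.proc i :=
  Finset.sup_le fun k _ => h.le_sum hlam k

theorem proc_le_sum (I : RCPSP) (k : Fin I.numJobs) : I.proc k ≤ ∑ i, I.proc i :=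
  Finset.single_le_sum (fun _ _ => Nat.zero_le _) (Finset.mem_univ k)

theorem Valid.nextTime_le_sum {I : RCPSP} {lam : ℕ} {f : Fin I.numJobs → ℕ} (h : I.Valid lam f)
    (hlam : lam ≤ ∑ i, I.proc i) (k : Fin I.numJobs) : I.nextTime f k ≤ 3 * ∑ i, I.proc i := by
  have h1 := h.clock_le_sum hlam
  have h2 := h.le_sum hlam k
  have h3 := I.proc_le_sum k
  unfold nextTime
  split_ifs
  · omega
  · exact max_le (by omega) (by omega)

theorem Valid.span_le_sum {I : RCPSP} {lam : ℕ} {f : Fin I.numJobs → ℕ} (h : I.Valid lam f)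
    (hlam : lam ≤ ∑ i, I.proc i) : I.span f ≤ 3 * ∑ i, I.proc i :=
  Finset.sup_le fun k _ => by
    have h2 := h.le_sum hlam k
    have h3 := I.proc_le_sum k
    omega

theorem Valid.digit_lt {I : RCPSP} {lam K : ℕ} {f : Fin I.numJobs → ℕ} (h : I.Valid lam f)
    (hlam : lam ≤ ∑ i, I.proc i) (hK : 2 * ∑ i, I.proc i + 3 ≤ 2 ^ K) (k : Fin I.numJobs) :
    I.digit f k < 2 ^ K := by
  have := h.le_sum hlam k
  unfold digit
  split_ifs <;> omega

end RCPSP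

/-! ### Making and storing a candidate -/

namespace Solver

open LoopLang LoopLang.Expr

section

variable {I : RCPSP} {lam : ℕ} {f : Fin I.numJobs → ℕ} {J : Fin I.numJobs} {t : ℕ} {S : St}

theorem setTime_eval (h : Head I lam f S) {i : Fin I.numJobs} (hi : S.v .i = i) :
    (setTime.eval S).v .time = I.nextTime f i := by
  have e2 := h.proc i
  have e3 := h.cur i
  by_cases h0 : f i = 0
  · simp [setTime, RCPSP.nextTime, hi, e3, h0, h.clock]
  · by_cases hc : I.clock f < f i - 1 + I.proc i
    · simp [setTime, RCPSP.nextTime, hi, e2, e3, h0, h.clock, hc, hc.le]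
    · simp [setTime, RCPSP.nextTime, hi, e2, e3, h0, h.clock, hc, not_lt.1 hc]

/-- The candidate is written behind the queue, which does not change. -/
theorem makeNew_eval (h : Head I lam f S) (hj : S.v .j = J) (ht : S.v .time = t)
    (hd : S.v .head + I.numJobs ≤ S.v .tail) :
    Candidate I lam f J t (makeNew.eval S) ∧
      (∀ i < S.v .tail, (makeNew.eval S).a .queue i = S.a .queue i) ∧
      ∀ M, (∀ i, S.a .queue i ≤ M) → t + 1 ≤ M → ∀ i, (makeNew.eval S).a .queue i ≤ M := by
  have hput := iter_put .queue (x := .k) (n := .N)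
    (b := .put .queue (.var .tail + .var .k) (cur .k)) h.N (S.v .tail) f fun k S' hS' hq i => by
      have hk : (S'.setv .k k).v .k = k := by simp
      have ha : S'.a .queue = (S'.setv .k k).a .queue := by simp
      rw [ha] at hq ⊢
      generalize S'.setv .k k = S₁ at *
      have h₁ := h.agree hS' (by decide) (by decide) fun l => hq _ (by omega)
      have ht := hS'.v .tail (by decide)
      simp [h₁.cur k, hk, ht]
  have hag := (Cmd.iter .k .N (.put .queue (.var .tail + .var .k) (cur .k))).agree S
  have htl := hag.v .tail (by decide)
  have hj₁ := hag.v .j (by decide)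
  have ht₁ := hag.v .time (by decide)
  rw [makeNew, Cmd.eval]
  generalize (Cmd.iter .k .N (.put .queue (.var .tail + .var .k) (cur .k))).eval S = S₁ at *
  have h₁ : Head I lam f S₁ := h.agree hag (by decide) (by decide) fun l => hput.2 _ (by omega)
  rw [ht] at ht₁
  rw [hj] at hj₁
  simp only [Cmd.eval, eval_add, eval_var, eval_lit, htl, hj₁, ht₁]
  refine ⟨⟨⟨⟨h₁.N, h₁.R, h₁.le, h₁.proc, h₁.avail, h₁.req⟩, h₁.lam, h₁.clock, h₁.es, ?_⟩, hj₁,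
    ht₁, ?_⟩, fun i hi => ?_, fun M hM htM i => ?_⟩
  · intro k
    rw [St.seta_v, St.seta_a, if_neg, h₁.cur]
    have := hag.v .head (by decide)
    have := k.isLt
    omega
  · intro k
    rw [St.seta_v, St.seta_a, htl]
    by_cases hk : k = J
    · rw [if_pos ⟨rfl, by rw [hk]⟩, hk, Function.update_self]
    · rw [if_neg, Function.update_of_ne hk, hput.1]
      rintro ⟨-, h'⟩
      exact hk (Fin.ext (by omega))
  · rw [St.seta_a, if_neg (by omega)]
    exact hput.2 i (.inl hi)
  · rw [St.seta_a]
    split_ifs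
    · exact htM
    · by_cases hi : i < S.v .tail ∨ S.v .tail + I.numJobs ≤ i
      · rw [hput.2 i hi]; exact hM i
      · have := hput.1 ⟨i - S.v .tail, by omega⟩
        rw [show S.v .tail + (i - S.v .tail) = i by omega] at this
        rw [this, ← h.cur]
        exact hM _

theorem setCode_eval (h : Candidate I lam f J t S)
    (hclock : I.clock (Function.update f J (t + 1)) = t) :
    (setCode.eval S).v .code = I.code (S.v .K) (Function.update f J (t + 1)) := by
  obtain ⟨g, hg⟩ : ∃ g, g = Function.update f J (t + 1) := ⟨_, rfl⟩
  have h₀ := h.agree (Agree.setv (V := [.code]) (A := []) (o := false) t (x := .code) (by simp))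
    (by decide) (by decide) (by decide)
  have hc₀ : (S.setv .code t).v .code = t := by simp
  have hK₀ : (S.setv .code t).v .K = S.v .K := by simp
  rw [setCode, Cmd.eval, Cmd.eval, eval_var, h.time]
  rw [← hK₀]
  generalize S.setv .code t = S₀ at *
  have key := iter_induction .k .N (.iter .r .K (.assign .code (.var .code + .var .code)) ;;
    .when (new .k) (.ite (less (.var .time) (new .k - .lit 1 + proc .k))
      (.assign .code (.var .code + (new .k + .lit 1)))
      (.assign .code (.var .code + .lit 1)))) S₀
    (fun l S' => RCPSP.enc (2 ^ S₀.v .K)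
      (fun k => if h : k < I.numJobs then I.digit g ⟨k, h⟩ else 0) l (S'.v .code) =
      I.code (S₀.v .K) g) ?_ ?_
  · rw [← hg]; exact key
  · rw [h₀.N, hc₀, RCPSP.code, hg, hclock]
  · intro k hk S' hS' hP
    rw [h₀.N] at hk
    have hS'' := hS'.trans (Agree.setv (V := _) (A := _) (o := _) k (x := .k) (by simp))
    have hk₁ : (S'.setv .k k).v .k = k := by simp
    have hc₁ : (S'.setv .k k).v .code = S'.v .code := by simp
    rw [← hc₁] at hP
    generalize S'.setv .k k = S₁ at *
    have h₁ := h₀.agree hS'' (by decide) (by decide) (by decide)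
    have hK₁ := hS''.v .K (by decide)
    have hmul := iter_induction .r .K (.assign .code (.var .code + .var .code)) S₁
      (fun l S' => S'.v .code * 2 ^ l = S₁.v .code * 2 ^ S₁.v .K) rfl (by
        intro l _ S' _ hS
        rw [← hS]
        simp [pow_succ]
        ring)
    have hag := (Cmd.iter .r .K (.assign .code (.var .code + .var .code))).agree S₁
    rw [Cmd.eval]
    generalize (Cmd.iter .r .K (.assign .code (.var .code + .var .code))).eval S₁ = S₂ at *
    have h₂ := h₁.agree hag (by decide) (by decide) (by decide)
    have hk₂ := hag.v .k (by decide)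
    rw [hk₁] at hk₂
    rw [pow_zero, mul_one, hK₁] at hmul
    have e1 := h₂.new ⟨k, hk⟩
    have e2 := h₂.proc ⟨k, hk⟩
    rw [← hP, RCPSP.enc]
    congr 1
    rw [dif_pos hk, RCPSP.digit]
    rw [← hg] at e1 hclock
    dsimp only at e1 e2
    by_cases hg0 : g ⟨k, hk⟩ = 0
    · simp [hk₂, e1, hg0, hmul]
    · by_cases hlt : t < g ⟨k, hk⟩ - 1 + I.proc ⟨k, hk⟩
      · have hlt' : ¬ g ⟨k, hk⟩ - 1 + I.proc ⟨k, hk⟩ ≤ t := not_le.2 hlt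
        simp [hk₂, e1, e2, hg0, hmul, h₂.time, hclock, hlt, hlt']
      · have hlt' : g ⟨k, hk⟩ - 1 + I.proc ⟨k, hk⟩ ≤ t := not_lt.1 hlt
        simp [hk₂, e1, e2, hg0, hmul, h₂.time, hclock, hlt, hlt']

end

/-! ### The queue -/

/-- The partial schedule with the number `q` in the queue. -/
def entry (I : RCPSP) (S : St) (q : ℕ) (k : Fin I.numJobs) : ℕ := S.a .queue (q * I.numJobs + k)

/-- The queue, of which `h` entries have been treated, holds `m` entries. All of them are reachable,
and except for the first one, which is the empty partial schedule, their codes are distinct and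
marked in the array `Arr.seen`. -/
structure Queue (I : RCPSP) (lam M h m : ℕ) (S : St) : Prop where
  pos : 0 < m
  tail : S.v .tail = m * I.numJobs
  pending : S.v .pending + h = m
  reach : ∀ q < m, Relation.ReflTransGen (I.Succ lam) 0 (entry I S q)
  zero : entry I S 0 = 0
  last : ∀ q, 0 < q → q < m → ∃ j, entry I S q j = I.clock (entry I S q) + 1
  seen_le : ∀ c, S.a .seen c ≤ 1
  seen : ∀ c, S.a .seen c ≠ 0 ↔ ∃ q, 0 < q ∧ q < m ∧ I.code (S.v .K) (entry I S q) = c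
  inj : ∀ p q, 0 < p → p < q → q < m →
    I.code (S.v .K) (entry I S p) ≠ I.code (S.v .K) (entry I S q)
  le : ∀ i, S.a .queue i ≤ M

theorem mul_add_lt_of_lt {p q n : ℕ} (h : p < q) (k : Fin n) : p * n + k < q * n := by
  have := Nat.mul_le_mul_right n h
  rw [Nat.succ_mul] at this
  have := k.isLt
  omega

section

variable {I : RCPSP} {lam M h m : ℕ} {f : Fin I.numJobs → ℕ} {J i : Fin I.numJobs} {S S' : St}

theorem entry_congr (hq : ∀ i < m * I.numJobs, S'.a .queue i = S.a .queue i) {q : ℕ} (h : q < m) :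
    entry I S' q = entry I S q :=
  funext fun k => hq _ (mul_add_lt_of_lt h k)

theorem Queue.congr (hS : Queue I lam M h m S)
    (hv : ∀ x ∈ [Var.tail, .pending, .K], S'.v x = S.v x)
    (hq : ∀ i < S.v .tail, S'.a .queue i = S.a .queue i) (hs : S'.a .seen = S.a .seen)
    (hM : ∀ i, S'.a .queue i ≤ M) : Queue I lam M h m S' := by
  rw [hS.tail] at hq
  have he : ∀ q < m, entry I S' q = entry I S q := fun q h => entry_congr hq h
  have hK : S'.v .K = S.v .K := hv _ (by simp)
  refine ⟨hS.pos, ?_, ?_, fun q hq => ?_, ?_, fun q hq0 hq => ?_, ?_, fun c => ?_,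
    fun p q hp hpq hq => ?_, hM⟩
  · rw [hv _ (by simp), hS.tail]
  · rw [hv _ (by simp), hS.pending]
  · rw [he q hq]; exact hS.reach q hq
  · rw [he 0 hS.pos]; exact hS.zero
  · rw [he q hq]; exact hS.last q hq0 hq
  · rw [hs]; exact hS.seen_le
  · rw [hs, hS.seen c, hK]
    refine exists_congr fun q => and_congr_right fun _ => and_congr_right fun hq => ?_
    rw [he q hq]
  · rw [hK, he q hq, he p (by omega)]; exact hS.inj p q hp hpq hq

/-- The queue with `m` entries in the state `S` has been extended to that in the state `S'`. -/
def Grows (I : RCPSP) (lam M h m : ℕ) (S S' : St) : Prop :=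
  ∃ m', m ≤ m' ∧ Queue I lam M h m' S' ∧ (∀ q < m, entry I S' q = entry I S q) ∧
    ∀ c, S.a .seen c ≠ 0 → S'.a .seen c ≠ 0

theorem Grows.trans {S'' : St} (h₁ : Grows I lam M h m S S')
    (h₂ : ∀ m', m ≤ m' → Queue I lam M h m' S' → Grows I lam M h m' S' S'') :
    Grows I lam M h m S S'' := by
  obtain ⟨m', hm, hq, he, hs⟩ := h₁
  obtain ⟨m'', hm', hq', he', hs'⟩ := h₂ m' hm hq
  exact ⟨m'', hm.trans hm', hq', fun q hq => (he' q (by omega)).trans (he q hq),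
    fun c hc => hs' c (hs c hc)⟩

/-- Whether or not the candidate is added to the queue, its code is marked afterwards. -/
theorem push_eval {t : ℕ} (hf : Relation.ReflTransGen (I.Succ lam) 0 (Function.update f J (t + 1)))
    (hclock : I.clock (Function.update f J (t + 1)) = t) (hc : Candidate I lam f J t S)
    (hq : Queue I lam M h m S)
    (hcode : S.v .code = I.code (S.v .K) (Function.update f J (t + 1))) :
    Grows I lam M h m S (push.eval S) ∧
      (push.eval S).a .seen (I.code (S.v .K) (Function.update f J (t + 1))) ≠ 0 := by
  by_cases hs : S.a .seen (S.v .code) = 0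
  swap
  · have : push.eval S = S := Cmd.when_of_eq_zero (by simp [hs]) _
    rw [this, ← hcode]
    exact ⟨⟨m, le_rfl, hq, fun _ _ => rfl, fun _ => id⟩, hs⟩
  obtain ⟨S₁, hS₁⟩ : ∃ S₁, S₁ = push.eval S := ⟨_, rfl⟩
  rw [← hS₁]
  rw [push, Cmd.when_of_ne_zero (by simp [hs])] at hS₁
  have hv : ∀ x, S₁.v x = if x = .pending then S.v .pending + 1 else if x = .tail then
      S.v .tail + I.numJobs else S.v x := by
    intro x
    simp [hS₁, hc.N]
  have ha : S₁.a .queue = S.a .queue := by simp [hS₁, St.seta]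
  have hseen : ∀ c, S₁.a .seen c = if c = S.v .code then 1 else S.a .seen c := by
    intro c; simp [hS₁]
  have hK : S₁.v .K = S.v .K := by simp [hv]
  have he : ∀ q, entry I S₁ q = entry I S q := fun q => funext fun k => by rw [entry, ha, entry]
  have hm : entry I S m = Function.update f J (t + 1) := funext fun k => by
    rw [← hc.new k, entry, hq.tail]
  refine ⟨⟨m + 1, Nat.le_succ m, ⟨Nat.succ_pos m, ?_, ?_, fun q h => ?_, ?_, fun q h0 h => ?_,
    fun c => ?_, fun c => ?_, fun p q hp hpq h => ?_, ?_⟩, fun q _ => he q, fun c => ?_⟩, ?_⟩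
  · simp [hv, hq.tail, Nat.succ_mul]
  · have := hq.pending; simp [hv]; omega
  · rw [he]
    rcases Nat.lt_succ_iff_lt_or_eq.1 h with h | rfl
    · exact hq.reach q h
    · rw [hm]; exact hf
  · rw [he]; exact hq.zero
  · rw [he]
    rcases Nat.lt_succ_iff_lt_or_eq.1 h with h | rfl
    · exact hq.last q h0 h
    · rw [hm, hclock]; exact ⟨J, by simp⟩
  · rw [hseen]
    split_ifs
    · exact le_rfl
    · exact hq.seen_le c
  · rw [hseen]
    split_ifs with h
    · refine iff_of_true one_ne_zero ⟨m, hq.pos, Nat.lt_succ_self m, ?_⟩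
      rw [he, hm, hK, h, hcode]
    · rw [hq.seen c]
      constructor
      · rintro ⟨q, h0, h1, h2⟩
        exact ⟨q, h0, by omega, by rw [hK, he, h2]⟩
      · rintro ⟨q, h0, h1, h2⟩
        rw [hK, he] at h2
        rcases Nat.lt_succ_iff_lt_or_eq.1 h1 with h1 | rfl
        · exact ⟨q, h0, h1, h2⟩
        · exact absurd (by rw [← h2, hm, hcode]) h
  · rw [hK, he, he]
    rcases Nat.lt_succ_iff_lt_or_eq.1 h with h | rfl
    · exact hq.inj p q hp hpq h
    · rw [hm, ← hcode]
      intro h'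
      exact (hq.seen _).2 ⟨p, hp, hpq, h'⟩ hs
  · rw [ha]; exact hq.le
  · rw [hseen]
    split_ifs
    · exact fun _ => one_ne_zero
    · exact id
  · rw [hseen, ← hcode, if_pos rfl]; exact one_ne_zero

/-- The candidate is treated correctly: the queue remains correct, and if the job can be started,
the code of the result is marked afterwards. -/
theorem tryStart_eval (hlam : lam ≤ ∑ i, I.proc i) (hM : 3 * ∑ i, I.proc i + 1 ≤ M)
    (hh : Head I lam f S) (hf : Relation.ReflTransGen (I.Succ lam) 0 f)
    (hq : Queue I lam M h m S) (hd : S.v .head + I.numJobs ≤ S.v .tail) (hj : S.v .j = J)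
    (hi : S.v .i = i) :
    Grows I lam M h m S (tryStart.eval S) ∧ (I.Admissible lam f J (I.nextTime f i) →
      (tryStart.eval S).a .seen
        (I.code (S.v .K) (Function.update f J (I.nextTime f i + 1))) ≠ 0) := by
  have e1 := hh.proc J
  have e2 := hh.cur J
  by_cases hc : 0 < I.proc J ∧ f J = 0
  swap
  · have : tryStart.eval S = S := by
      refine Cmd.when_of_eq_zero ?_ _
      simp only [proc, cur, ne_eq, eval_conj, eval_neg, eval_inp, eval_get, eval_add, eval_var, hj,
        e1, e2, not_not]
      rwa [← ne_eq, ← Nat.pos_iff_ne_zero]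
    rw [this]
    exact ⟨⟨m, le_rfl, hq, fun _ _ => rfl, fun _ => id⟩, fun h => absurd ⟨h.pos, h.unstarted⟩ hc⟩
  obtain ⟨t, ht⟩ : ∃ t, t = I.nextTime f i := ⟨_, rfl⟩
  rw [← ht]
  have htM : t + 1 ≤ M := by
    have := (RCPSP.valid_of_reach hf).nextTime_le_sum hlam i
    omega
  have hclock : I.clock (Function.update f J (t + 1)) = t :=
    I.clock_update hc.2 (ht ▸ I.clock_le_nextTime f i)
  rw [tryStart, Cmd.when_of_ne_zero]
  swap
  · simp only [proc, cur, ne_eq, eval_conj, eval_neg, eval_inp, eval_get, eval_add, eval_var, hj,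
      e1, e2, not_not]
    exact ⟨hc.1.ne', hc.2⟩
  simp only [Cmd.eval]
  -- the time
  have a₁ := setTime.agree S
  have t₁ := setTime_eval hh hi
  rw [← ht] at t₁
  have K₁ := a₁.v .K (by decide)
  have h₁ := hh.agree a₁ (by decide) (by decide) fun k => by rw [a₁.a _ (by decide)]
  have hd₁ : (setTime.eval S).v .head + I.numJobs ≤ (setTime.eval S).v .tail := by
    rwa [a₁.v .head (by decide), a₁.v .tail (by decide)]
  have j₁ := (a₁.v .j (by decide)).trans hj
  have q₁ : Queue I lam M h m (setTime.eval S) := hq.congr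
    (fun x hx => a₁.v x (by revert x hx; decide))
    (fun i _ => by rw [a₁.a _ (by decide)]) (a₁.a _ (by decide))
    (fun i => by rw [a₁.a _ (by decide)]; exact hq.le i)
  have s₁ := a₁.a .seen (by decide)
  have u₁ := a₁.a .queue (by decide)
  generalize setTime.eval S = S₁ at *
  -- the candidate
  have a₂ := makeNew.agree S₁
  obtain ⟨c₂, u₂, M₂⟩ := makeNew_eval h₁ j₁ t₁ hd₁
  have K₂ := (a₂.v .K (by decide)).trans K₁
  have q₂ : Queue I lam M h m (makeNew.eval S₁) := q₁.congr
    (fun x hx => a₂.v x (by revert x hx; decide)) u₂ (a₂.a _ (by decide)) (M₂ M q₁.le htM)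
  have s₂ := (a₂.a .seen (by decide)).trans s₁
  generalize makeNew.eval S₁ = S₂ at *
  -- the tests
  have a₃ := checkAll.agree S₂
  have ok₃ := checkAll_eval c₂ hc.1 hc.2
  have c₃ := c₂.agree a₃ (by decide) (by decide) (by decide)
  have K₃ := (a₃.v .K (by decide)).trans K₂
  have q₃ : Queue I lam M h m (checkAll.eval S₂) := q₂.congr
    (fun x hx => a₃.v x (by revert x hx; decide))
    (fun i _ => by rw [a₃.a _ (by decide)]) (a₃.a _ (by decide))
    (fun i => by rw [a₃.a _ (by decide)]; exact q₂.le i)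
  have s₃ := (a₃.a .seen (by decide)).trans s₂
  have u₃ := a₃.a .queue (by decide)
  generalize checkAll.eval S₂ = S₃ at *
  have g₃ : Grows I lam M h m S S₃ := by
    refine ⟨m, le_rfl, q₃, fun q h => entry_congr (fun i hi => ?_) h, fun c => by rw [s₃]; exact id⟩
    rw [u₃, u₂ i (by rw [q₁.tail]; exact hi), u₁]
  by_cases hok : S₃.v .ok = 0
  · have hna : ¬ I.Admissible lam f J t := fun ha => ok₃.2 ha hok
    have hw : (Cmd.when (.var .ok) (setCode ;; push)).eval S₃ = S₃ :=
      Cmd.when_of_eq_zero (e := .var .ok) hok _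
    rw [hw]
    exact ⟨g₃, fun ha => absurd ha hna⟩
  have ha := ok₃.1 hok
  have hw : (Cmd.when (.var .ok) (setCode ;; push)).eval S₃ = push.eval (setCode.eval S₃) :=
    Cmd.when_of_ne_zero (e := .var .ok) hok _
  rw [hw]
  -- the code
  have a₄ := setCode.agree S₃
  have code₄ := setCode_eval c₃ hclock
  have c₄ := c₃.agree a₄ (by decide) (by decide) (by decide)
  have K₄ := a₄.v .K (by decide)
  have q₄ : Queue I lam M h m (setCode.eval S₃) := q₃.congr
    (fun x hx => a₄.v x (by revert x hx; decide))
    (fun i _ => by rw [a₄.a _ (by decide)]) (a₄.a _ (by decide))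
    (fun i => by rw [a₄.a _ (by decide)]; exact q₃.le i)
  have g₄ : Grows I lam M h m S₃ (setCode.eval S₃) :=
    ⟨m, le_rfl, q₄, fun q h => entry_congr (fun i hi => by rw [a₄.a _ (by decide)]) h,
      fun c => by rw [a₄.a _ (by decide)]; exact id⟩
  rw [← K₄] at code₄
  rw [K₃] at K₄
  generalize setCode.eval S₃ = S₄ at *
  have hreach : Relation.ReflTransGen (I.Succ lam) 0 (Function.update f J (t + 1)) :=
    hf.tail ⟨J, i, by rwa [← ht], by rw [← ht]⟩
  have hp := fun m (q : Queue I lam M h m S₄) => push_eval hreach hclock c₄ q code₄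
  refine ⟨(g₃.trans fun m' _ q => ?_).trans fun m' _ q => (hp m' q).1, fun _ => ?_⟩
  · have : m' = m := by
      have := q.pending; have := q₃.pending; omega
    rw [this]; exact g₄
  · rw [← K₄]; exact (hp m q₄).2

end

end Solver

namespace Solver

open LoopLang LoopLang.Expr

/-! ### Treating an entry of the queue -/

section

variable {I : RCPSP} {lam M h m : ℕ} {f : Fin I.numJobs → ℕ} {S S' : St}

/-- The row at the head of the queue. -/
structure Row (I : RCPSP) (f : Fin I.numJobs → ℕ) (S : St) : Prop extends Input I S where
  cur : ∀ k : Fin I.numJobs, S.a .queue (S.v .head + k) = f k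

theorem Row.agree {V : List Var} {A : List Arr} (h : Row I f S) (hS : Agree V A false S S')
    (hV : ∀ x ∈ [Var.N, .R, .offP, .offA, .offR, .head], x ∉ V) (hq : Arr.queue ∉ A) :
    Row I f S' := by
  refine ⟨h.toInput.agree hS fun x hx => hV x (by simp at hx ⊢; tauto), fun k => ?_⟩
  rw [hS.a _ hq, hS.v _ (hV .head (by simp)), h.cur]

theorem setClock_eval (h : Row I f S) : (setClock.eval S).v .clock = I.clock f := by
  have h₀ := h.agree (Agree.setv (V := [.clock]) (A := []) (o := false) 0 (x := .clock) (by simp))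
    (by decide) (by decide)
  have ha₀ : (S.setv .clock 0).v .clock = 0 := by simp
  rw [setClock, Cmd.eval, Cmd.eval, eval_lit]
  generalize S.setv .clock 0 = S₀ at *
  refine (iter_max .clock h₀.N (fun k => f k - 1) fun k S' hS' => ?_).trans (by
    rw [ha₀, RCPSP.clock]; simp)
  have hk : (S'.setv .k k).v .k = k := by simp
  have hok : (S'.setv .k k).v .clock = S'.v .clock := by simp
  rw [← hok]
  generalize S'.setv .k k = S₁ at *
  have h₁ := h₀.agree hS' (by decide) (by decide)
  rw [Cmd.max_eval]
  simp [hk, h₁.cur k]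

theorem setSpan_eval (h : Row I f S) : (setSpan.eval S).v .span = I.span f := by
  have h₀ := h.agree (Agree.setv (V := [.span]) (A := []) (o := false) 0 (x := .span) (by simp))
    (by decide) (by decide)
  have ha₀ : (S.setv .span 0).v .span = 0 := by simp
  rw [setSpan, Cmd.eval, Cmd.eval, eval_lit]
  generalize S.setv .span 0 = S₀ at *
  refine (iter_max .span h₀.N (fun k => f k - 1 + I.proc k) fun k S' hS' => ?_).trans (by
    rw [ha₀, RCPSP.span]; simp)
  have hk : (S'.setv .k k).v .k = k := by simp
  have hok : (S'.setv .k k).v .span = S'.v .span := by simp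
  rw [← hok]
  generalize S'.setv .k k = S₁ at *
  have h₁ := h₀.agree hS' (by decide) (by decide)
  rw [Cmd.max_eval]
  simp [hk, h₁.cur k, h₁.proc k]

theorem setComplete_eval (h : Row I f S) : (setComplete.eval S).v .ok ≠ 0 ↔ I.Complete f := by
  have h₀ := h.agree (Agree.setv (V := [.ok]) (A := []) (o := false) 1 (x := .ok) (by simp))
    (by decide) (by decide)
  have ha₀ : (S.setv .ok 1).v .ok = 1 := by simp
  rw [setComplete, Cmd.eval, Cmd.eval, eval_lit]
  generalize S.setv .ok 1 = S₀ at *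
  refine (iter_check .ok h₀.N (fun k => 0 < I.proc k ∧ f k = 0) fun k S' hS' => ?_).trans ?_
  · have hk : (S'.setv .k k).v .k = k := by simp
    have hok : (S'.setv .k k).v .ok = S'.v .ok := by simp
    rw [← hok]
    generalize S'.setv .k k = S₁ at *
    have h₁ := h₀.agree hS' (by decide) (by decide)
    refine Cmd.reset_eval .ok ?_
    simp [hk, h₁.cur k, h₁.proc k, Nat.pos_iff_ne_zero]
  · rw [ha₀, RCPSP.Complete]
    simp

/-- If the partial schedule at the head of the queue is not complete or not better than the best one
so far, nothing changes, and otherwise it is stored. -/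
theorem record_eval (h : Row I f S) (hok : S.v .ok ≠ 0 ↔ I.Complete f)
    (hspan : S.v .span = I.span f) :
    (¬ (I.Complete f ∧ (S.v .found = 0 ∨ I.span f < S.v .best)) ∧ record.eval S = S) ∨
    (I.Complete f ∧ (S.v .found = 0 ∨ I.span f < S.v .best)) ∧ (record.eval S).v .found = 1 ∧
      (record.eval S).v .best = I.span f ∧
      (∀ k : Fin I.numJobs, (record.eval S).a .best k = f k) ∧
      ∀ i, I.numJobs ≤ i → (record.eval S).a .best i = S.a .best i := by
  have hcond : (conj (.var .ok) (disj (neg (.var .found)) (less (.var .span) (.var .best)))).eval S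
      ≠ 0 ↔ I.Complete f ∧ (S.v .found = 0 ∨ I.span f < S.v .best) := by
    rw [← hok]
    simp [hspan]
    intro _
    by_cases h0 : S.v .found = 0 <;> simp [h0]
  by_cases hc : I.Complete f ∧ (S.v .found = 0 ∨ I.span f < S.v .best)
  swap
  · exact .inl ⟨hc, Cmd.when_of_eq_zero (by_contra fun h' => hc (hcond.1 h')) _⟩
  refine .inr ⟨hc, ?_⟩
  rw [record, Cmd.when_of_ne_zero (hcond.2 hc), Cmd.eval, Cmd.eval, Cmd.eval, Cmd.eval]
  have hag : Agree [.found, .best] [] false S ((S.setv .found 1).setv .best (I.span f)) :=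
    (Agree.setv 1 (by simp)).trans (Agree.setv _ (by simp))
  have h₀ := h.agree hag (by decide) (by decide)
  have hf₀ : ((S.setv .found 1).setv .best (I.span f)).v .found = 1 := by simp
  have hb₀ : ((S.setv .found 1).setv .best (I.span f)).v .best = I.span f := by simp
  have hs₀ : (Expr.var .span).eval (S.setv .found 1) = I.span f := by simp [hspan]
  rw [eval_lit, hs₀]
  have ha₀ : ((S.setv .found 1).setv .best (I.span f)).a .best = S.a .best := rfl
  generalize (S.setv .found 1).setv .best (I.span f) = S₀ at *
  have hag' := (Cmd.iter .k .N (.put .best (.var .k) (Solver.cur .k))).agree S₀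
  have hput := iter_put .best (x := .k) (n := .N)
    (b := .put .best (.var .k) (Solver.cur .k)) h₀.N 0 f fun k S' hS' hq i => by
      have hk : (S'.setv .k k).v .k = k := by simp
      have ha : S'.a .best = (S'.setv .k k).a .best := by simp
      rw [ha] at hq ⊢
      generalize S'.setv .k k = S₁ at *
      have h₁ := h₀.agree hS' (by decide) (by decide)
      simp [h₁.cur k, hk]
  refine ⟨?_, ?_, ?_, fun i hi => ?_⟩
  · rw [hag'.v _ (by decide), hf₀]
  · rw [hag'.v _ (by decide), hb₀]
  · intro k
    have := hput.1 k
    rwa [zero_add] at this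
  · rw [hput.2 i (.inr (by omega)), ha₀]

/-- All successors of the partial schedule at the head of the queue are marked afterwards. -/
theorem expand_eval (hlam : lam ≤ ∑ i, I.proc i) (hM : 3 * ∑ i, I.proc i + 1 ≤ M)
    (hh : Head I lam f S) (hf : Relation.ReflTransGen (I.Succ lam) 0 f)
    (hq : Queue I lam M h m S) (hhm : h < m) (hhead : S.v .head = h * I.numJobs) :
    Grows I lam M h m S (expand.eval S) ∧ ∀ J i, I.Admissible lam f J (I.nextTime f i) →
      (expand.eval S).a .seen
        (I.code (S.v .K) (Function.update f J (I.nextTime f i + 1))) ≠ 0 := by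
  have key : ∀ S' : St, Agree expand.vars expand.arrs expand.emits S S' → Grows I lam M h m S S' →
      Head I lam f S' ∧ S'.v .head + I.numJobs ≤ S'.v .tail ∧ S'.v .K = S.v .K := by
    intro S' hS' ⟨m', hm, hq', he, _⟩
    refine ⟨hh.agree hS' (by decide) (by decide) fun k => ?_, ?_, hS'.v .K (by decide)⟩
    · rw [hhead]
      exact congrFun (he h hhm) k
    · rw [hS'.v .head (by decide), hhead, hq'.tail, ← Nat.succ_mul]
      exact Nat.mul_le_mul_right _ (by omega)
  have main := iter_induction .j .N (.iter .i .N tryStart) S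
    (fun l S' => Agree expand.vars expand.arrs expand.emits S S' ∧ Grows I lam M h m S S' ∧
      ∀ J i : Fin I.numJobs, l ≤ J → I.Admissible lam f J (I.nextTime f i) →
      S'.a .seen (I.code (S.v .K) (Function.update f J (I.nextTime f i + 1))) ≠ 0) ?_ ?_
  · exact ⟨main.2.1, fun J i => main.2.2 J i (Nat.zero_le _)⟩
  · refine ⟨.refl _ _ _ _, ⟨m, le_rfl, hq, fun _ _ => rfl, fun _ => id⟩, fun J _ hJ => ?_⟩
    rw [hh.N] at hJ
    have := J.isLt
    omega
  intro l hl S' hS' ⟨_, hgS, hadm⟩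
  rw [hh.N] at hl
  have hagS := hS'.trans (Agree.setv (V := _) (A := _) (o := _) l (x := .j) (by simp))
  have hj : (S'.setv .j l).v .j = l := by simp
  have hg : Grows I lam M h m S (S'.setv .j l) := hgS.trans fun m' _ q =>
    ⟨m', le_rfl, q.congr (by simp) (fun _ _ => rfl) rfl q.le, fun _ _ => rfl, fun _ => id⟩
  have ha : (S'.setv .j l).a = S'.a := rfl
  rw [← ha] at hadm
  clear hgS
  generalize S'.setv .j l = S₀ at *
  have hN : S₀.v .N = I.numJobs := (key S₀ hagS hg).1.N
  have inner := iter_induction .i .N tryStart S₀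
    (fun l' S'' => Agree expand.vars expand.arrs expand.emits S S'' ∧ Grows I lam M h m S S'' ∧
      (∀ c, S₀.a .seen c ≠ 0 → S''.a .seen c ≠ 0) ∧
      ∀ i : Fin I.numJobs, l' ≤ i → I.Admissible lam f ⟨l, hl⟩ (I.nextTime f i) →
      S''.a .seen (I.code (S.v .K) (Function.update f ⟨l, hl⟩ (I.nextTime f i + 1))) ≠ 0) ?_ ?_
  · refine ⟨inner.1, inner.2.1, fun J i hJ hA => ?_⟩
    by_cases hJl : J = ⟨l, hl⟩
    · rw [hJl] at hA ⊢
      exact inner.2.2.2 i (Nat.zero_le _) hA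
    · have : (J : ℕ) ≠ l := fun h' => hJl (Fin.ext h')
      exact inner.2.2.1 _ (hadm J i (by omega) hA)
  · refine ⟨hagS, hg, fun _ => id, fun i hi => ?_⟩
    have := i.isLt
    omega
  intro l' hl' S'' hS'' ⟨_, hgS, hseen, hadm'⟩
  rw [hN] at hl'
  have hag₁ := hS''.trans (Agree.setv (V := _) (A := _) (o := _) l' (x := .i) (by simp))
  have hi : (S''.setv .i l').v .i = l' := by simp
  have hg₁ : Grows I lam M h m S (S''.setv .i l') := hgS.trans fun m' _ q =>
    ⟨m', le_rfl, q.congr (by simp) (fun _ _ => rfl) rfl q.le, fun _ _ => rfl, fun _ => id⟩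
  have ha₁ : (S''.setv .i l').a = S''.a := rfl
  rw [← ha₁] at hadm' hseen
  clear hgS
  generalize S''.setv .i l' = S₁ at *
  have hagS₁ : Agree expand.vars expand.arrs expand.emits S S₁ :=
    hagS.trans (hag₁.mono (by simp [Cmd.vars]) (by simp [Cmd.arrs]) (by decide))
  obtain ⟨hh₁, hd₁, hK₁⟩ := key S₁ hagS₁ hg₁
  have hj₁ : S₁.v .j = l := (hag₁.v .j (by decide)).trans hj
  have hstep : ∀ m', Queue I lam M h m' S₁ → _ := fun m' q =>
    tryStart_eval hlam hM hh₁ hf q hd₁ (J := ⟨l, hl⟩) (i := ⟨l', hl'⟩) hj₁ hi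
  obtain ⟨m', hm', q', he', hs'⟩ := id hg₁
  obtain ⟨m'', hm'', q'', he'', hs''⟩ := (hstep m' q').1
  refine ⟨hagS₁.trans ((tryStart.agree S₁).mono (by simp [expand, Cmd.vars])
    (by simp [expand, Cmd.arrs]) (by decide)), hg₁.trans fun m' _ q => (hstep m' q).1,
    fun c hc => hs'' c (hseen c hc), fun i hi' hA => ?_⟩
  by_cases hil : i = ⟨l', hl'⟩
  · rw [hil] at hA ⊢
    rw [← hK₁]
    exact (hstep m' q').2 hA
  · have : (i : ℕ) ≠ l' := fun h' => hil (Fin.ext h')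
    exact hs'' _ (hadm' i (by omega) hA)

end

/-! ### The invariant of the search -/

/-- The variables that keep their meaning between the visits of the entries of the queue. -/
def live : List Var :=
  [.found, .N, .R, .K, .P, .lam, .head, .tail, .pending, .best, .offP, .offA, .offR]

/-- The first `h` of the `m` entries in the queue have been treated: their successors have been
added to the queue, and the best one among those that are complete has been recorded. -/
structure Inv (I : RCPSP) (L M h m : ℕ) (S : St) : Prop extends Input I S where
  lam : S.v .lam = L
  es : ∀ k : Fin I.numJobs, S.a .es k = I.earliest k
  queue : Queue I L M h m S
  head : S.v .head = h * I.numJobs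
  closed : ∀ q < h, ∀ f', I.Succ L (entry I S q) f' → S.a .seen (I.code (S.v .K) f') ≠ 0
  found_le : S.v .found ≤ 1
  not_complete : S.v .found = 0 → ∀ q < h, ¬ I.Complete (entry I S q)
  best : S.v .found ≠ 0 → ∃ q < h, I.Complete (entry I S q) ∧ S.v .best = I.span (entry I S q) ∧
    (∀ k : Fin I.numJobs, S.a .best k = entry I S q k) ∧
    ∀ p < h, I.Complete (entry I S p) → I.span (entry I S q) ≤ I.span (entry I S p)
  best_le : S.v .best ≤ M
  arr_best_le : ∀ i, S.a .best i ≤ M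

theorem Inv.agree {I : RCPSP} {lam M h m : ℕ} {S S' : St} {V : List Var} (hS : Inv I lam M h m S)
    (hag : Agree V [] false S S') (hV : ∀ x ∈ live, x ∉ V) : Inv I lam M h m S' := by
  have hv : ∀ x ∈ live, S'.v x = S.v x := fun x hx => hag.v x (hV x hx)
  have ha : S'.a = S.a := funext fun k => hag.a k (by simp)
  have he : ∀ q, entry I S' q = entry I S q := fun q => by unfold entry; rw [ha]
  refine ⟨hS.toInput.agree hag fun x hx => hV x (by revert x; decide), ?_, ?_, ?_, ?_, ?_, ?_, ?_,
    ?_, ?_, ?_⟩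
  · rw [hv _ (by decide), hS.lam]
  · rw [ha]; exact hS.es
  · exact hS.queue.congr (fun x hx => hv x (by revert x; decide)) (fun _ _ => by rw [ha])
      (by rw [ha]) (by rw [ha]; exact hS.queue.le)
  · rw [hv _ (by decide), hS.head]
  · intro q; rw [he, ha, hv .K (by decide)]; exact hS.closed q
  · rw [hv _ (by decide)]; exact hS.found_le
  · rw [hv _ (by decide)]; intro h q; rw [he]; exact hS.not_complete h q
  · rw [hv _ (by decide), hv _ (by decide)]; simp only [he, ha]; exact hS.best
  · rw [hv _ (by decide)]; exact hS.best_le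
  · rw [ha]; exact hS.arr_best_le

/-- A visit of the entry `h` preserves the invariant of the search. -/
theorem visit_eval {I : RCPSP} {lam M h m : ℕ} {S : St} (hlam : lam ≤ ∑ i, I.proc i)
    (hM : 3 * ∑ i, I.proc i + 1 ≤ M) (hS : Inv I lam M h m S) (hhm : h < m) :
    ∃ m', Inv I lam M (h + 1) m' (visit.eval S) := by
  obtain ⟨f, hf⟩ : ∃ f, f = entry I S h := ⟨_, rfl⟩
  have hreach := hS.queue.reach h hhm
  rw [← hf] at hreach
  have hvalid := RCPSP.valid_of_reach hreach
  have hrow : Row I f S := ⟨hS.toInput, fun k => by rw [hS.head, hf]; rfl⟩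
  simp only [visit, Cmd.eval]
  -- the clock
  have c₁ := setClock_eval hrow
  have a₁ := setClock.agree S
  have i₁ := hS.agree (a₁.mono (List.Subset.refl _) (by decide) (by decide)) (by decide)
  have r₁ := hrow.agree a₁ (by decide) (by decide)
  have e₁ : entry I (setClock.eval S) = entry I S := by
    unfold entry; rw [a₁.a .queue (by decide)]
  generalize setClock.eval S = S₁ at *
  have c₂ := setComplete_eval r₁
  have a₂ := setComplete.agree S₁
  have i₂ := i₁.agree (a₂.mono (List.Subset.refl _) (by decide) (by decide)) (by decide)
  have r₂ := r₁.agree a₂ (by decide) (by decide)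
  have e₂ : entry I (setComplete.eval S₁) = entry I S := by
    rw [← e₁]; unfold entry; rw [a₂.a .queue (by decide)]
  have k₂ := a₂.v .clock (by decide)
  generalize setComplete.eval S₁ = S₂ at *
  have c₃ := setSpan_eval r₂
  have a₃ := setSpan.agree S₂
  have i₃ := i₂.agree (a₃.mono (List.Subset.refl _) (by decide) (by decide)) (by decide)
  have r₃ := r₂.agree a₃ (by decide) (by decide)
  have e₃ : entry I (setSpan.eval S₂) = entry I S := by
    rw [← e₂]; unfold entry; rw [a₃.a .queue (by decide)]
  have k₃ := (a₃.v .clock (by decide)).trans k₂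
  have ok₃ := a₃.v .ok (by decide)
  generalize setSpan.eval S₂ = S₃ at *
  rw [← ok₃] at c₂
  rw [c₁] at k₃
  -- the record
  have a₄ := record.agree S₃
  have r₄ := r₃.agree a₄ (by decide) (by decide)
  have rec₄ := record_eval r₃ c₂ c₃
  have e₄ : entry I (record.eval S₃) = entry I S := by
    rw [← e₃]; unfold entry; rw [a₄.a .queue (by decide)]
  have q₄ : Queue I lam M h m (record.eval S₃) := i₃.queue.congr
    (fun x hx => a₄.v x (by revert x hx; decide))
    (fun i _ => by rw [a₄.a _ (by decide)]) (a₄.a _ (by decide))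
    (fun i => by rw [a₄.a _ (by decide)]; exact i₃.queue.le i)
  have H₄ : Head I lam f (record.eval S₃) := by
    refine ⟨r₄.toInput, ?_, ?_, ?_, r₄.cur⟩
    · rw [a₄.v _ (by decide), i₃.lam]
    · rw [a₄.v _ (by decide), k₃]
    · rw [a₄.a _ (by decide)]; exact i₃.es
  have head₄ : (record.eval S₃).v .head = h * I.numJobs := by rw [a₄.v _ (by decide), i₃.head]
  have closed₄ : ∀ q < h, ∀ f', I.Succ lam (entry I S q) f' →
      (record.eval S₃).a .seen (I.code (S₃.v .K) f') ≠ 0 := by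
    rw [a₄.a _ (by decide), ← e₃]; exact i₃.closed
  have K₄ := a₄.v .K (by decide)
  have best₄ : (record.eval S₃).v .found ≤ 1 ∧ ((record.eval S₃).v .found = 0 →
      ∀ q < h + 1, ¬ I.Complete (entry I S q)) ∧
      ((record.eval S₃).v .found ≠ 0 → ∃ q < h + 1, I.Complete (entry I S q) ∧
        (record.eval S₃).v .best = I.span (entry I S q) ∧
        (∀ k : Fin I.numJobs, (record.eval S₃).a .best k = entry I S q k) ∧
        ∀ p < h + 1, I.Complete (entry I S p) → I.span (entry I S q) ≤ I.span (entry I S p)) ∧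
      (record.eval S₃).v .best ≤ M ∧ ∀ i, (record.eval S₃).a .best i ≤ M := by
    have h1 := i₃.not_complete
    have h2 := i₃.best
    rw [e₃] at h1 h2
    rcases rec₄ with ⟨hn, h'⟩ | ⟨hc, hfd, hb, hk, hk'⟩
    · rw [h']
      refine ⟨i₃.found_le, fun h0 q hq => ?_, fun h0 => ?_, i₃.best_le, i₃.arr_best_le⟩
      · rcases Nat.lt_succ_iff_lt_or_eq.1 hq with hq | rfl
        · exact h1 h0 q hq
        · rw [← hf]; exact fun hc => hn ⟨hc, .inl h0⟩
      · obtain ⟨q, hq, g1, g2, g3, g4⟩ := h2 h0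
        refine ⟨q, by omega, g1, g2, g3, fun p hp hpc => ?_⟩
        rcases Nat.lt_succ_iff_lt_or_eq.1 hp with hp | rfl
        · exact g4 p hp hpc
        · rw [← hf] at hpc ⊢
          rw [← g2]
          exact not_lt.1 fun hlt => hn ⟨hpc, .inr hlt⟩
    · refine ⟨hfd.le, fun h0 => by omega, fun _ => ⟨h, by omega, hf ▸ hc.1, hf ▸ hb, hf ▸ hk,
        fun p hp hpc => ?_⟩, ?_, fun i => ?_⟩
      · rcases Nat.lt_succ_iff_lt_or_eq.1 hp with hp | rfl
        · rcases hc.2 with h0 | hlt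
          · exact absurd hpc (h1 h0 p hp)
          · by_cases h0 : S₃.v .found = 0
            · exact absurd hpc (h1 h0 p hp)
            · obtain ⟨q, hq, g1, g2, g3, g4⟩ := h2 h0
              have := g4 p hp hpc
              rw [← hf]
              omega
        · exact le_rfl
      · rw [hb]; have := hvalid.span_le_sum hlam; omega
      · by_cases hi : i < I.numJobs
        · have := hk ⟨i, hi⟩
          dsimp only at this
          rw [this, ← r₃.cur]
          exact i₃.queue.le _
        · rw [hk' i (by omega)]; exact i₃.arr_best_le i
  generalize record.eval S₃ = S₄ at *
  -- the successors
  obtain ⟨⟨m', hm, q₅, he₅, hs₅⟩, adm₅⟩ := expand_eval hlam hM H₄ hreach q₄ hhm head₄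
  have a₅ := expand.agree S₄
  have in₅ : Input I (expand.eval S₄) := r₄.toInput.agree a₅ (by decide)
  rw [e₄] at he₅
  have K₅ := a₅.v .K (by decide)
  have v₅ := a₅.v
  have aes₅ := a₅.a .es (by decide)
  have ab₅ := a₅.a .best (by decide)
  have hv₅ : ∀ x ∈ [Var.found, .best, .lam, .head, .N], (expand.eval S₄).v x = S₄.v x := fun x hx =>
    v₅ x (by revert x hx; decide)
  clear v₅ a₅
  generalize expand.eval S₄ = S₅ at *
  have hag : Agree [.head, .pending] [] false S₅ ((S₅.setv .head (S₅.v .head + S₅.v .N)).setv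
      .pending ((S₅.setv .head (S₅.v .head + S₅.v .N)).v .pending - 1)) :=
    (Agree.setv _ (by simp)).trans (Agree.setv _ (by simp))
  have hhead : ((S₅.setv .head (S₅.v .head + S₅.v .N)).setv
      .pending ((S₅.setv .head (S₅.v .head + S₅.v .N)).v .pending - 1)).v .head =
      (h + 1) * I.numJobs := by
    simp only [St.setv_v, reduceCtorEq, if_false, if_true]
    rw [hv₅ .head (by simp), hv₅ .N (by simp), head₄, H₄.N, Nat.succ_mul]
  have hpend : ((S₅.setv .head (S₅.v .head + S₅.v .N)).setv
      .pending ((S₅.setv .head (S₅.v .head + S₅.v .N)).v .pending - 1)).v .pending + (h + 1) =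
      m' := by
    simp only [St.setv_v, reduceCtorEq, if_false, if_true]
    have := q₅.pending
    omega
  simp only [eval_add, eval_sub, eval_var, eval_lit]
  have ha : ((S₅.setv .head (S₅.v .head + S₅.v .N)).setv
      .pending ((S₅.setv .head (S₅.v .head + S₅.v .N)).v .pending - 1)).a = S₅.a := rfl
  generalize (S₅.setv .head (S₅.v .head + S₅.v .N)).setv
      .pending ((S₅.setv .head (S₅.v .head + S₅.v .N)).v .pending - 1) = S₆ at *
  have e₆ : entry I S₆ = entry I S₅ := by unfold entry; rw [ha]
  have v₆ : ∀ x ∈ [Var.found, .best, .lam, .K, .tail], S₆.v x = S₅.v x := fun x hx =>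
    hag.v x (by revert x hx; decide)
  have K₆ : S₆.v .K = S₃.v .K := (v₆ .K (by simp)).trans (K₅.trans K₄)
  have hq : ∀ q < h + 1, entry I S₆ q = entry I S q := fun q h => by rw [e₆]; exact he₅ q (by omega)
  have f₆ : S₆.v .found = S₄.v .found := (v₆ _ (by simp)).trans (hv₅ _ (by simp))
  have b₆ : S₆.v .best = S₄.v .best := (v₆ _ (by simp)).trans (hv₅ _ (by simp))
  have ab₆ : S₆.a .best = S₄.a .best := by rw [ha, ab₅]
  refine ⟨m', in₅.agree hag (by decide), ?_, ?_, ?_, hhead, fun q hqh f' hs => ?_, ?_,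
    fun h0 q hqh => ?_, fun h0 => ?_, ?_, ?_⟩
  · rw [v₆ _ (by simp), hv₅ _ (by simp), H₄.lam]
  · rw [ha, aes₅]; exact H₄.es
  · refine ⟨q₅.pos, ?_, hpend, ?_, ?_, ?_, ?_, ?_, ?_, ?_⟩
    · rw [v₆ _ (by simp), q₅.tail]
    · rw [e₆]; exact q₅.reach
    · rw [e₆]; exact q₅.zero
    · rw [e₆]; exact q₅.last
    · rw [ha]; exact q₅.seen_le
    · rw [ha, e₆, v₆ .K (by simp)]; exact q₅.seen
    · rw [e₆, v₆ .K (by simp)]; exact q₅.inj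
    · rw [ha]; exact q₅.le
  · rw [hq q hqh] at hs
    rw [ha, K₆]
    rcases Nat.lt_succ_iff_lt_or_eq.1 hqh with hqh | rfl
    · exact hs₅ _ (closed₄ q hqh f' hs)
    · rw [← hf] at hs
      obtain ⟨J, i, hA, rfl⟩ := hs
      rw [← K₄]
      exact adm₅ J i hA
  · rw [f₆]; exact best₄.1
  · rw [hq q hqh]
    rw [f₆] at h0
    exact best₄.2.1 h0 q hqh
  · rw [f₆] at h0
    obtain ⟨q, hqh, g1, g2, g3, g4⟩ := best₄.2.2.1 h0
    refine ⟨q, hqh, ?_, ?_, ?_, fun p hp => ?_⟩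
    · rw [hq q hqh]; exact g1
    · rw [hq q hqh, b₆]; exact g2
    · rw [hq q hqh, ab₆]; exact g3
    · rw [hq q hqh, hq p hp]; exact g4 p hp
  · rw [b₆]; exact best₄.2.2.2.1
  · rw [ab₆]; exact best₄.2.2.2.2

end Solver

/-! ### The encoding of an instance -/

namespace RCPSP

theorem getD_flatMap_finRange {n m : ℕ} (f : Fin n → List ℕ) (hf : ∀ i, (f i).length = m)
    (i : Fin n) {j : ℕ} (hj : j < m) :
    ((List.finRange n).flatMap f).getD (i * m + j) 0 = (f i).getD j 0 := by
  induction n with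
  | zero => exact i.elim0
  | succ n ih =>
    rw [List.finRange_succ, List.flatMap_cons, List.flatMap_map]
    cases i using Fin.cases with
    | zero => rw [List.getD_append _ _ _ _ (by rw [hf]; simpa using hj)]; simp
    | succ i =>
      rw [List.getD_append_right _ _ _ _ (by rw [hf, Fin.val_succ, Nat.succ_mul]; omega), hf,
        ← ih (fun i => f i.succ) (fun i => hf _) i]
      congr 1
      rw [Fin.val_succ, Nat.succ_mul]
      omega

theorem length_flatMap_finRange {n m : ℕ} (f : Fin n → List ℕ) (hf : ∀ i, (f i).length = m) :
    ((List.finRange n).flatMap f).length = n * m := by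
  simp [List.length_flatMap, hf]

theorem getD_map_finRange {n : ℕ} (f : Fin n → ℕ) (i : Fin n) :
    ((List.finRange n).map f).getD i 0 = f i := by
  simp [List.getD]

section

variable (I : RCPSP)

/-- The number with the given index in the encoding, and `0` behind its end. -/
noncomputable def data (i : ℕ) : ℕ := I.encode.getD i 0

theorem data_zero : I.data 0 = I.numJobs := by simp [data, encode]

theorem data_one : I.data 1 = I.numRes := by simp [data, encode]

theorem length_encode : I.encode.length = 2 + I.numJobs * I.numJobs + I.numJobs + I.numRes +
    I.numJobs * I.numRes := by
  simp [encode, length_flatMap_finRange _ (m := I.numJobs),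
    length_flatMap_finRange _ (m := I.numRes)]
  ring

open Classical in
theorem data_le (i j : Fin I.numJobs) :
    I.data (2 + i * I.numJobs + j) = if I.le i j then 1 else 0 := by
  have h := Solver.mul_add_lt_of_lt i.2 j
  have hl := length_flatMap_finRange (m := I.numJobs)
    (fun i => (List.finRange I.numJobs).map fun j => if I.le i j then 1 else 0) (by simp)
  rw [data, encode, List.getD_append, List.getD_append, List.getD_append, List.getD_append_right,
    List.length_cons, List.length_singleton,
    show 2 + i * I.numJobs + j - (1 + 1) = i * I.numJobs + j by
      omega, getD_flatMap_finRange _ (by simp) i j.2, getD_map_finRange]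
  all_goals
    simp only [List.length_append, List.length_cons, List.length_nil, hl, List.length_map,
      List.length_finRange]
    omega

theorem data_proc (j : Fin I.numJobs) :
    I.data (2 + I.numJobs * I.numJobs + j) = I.proc j := by
  classical
  have h := j.2
  have hl := length_flatMap_finRange (m := I.numJobs)
    (fun i => (List.finRange I.numJobs).map fun j => if I.le i j then 1 else 0) (by simp)
  rw [data, encode, List.getD_append, List.getD_append, List.getD_append_right, List.length_append,
    List.length_cons, List.length_singleton, hl, show 2 + I.numJobs * I.numJobs + j -
      (1 + 1 + I.numJobs * I.numJobs) = j by omega, getD_map_finRange]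
  all_goals
    simp only [List.length_append, List.length_cons, List.length_nil, hl, List.length_map,
      List.length_finRange]
    omega

theorem data_avail (ρ : Fin I.numRes) :
    I.data (2 + I.numJobs * I.numJobs + I.numJobs + ρ) = I.avail ρ := by
  classical
  have h := ρ.2
  have hl := length_flatMap_finRange (m := I.numJobs)
    (fun i => (List.finRange I.numJobs).map fun j => if I.le i j then 1 else 0) (by simp)
  rw [data, encode, List.getD_append, List.getD_append_right, List.length_append,
    List.length_append, List.length_cons, List.length_singleton, List.length_map,
    List.length_finRange, hl,
    show 2 + I.numJobs * I.numJobs + I.numJobs + ρ -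
      (1 + 1 + I.numJobs * I.numJobs + I.numJobs) = ρ by omega, getD_map_finRange]
  all_goals
    simp only [List.length_append, List.length_cons, List.length_nil, hl, List.length_map,
      List.length_finRange]
    omega

theorem data_req (j : Fin I.numJobs) (ρ : Fin I.numRes) :
    I.data (2 + I.numJobs * I.numJobs + I.numJobs + I.numRes + j * I.numRes + ρ) = I.req j ρ := by
  classical
  have hl := length_flatMap_finRange (m := I.numJobs)
    (fun i => (List.finRange I.numJobs).map fun j => if I.le i j then 1 else 0) (by simp)
  rw [data, encode, List.getD_append_right, List.length_append, List.length_append,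
    List.length_append, List.length_cons, List.length_singleton, List.length_map,
    List.length_finRange, hl, List.length_map, List.length_finRange,
    show 2 + I.numJobs * I.numJobs + I.numJobs + I.numRes + j * I.numRes + ρ -
      (1 + 1 + I.numJobs * I.numJobs + I.numJobs + I.numRes) = j * I.numRes + ρ by omega,
    getD_flatMap_finRange _ (by simp) j ρ.2, getD_map_finRange]
  simp only [List.length_append, List.length_cons, List.length_nil, hl, List.length_map,
    List.length_finRange]
  omega

theorem sum_lt_two_pow (l : List ℕ) : l.sum < 2 ^ (l.map fun a => Nat.size a + 1).sum := by
  induction l with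
  | nil => simp
  | cons a l ih =>
    have h1 := Nat.lt_size_self a
    have h2 : 2 ^ Nat.size a ≤ 2 ^ (Nat.size a + (l.map fun a => Nat.size a + 1).sum) :=
      Nat.pow_le_pow_right two_pos (by omega)
    have h3 : 2 ^ (l.map fun a => Nat.size a + 1).sum ≤
        2 ^ (Nat.size a + (l.map fun a => Nat.size a + 1).sum) :=
      Nat.pow_le_pow_right two_pos (by omega)
    rw [List.sum_cons, List.map_cons, List.sum_cons, show Nat.size a + 1 +
      (l.map fun a => Nat.size a + 1).sum = Nat.size a + (l.map fun a => Nat.size a + 1).sum + 1 by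
        omega, pow_succ]
    omega

theorem data_lt (i : ℕ) : I.data i < 2 ^ I.size := by
  refine lt_of_le_of_lt ?_ (sum_lt_two_pow I.encode)
  rw [data, List.getD_eq_getElem?_getD]
  rcases h : I.encode[i]? with _ | a
  · simp
  · exact List.le_sum_of_mem (List.mem_of_getElem? h)

theorem sum_proc_lt : ∑ j, I.proc j < 2 ^ I.size := by
  refine lt_of_le_of_lt ?_ (sum_lt_two_pow I.encode)
  simp only [encode, List.sum_append, Fin.sum_univ_def]
  omega

theorem length_encode_le_size : I.encode.length ≤ I.size := by
  rw [size]
  generalize I.encode = l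
  induction l with
  | nil => simp
  | cons a l ih => simp; omega

theorem numJobs_add_numRes_le_size : I.numJobs + I.numRes ≤ I.size := by
  have := I.length_encode_le_size
  rw [length_encode] at this
  have := Nat.zero_le (I.numJobs * I.numJobs)
  omega

/-- The input fits into the memory cells below the arrays. -/
theorem length_encode_lt : I.encode.length < 4 * 2 ^ (I.numJobs + I.numRes) := by
  rw [length_encode]
  have h : ∀ s : ℕ, 2 + s * s + s < 4 * 2 ^ s := by
    intro s
    induction s with
    | zero => simp
    | succ s ih =>
      have : s < 2 ^ s := Nat.lt_two_pow_self
      rw [pow_succ]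
      ring_nf at ih ⊢
      omega
  have := h (I.numJobs + I.numRes)
  have h2 : I.numJobs * I.numJobs + I.numJobs * I.numRes ≤
      (I.numJobs + I.numRes) * (I.numJobs + I.numRes) := by
    rw [← mul_add]; exact Nat.mul_le_mul_right _ (Nat.le_add_right _ _)
  omega

end

end RCPSP

/-! ### Preparations -/

namespace Solver

open LoopLang LoopLang.Expr

section

variable {I : RCPSP} {S : St}

theorem setOffsets_eval (hN : S.v .N = I.numJobs) (hR : S.v .R = I.numRes)
    (hi : ∀ i, S.inp i = I.data i) : Input I (setOffsets.eval S) := by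
  have hm := Cmd.mul_eval .N .N S (by decide) (by decide) (by decide)
  have hag := (Cmd.mul .N .N).agree S
  have hN₁ := (hag.v .N (by decide)).trans hN
  have hR₁ := (hag.v .R (by decide)).trans hR
  have hi₁ : ∀ i, ((Cmd.mul .N .N).eval S).inp i = I.data i := fun i => (hag.inp i).trans (hi i)
  rw [setOffsets, Cmd.eval]
  generalize (Cmd.mul .N .N).eval S = S₁ at *
  rw [hN] at hm
  refine ⟨?_, ?_, fun i j => ?_, fun j => ?_, fun ρ => ?_, fun j ρ => ?_⟩
  · simp [hN₁]
  · simp [hR₁]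
  · simp [hi₁, I.data_le]
  · simp [hi₁, hm, I.data_proc]
  · simp [hi₁, hm, hN₁, I.data_avail]
  · simp [hi₁, hm, hN₁, hR₁, I.data_req]

theorem sumProc_eval (h : Input I S) (hP : S.v .P = 0) :
    (sumProc.eval S).v .P = ∑ j, I.proc j := by
  refine (iter_sum .P h.N I.proc fun k S' hS' => ?_).trans (by rw [hP, zero_add])
  have hk : (S'.setv .j k).v .j = k := by simp
  have hok : (S'.setv .j k).v .P = S'.v .P := by simp
  rw [← hok]
  generalize S'.setv .j k = S₁ at *
  have h₁ := h.agree hS' (by decide)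
  simp [hk, h₁.proc k]

end

end Solver

/-! ### The earliest possible starting times -/

namespace RCPSP

open Classical in
/-- The number of strict predecessors of a job. -/
noncomputable def depth (I : RCPSP) (j : Fin I.numJobs) : ℕ :=
  (Finset.univ.filter fun i => I.lt i j).card

theorem depth_lt_depth (I : RCPSP) {i j : Fin I.numJobs} (h : I.lt i j) :
    I.depth i < I.depth j := by
  classical
  refine Finset.card_lt_card (Finset.ssubset_iff_of_subset (fun k hk => ?_) |>.2 ⟨i, ?_, ?_⟩)
  · simp only [Finset.mem_filter, Finset.mem_univ, true_and] at hk ⊢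
    exact I.lt_trans' hk h
  · simpa using h
  · simpa using fun h : I.lt i i => h.2 rfl

theorem depth_lt (I : RCPSP) (j : Fin I.numJobs) : I.depth j < I.numJobs := by
  classical
  have : I.depth j < (Finset.univ : Finset (Fin I.numJobs)).card :=
    Finset.card_lt_card (Finset.ssubset_iff_of_subset (Finset.filter_subset _ _) |>.2
      ⟨j, Finset.mem_univ j, by simpa using fun h : I.lt j j => h.2 rfl⟩)
  simpa using this

end RCPSP

namespace Solver

open LoopLang LoopLang.Expr

section

variable {I : RCPSP} {S : St}

/-- The entries of the array `Arr.es` are at most the earliest possible starting times, with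
equality for the jobs that have fewer than `r` strict predecessors. -/
def Approx (I : RCPSP) (r : ℕ) (S : St) : Prop :=
  (∀ k : Fin I.numJobs, S.a .es k ≤ I.earliest k) ∧
    ∀ k : Fin I.numJobs, I.depth k < r → I.earliest k ≤ S.a .es k

/-- A step of the approximation increases values, but not beyond the earliest possible starting
times. -/
theorem relaxStep_eval (h : Input I S) {i j : Fin I.numJobs} (hi : S.v .i = i) (hj : S.v .j = j)
    (hle : ∀ k : Fin I.numJobs, S.a .es k ≤ I.earliest k) :
    (∀ k : Fin I.numJobs, S.a .es k ≤ (relaxStep.eval S).a .es k ∧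
      (relaxStep.eval S).a .es k ≤ I.earliest k) ∧
    (I.lt i j → S.a .es i + I.proc i ≤ (relaxStep.eval S).a .es j) := by
  have hm := Cmd.mul_eval .i .N S (by decide) (by decide) (by decide)
  have hag := (Cmd.mul .i .N).agree S
  have hi₁ := (hag.v .i (by decide)).trans hi
  have hj₁ := (hag.v .j (by decide)).trans hj
  have h₁ := h.agree hag (by decide)
  have hes := hag.a .es (by decide)
  rw [← hes] at hle ⊢
  rw [relaxStep, Cmd.eval]
  generalize (Cmd.mul .i .N).eval S = S₁ at *
  rw [hi, h.N] at hm
  have e1 : ¬ S₁.inp _ = 0 ↔ _ := h₁.le i j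
  have e2 := h₁.proc i
  have e4 : ¬ (i : ℕ) = j ↔ i ≠ j := by rw [ne_eq, Fin.ext_iff]
  have hc : (conj (leq .j) (differ (.var .i) (.var .j))).eval S₁ ≠ 0 ↔ I.lt i j := by
    simp only [leq, ne_eq, eval_conj, eval_differ, eval_inp, eval_add, eval_var, eval_lit, hi₁, hj₁,
      hm, e1, e4, not_not, RCPSP.lt]
  by_cases hlt : I.lt i j
  swap
  · rw [Cmd.when_of_eq_zero (by rwa [← hc, not_not] at hlt)]
    exact ⟨fun k => ⟨le_rfl, hle k⟩, fun h => absurd h hlt⟩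
  rw [Cmd.when_of_ne_zero (hc.2 hlt)]
  by_cases hless : S₁.a .es j < S₁.a .es i + I.proc i
  swap
  · rw [Cmd.when_of_eq_zero (by simp [hi₁, hj₁, e2]; omega)]
    exact ⟨fun k => ⟨le_rfl, hle k⟩, fun _ => by omega⟩
  rw [Cmd.when_of_ne_zero (by simpa [hi₁, hj₁, e2] using hless)]
  have hval : ∀ k : ℕ, ((Cmd.put .es (.var .j) (.get .es (.var .i) + proc .i)).eval S₁).a .es k =
      if k = j then S₁.a .es i + I.proc i else S₁.a .es k := by
    intro k; simp [hi₁, hj₁, e2]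
  refine ⟨fun k => ?_, fun _ => ?_⟩
  · rw [hval]
    split_ifs with hk
    · rw [hk, Fin.ext hk]
      have := I.earliest_le_of_lt hlt
      have := hle i
      exact ⟨hless.le, by omega⟩
    · exact ⟨le_rfl, hle k⟩
  · rw [hval, if_pos rfl]

theorem Approx.step {r : ℕ} {S' : St} (h : Approx I r S) (h' : ∀ k : Fin I.numJobs,
    S.a .es k ≤ S'.a .es k ∧ S'.a .es k ≤ I.earliest k) : Approx I r S' :=
  ⟨fun k => (h' k).2, fun k hk => (h.2 k hk).trans (h' k).1⟩

/-- In a round, the values of the jobs with `r` strict predecessors become correct, since those of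
their predecessors, which have fewer strict predecessors, have been correct before. -/
theorem relax_round_eval {r : ℕ} (h : Input I S) (hS : Approx I r S) :
    Approx I (r + 1) ((Cmd.iter .j .N (.iter .i .N relaxStep)).eval S) := by
  have main := iter_induction .j .N (.iter .i .N relaxStep) S (fun l S' => Approx I r S' ∧
    ∀ J : Fin I.numJobs, l ≤ J → I.depth J < r + 1 → I.earliest J ≤ S'.a .es J) ?_ ?_
  · exact ⟨main.1.1, fun k => main.2 k (Nat.zero_le _)⟩
  · refine ⟨hS, fun J hJ => ?_⟩
    have := h.N; have := J.2; omega
  intro l hl S' hS' ⟨hA, hJ⟩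
  rw [h.N] at hl
  have hag := hS'.trans (Agree.setv (V := _) (A := _) (o := _) l (x := .j) (by simp))
  have hj : (S'.setv .j l).v .j = l := by simp
  have hA₀ : Approx I r (S'.setv .j l) := hA
  have hJ₀ : ∀ J : Fin I.numJobs, l + 1 ≤ J → I.depth J < r + 1 →
    I.earliest J ≤ (S'.setv .j l).a .es J := hJ
  clear hA hJ
  generalize S'.setv .j l = S₀ at *
  have h₀ := h.agree hag (by decide)
  have inner := iter_induction .i .N relaxStep S₀ (fun l' S'' => Approx I r S'' ∧
    (∀ J : Fin I.numJobs, l + 1 ≤ J → I.depth J < r + 1 → I.earliest J ≤ S''.a .es J) ∧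
    (I.depth ⟨l, hl⟩ < r + 1 → ∀ i : Fin I.numJobs, l' ≤ i → I.lt i ⟨l, hl⟩ →
      I.earliest i + I.proc i ≤ S''.a .es l)) ?_ ?_
  · refine ⟨inner.1, fun J hlJ hd => ?_⟩
    rcases hlJ.eq_or_lt with hlJ | hlJ
    · obtain rfl : J = ⟨l, hl⟩ := Fin.ext hlJ.symm
      exact I.earliest_le fun i hi => inner.2.2 hd i (Nat.zero_le _) hi
    · exact inner.2.1 J hlJ hd
  · refine ⟨hA₀, hJ₀, fun _ i hi => ?_⟩
    have := h₀.N; have := i.2; omega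
  intro l' hl' S'' hS'' ⟨hA, hJ, hi⟩
  rw [h₀.N] at hl'
  have hag₁ := hS''.trans (Agree.setv (V := _) (A := _) (o := _) l' (x := .i) (by simp))
  have hi₁ : (S''.setv .i l').v .i = l' := by simp
  have hA₁ : Approx I r (S''.setv .i l') := hA
  have ha : (S''.setv .i l').a = S''.a := rfl
  rw [← ha] at hJ hi
  clear hA ha
  generalize S''.setv .i l' = S₁ at *
  have h₁ := h₀.agree hag₁ (by decide)
  have hj₁ := (hag₁.v .j (by decide)).trans hj
  obtain ⟨hstep, hnew⟩ := relaxStep_eval h₁ (i := ⟨l', hl'⟩) (j := ⟨l, hl⟩) hi₁ hj₁ hA₁.1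
  refine ⟨hA₁.step hstep, fun J hlJ hd => (hJ J hlJ hd).trans (hstep J).1, fun hd i hi' hlt => ?_⟩
  rcases hi'.eq_or_lt with hi' | hi'
  · obtain rfl : i = ⟨l', hl'⟩ := Fin.ext hi'.symm
    have := hnew hlt
    have := hA₁.2 ⟨l', hl'⟩ (by have := I.depth_lt_depth hlt; omega)
    dsimp only at *
    omega
  · exact (hi hd i hi' hlt).trans (hstep ⟨l, hl⟩).1

theorem relax_eval (h : Input I S) (hS : ∀ k, S.a .es k = 0) (k : Fin I.numJobs) :
    (relax.eval S).a .es k = I.earliest k := by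
  have := iter_induction .r .N (.iter .j .N (.iter .i .N relaxStep)) S
    (fun l S' => Approx I (I.numJobs - l) S') ?_ ?_
  · exact le_antisymm (this.1 k) (this.2 k (I.depth_lt k))
  · rw [h.N, Nat.sub_self]
    exact ⟨fun k => by rw [hS]; exact Nat.zero_le _, fun k hk => absurd hk (Nat.not_lt_zero _)⟩
  · intro l hl S' hS' hP
    rw [h.N] at hl
    have hag := hS'.trans (Agree.setv (V := _) (A := _) (o := _) l (x := .r) (by simp))
    rw [show I.numJobs - l = I.numJobs - (l + 1) + 1 by omega]
    exact relax_round_eval (h.agree hag (by decide)) hP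

/-- The values of the variables after `n` steps of the search for the length of a digit. -/
theorem iterate_nextBit (hK : S.v .K = 0) (hp : S.v .power = 1)
    (hg : S.v .gap = 2 * S.v .P + 2) (n : ℕ) :
    Agree nextBit.vars [] false S (nextBit.eval^[n] S) ∧ (nextBit.eval^[n] S).v .K = n ∧
      (nextBit.eval^[n] S).v .power = 2 ^ n ∧
      (nextBit.eval^[n] S).v .gap = 2 * S.v .P + 3 - 2 ^ n := by
  induction n with
  | zero => exact ⟨.refl _ _ _ _, hK, hp, by rw [Function.iterate_zero_apply, hg, pow_zero]; omega⟩
  | succ n ih =>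
    rw [Function.iterate_succ_apply']
    generalize nextBit.eval^[n] S = S' at *
    obtain ⟨h1, h2, h3, h4⟩ := ih
    have hP := h1.v .P (by decide)
    refine ⟨h1.trans (nextBit.agree S'), ?_, ?_, ?_⟩
    · simp [nextBit, h2]
    · simp [nextBit, h3, pow_succ, mul_two]
    · simp [nextBit, h3, hP, pow_succ, mul_two, two_mul]

/-! ### Reading off the schedule -/

theorem maxPred_eval (h : Input I S) {f : Fin I.numJobs → ℕ}
    (hf : ∀ k : Fin I.numJobs, S.a .best k = f k) {j : Fin I.numJobs} (hj : S.v .j = j)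
    (h0 : I.proc j = 0) : (maxPred.eval S).v .span = I.fill f j := by
  classical
  have hag₀ : Agree [.span] [] false S (S.setv .span 0) := Agree.setv 0 (by simp)
  have h₀ := h.agree hag₀ (by decide)
  have hf₀ : ∀ k : Fin I.numJobs, (S.setv .span 0).a .best k = f k := hf
  have hj₀ : (S.setv .span 0).v .j = j := by simp [hj]
  have ha₀ : (S.setv .span 0).v .span = 0 := by simp
  rw [maxPred, Cmd.eval, Cmd.eval, eval_lit]
  clear hf hj h
  generalize S.setv .span 0 = S₀ at *
  refine (iter_max .span h₀.N (fun i => if I.lt i j then f i - 1 + I.proc i else 0)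
    fun i S' hS' => ?_).trans ?_
  · have hi : (S'.setv .i i).v .i = i := by simp
    have hok : (S'.setv .i i).v .span = S'.v .span := by simp
    rw [← hok]
    generalize S'.setv .i i = S₁ at *
    have h₁ := h₀.agree hS' (by decide)
    have hj₁ := (hS'.v .j (by decide)).trans hj₀
    have hb₁ := hS'.a .best (by decide)
    have hm := Cmd.mul_eval .i .N S₁ (by decide) (by decide) (by decide)
    have hag := (Cmd.mul .i .N).agree S₁
    have h₂ := h₁.agree hag (by decide)
    have hi₂ := (hag.v .i (by decide)).trans hi
    have hj₂ := (hag.v .j (by decide)).trans hj₁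
    have hs₂ := hag.v .span (by decide)
    have hb₂ := (hag.a .best (by decide)).trans hb₁
    rw [Cmd.eval]
    generalize (Cmd.mul .i .N).eval S₁ = S₂ at *
    rw [hi, h₁.N] at hm
    have e1 : ¬ S₂.inp _ = 0 ↔ _ := h₂.le i j
    have e2 := h₂.proc i
    have e4 : ¬ (i : ℕ) = j ↔ i ≠ j := by rw [ne_eq, Fin.ext_iff]
    have hc : (conj (leq .j) (differ (.var .i) (.var .j))).eval S₂ ≠ 0 ↔ I.lt i j := by
      simp only [leq, ne_eq, eval_conj, eval_differ, eval_inp, eval_add, eval_var, eval_lit, hi₂,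
        hj₂, hm, e1, e4, not_not, RCPSP.lt]
    rw [← hs₂]
    by_cases hlt : I.lt i j
    · rw [Cmd.when_of_ne_zero (hc.2 hlt), Cmd.max_eval, if_pos hlt]
      simp [hi₂, hb₂, hf₀, e2]
    · rw [Cmd.when_of_eq_zero (by rwa [← hc, not_not] at hlt), if_neg hlt,
        max_eq_left (Nat.zero_le _)]
  · rw [ha₀, RCPSP.fill, if_pos h0, Finset.sup_ite]
    simp

theorem finish_eval (h : Input I S) {f : Fin I.numJobs → ℕ}
    (hf : ∀ k : Fin I.numJobs, S.a .best k = f k) (j : Fin I.numJobs) :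
    (finish.eval S).a .es j = I.fill f j := by
  have := (iter_put .es (x := .j) (n := .N) (b := .ite (proc .j)
    (.put .es (.var .j) (.get .best (.var .j) - .lit 1))
    (maxPred ;; .put .es (.var .j) (.var .span))) h.N 0 (I.fill f) fun k S' hS' hq i => ?_).1 j
  · rwa [zero_add] at this
  have hk : (S'.setv .j k).v .j = k := by simp
  have ha : S'.a .es = (S'.setv .j k).a .es := by simp
  rw [ha]
  clear ha hq
  generalize S'.setv .j k = S₁ at *
  have h₁ := h.agree hS' (by decide)
  have hb₁ := hS'.a .best (by decide)
  have e2 := h₁.proc k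
  by_cases h0 : I.proc k = 0
  · have hm := maxPred_eval h₁ (f := f) (fun k => by rw [hb₁, hf]) hk h0
    have hag := maxPred.agree S₁
    have hk₂ := (hag.v .j (by decide)).trans hk
    have he₂ := hag.a .es (by decide)
    rw [Cmd.eval, if_neg (by simp [hk, e2, h0]), Cmd.eval]
    generalize maxPred.eval S₁ = S₂ at *
    simp [hk₂, hm, he₂]
  · rw [I.fill_of_pos f (Nat.pos_of_ne_zero h0), Cmd.eval, if_pos (by simp [hk, e2, h0])]
    simp [hk, hb₁, hf]

theorem output_eval (hN : S.v .N = I.numJobs) (hb : I.numJobs ≤ S.base) (j : Fin I.numJobs) :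
    (output.eval S).io j = S.a .es j := by
  have := iter_induction .j .N (.emit (.var .j) (.get .es (.var .j))) S
    (fun l S' => ∀ k : Fin I.numJobs, l ≤ k → S'.io k = S.a .es k) ?_ ?_
  · exact this j (Nat.zero_le _)
  · intro k hk
    have := k.2; omega
  · intro l hl S' hS' hP k hk
    have ha := hS'.a .es (by decide)
    have hbase := hS'.base
    rw [hN] at hl
    rw [Cmd.eval, if_pos (by simp; omega), St.setio_io]
    simp only [eval_var, eval_get, St.setv_v, St.setv_a, if_true, ha]
    split_ifs with h
    · rw [h]
    · exact hP k (by omega)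

end

end Solver

/-! ### Parts of the machine program that are not loop programs -/

namespace RAM

/-- The registers that a program may change. -/
def Prog.writes : Prog → List ℕ
  | .skip => []
  | .const x _ => [x]
  | .add x _ _ => [x]
  | .sub x _ _ => [x]
  | .load x _ => [x]
  | .store _ _ => []
  | .seq p q => p.writes ++ q.writes
  | .ite _ p q => p.writes ++ q.writes
  | .loop _ p => p.writes

/-- A program changes no registers but those it writes to. -/
theorem Exec.reg_eq {p : Prog} {σ τ : State} {t r : ℕ} (h : Exec p σ t τ) (hr : r ∉ p.writes) :
    τ.reg r = σ.reg r := by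
  induction h with
  | skip | loop_stop | store => rfl
  | const | add | sub | load => exact LoopLang.setReg_reg_ne _ _ (by simpa [Prog.writes] using hr)
  | seq _ _ ih₁ ih₂ =>
    simp only [Prog.writes, List.mem_append, not_or] at hr
    exact (ih₂ hr.2).trans (ih₁ hr.1)
  | ite_true _ _ ih =>
    simp only [Prog.writes, List.mem_append, not_or] at hr
    exact ih hr.1
  | ite_false _ _ ih =>
    simp only [Prog.writes, List.mem_append, not_or] at hr
    exact ih hr.2
  | loop_step _ _ _ ih₁ ih₂ => exact (ih₂ hr).trans (ih₁ hr)

/-- Set some registers to zero. -/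
def clear : List ℕ → Prog
  | [] => .skip
  | r :: l => .seq (.const r 0) (clear l)

theorem clear_runs (l : List ℕ) (σ : State) :
    Runs (clear l) σ (l.length + 1) ⟨fun r => if r ∈ l then 0 else σ.reg r, σ.mem⟩ := by
  induction l generalizing σ with
  | nil => simpa [clear] using Runs.skip σ
  | cons x l ih =>
    have := (Runs.const σ x 0).seq (ih (σ.setReg x 0))
    have he : (⟨fun r => if r ∈ x :: l then 0 else σ.reg r, σ.mem⟩ : State) =
        ⟨fun r => if r ∈ l then 0 else (σ.setReg x 0).reg r, (σ.setReg x 0).mem⟩ := by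
      congr 1
      funext r
      by_cases hx : r = x
      · simp [hx, State.setReg]
      · simp [hx, State.setReg]
    rw [he]
    exact this.mono (by simp; omega)

end RAM

namespace LoopLang

open RAM (State Prog Runs Exec Bdd)

/-- A loop of the machine that repeats a command as long as a variable is not zero. -/
theorem while_runs (c : Cmd) (x : Var) {m : ℕ} (hc : c.BoundedBy [] = true) (n : ℕ) {S : St}
    {σ : State} (h : Rep S σ) (h1 : ∀ i < n, (c.eval^[i] S).v x ≠ 0)
    (h0 : (c.eval^[n] S).v x = 0) :
    ∃ τ, Runs (.loop (vr x) (c.compile 0)) σ (n * (c.cost.eval m + 1) + 1) τ ∧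
      Rep (c.eval^[n] S) τ := by
  induction n generalizing S σ with
  | zero => exact ⟨σ, by simpa using Runs.loop_stop ((h.v x).trans h0), h⟩
  | succ n ih =>
    obtain ⟨τ, r, hτ, -⟩ := c.compile_runs 0 (m := m) hc (by simp) h
    obtain ⟨υ, r', hυ⟩ := ih hτ (fun i hi => h1 (i + 1) (by omega)) h0
    refine ⟨υ, (Runs.loop_step ?_ r r').mono ?_, hυ⟩
    · rw [h.v]; exact h1 0 (by omega)
    · rw [Nat.succ_mul]; omega

end LoopLang

namespace Solver

open LoopLang LoopLang.Expr
open RAM (State Prog Runs Exec Bdd)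

/-- Multiply the register `1` by a power of two. -/
def double : Prog := .loop (tr 0) (.seq (.add 1 1 1) (.sub (tr 0) (tr 0) (tr 1)))

theorem double_runs (n : ℕ) (σ : State) (h0 : σ.reg (tr 0) = n) (h1 : σ.reg (tr 1) = 1) :
    ∃ τ, Runs double σ (3 * n + 1) τ ∧ τ.mem = σ.mem ∧ τ.reg 1 = σ.reg 1 * 2 ^ n ∧
      ∀ x, τ.reg (vr x) = σ.reg (vr x) := by
  induction n generalizing σ with
  | zero => exact ⟨σ, Runs.loop_stop h0, rfl, by simp, fun _ => rfl⟩
  | succ n ih =>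
    obtain ⟨σ', hσ'⟩ : ∃ σ', σ' = ((σ.setReg 1 (σ.reg 1 + σ.reg 1)).setReg (tr 0) n) := ⟨_, rfl⟩
    obtain ⟨τ, r, hm, hr, hv⟩ := ih σ' (by simp [hσ']) (by simp [hσ', setReg_reg_ne, h1])
    refine ⟨τ, ?_, ?_, ?_, fun x => ?_⟩
    · have := Runs.loop_step (x := tr 0) (by omega)
        ((Runs.add σ 1 1 1).seq (Runs.sub _ (tr 0) (tr 0) (tr 1)))
        (σ₂ := τ) (l := 3 * n + 1) (by
          rw [hσ', double] at r
          simpa [setReg_reg_ne, h0, h1] using r)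
      exact this.mono (by omega)
    · rw [hm, hσ']; rfl
    · rw [hr, hσ', pow_succ]
      simp [setReg_reg_ne]
      ring
    · rw [hv, hσ']
      simp [setReg_reg_ne]

/-- Load the number of jobs. -/
def loadJobs : Prog := .seq (.const (tr 0) 1) (.load (vr .N) (tr 0))

/-- Load the number of resources, and determine the address of the first cell for arrays. -/
def layout : Prog :=
  .seq (.const (tr 0) 2) <| .seq (.load (vr .R) (tr 0)) <| .seq (.const 1 4) <|
  .seq (.add (tr 0) (vr .N) (vr .R)) <| .seq (.const (tr 1) 1) double

/-- The state of the loop programs at the beginning. -/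
noncomputable def startState (I : RCPSP) (lam : ℕ) : St where
  base := 4 * 2 ^ (I.numJobs + I.numRes)
  v x := if x = .N then I.numJobs else if x = .R then I.numRes else 0
  a _ _ := 0
  io i := (lam :: I.encode).getD i 0

theorem mem_initial_succ (I : RCPSP) (lam i : ℕ) :
    (RAM.initial (lam :: I.encode)).mem (i + 1) = I.data i := by
  simp [RAM.initial, RCPSP.data]

theorem startState_inp (I : RCPSP) (lam i : ℕ) : (startState I lam).inp i = I.data i := by
  have := I.length_encode_lt
  unfold St.inp
  split_ifs with h
  · exact mem_initial_succ I lam i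
  · rw [RCPSP.data, List.getD_eq_default]
    simp only [startState] at h
    omega

theorem bdd_initial (I : RCPSP) (lam : ℕ) : Bdd I.size (RAM.initial (lam :: I.encode)) := by
  refine ⟨fun r => by simp [RAM.initial], fun a ha => ?_⟩
  obtain ⟨i, rfl⟩ := Nat.exists_eq_succ_of_ne_zero ha
  rw [Nat.succ_eq_add_one, mem_initial_succ]
  exact I.data_lt i

theorem loadJobs_runs (I : RCPSP) (lam : ℕ) :
    Runs loadJobs (RAM.initial (lam :: I.encode)) 3
      (((RAM.initial (lam :: I.encode)).setReg (tr 0) 1).setReg (vr .N) I.numJobs) := by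
  have h := mem_initial_succ I lam 0
  rw [zero_add, I.data_zero] at h
  have := (Runs.const (RAM.initial (lam :: I.encode)) (tr 0) 1).seq (Runs.load _ (vr .N) (tr 0)
    (by simp))
  rw [loadJobs]
  simpa [State.setReg, h] using this

theorem layout_runs (I : RCPSP) (lam : ℕ) :
    ∃ τ, Runs layout (((RAM.initial (lam :: I.encode)).setReg (tr 0) 1).setReg (vr .N) I.numJobs)
      (3 * (I.numJobs + I.numRes) + 13) τ ∧ Rep (startState I lam) τ := by
  obtain ⟨σ, hσ⟩ : ∃ σ, σ = ((RAM.initial (lam :: I.encode)).setReg (tr 0) 1).setReg (vr .N)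
    I.numJobs := ⟨_, rfl⟩
  rw [← hσ]
  have hmem : σ.mem = (RAM.initial (lam :: I.encode)).mem := by rw [hσ]; rfl
  have h2 : σ.mem 2 = I.numRes := by rw [hmem, mem_initial_succ I lam 1, I.data_one]
  obtain ⟨σ', hσ'⟩ : ∃ σ', σ' = ((((σ.setReg (tr 0) 2).setReg (vr .R) I.numRes).setReg 1 4).setReg
    (tr 0) (I.numJobs + I.numRes)).setReg (tr 1) 1 := ⟨_, rfl⟩
  obtain ⟨τ, r, hm, hr, hv⟩ := double_runs (I.numJobs + I.numRes) σ'
    (by rw [hσ', setReg_reg_ne _ _ (by simp), setReg_reg_self]) (by rw [hσ', setReg_reg_self])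
  have hN : σ.reg (vr .N) = I.numJobs := by rw [hσ, setReg_reg_self]
  refine ⟨τ, ?_, ?_⟩
  · have := (Runs.const σ (tr 0) 2).seq <| (Runs.load _ (vr .R) (tr 0) (by simp)).seq <|
      (Runs.const _ 1 4).seq <| (Runs.add _ (tr 0) (vr .N) (vr .R)).seq <|
      (Runs.const _ (tr 1) 1).seq (q := double) (σ₂ := τ) (l := 3 * (I.numJobs + I.numRes) + 1)
      (by
        have e : (σ.setReg (tr 0) 2).mem = σ.mem := rfl
        simpa [setReg_reg_ne, hN, hσ', e, h2] using r)
    exact this.mono (by omega)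
  · refine ⟨by simp [startState], ?_, fun x => ?_, fun i _ => ?_, fun k i => ?_⟩
    · rw [hr, hσ']
      simp [setReg_reg_ne, startState]
    · rw [hv, hσ', hσ]
      by_cases hx : x = .R
      · subst hx; simp [setReg_reg_ne, startState]
      · by_cases hx' : x = .N
        · subst hx'; simp [setReg_reg_ne, startState]
        · simp [setReg_reg_ne, startState, hx, hx', RAM.initial]
    · rw [hm, hσ', hσ]; rfl
    · have hl := I.length_encode_lt
      rw [hm, hσ', hσ]
      change (lam :: I.encode).getD _ 0 = 0
      rw [List.getD_eq_default]
      simp only [startState, List.length_cons]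
      omega

/-- Replace the bound on the lag by the sum of the processing times if this is smaller. -/
def cap : Prog :=
  .seq (.const (tr 0) 0) <| .seq (.load (vr .lam) (tr 0)) <|
  .seq (.sub (tr 0) (vr .lam) (vr .P)) <| .seq (.sub (vr .lam) (vr .lam) (tr 0))
    (.const (tr 0) 0)

/-- The cost of reading the bound on the lag, the only number whose length is not bounded by `b`;
the capped bound is. -/
theorem cap_exec {S : St} {σ : State} (h : Rep S σ) {b : ℕ} (hb : Bdd b σ) :
    ∃ τ t, Exec cap σ t τ ∧ t ≤ 5 + 4 * Nat.size (S.io 0) + b ∧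
      Rep (S.setv .lam (min (S.io 0) (S.v .P))) τ ∧ Bdd b τ := by
  have h0 : σ.mem 0 = S.io 0 := h.io 0 h.pos
  have hP := h.v .P
  have hPb := hb.size_reg (vr .P)
  rw [hP] at hPb
  obtain ⟨l, hl⟩ : ∃ l, l = S.io 0 := ⟨_, rfl⟩
  rw [← hl] at h0 ⊢
  have e₁ := Exec.const σ (tr 0) 0
  have e₂ := Exec.load (σ.setReg (tr 0) 0) (vr .lam) (tr 0)
  rw [setReg_reg_self, show (σ.setReg (tr 0) 0).mem 0 = l from h0] at e₂
  have e₃ := Exec.sub ((σ.setReg (tr 0) 0).setReg (vr .lam) l) (tr 0) (vr .lam) (vr .P)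
  rw [setReg_reg_self, setReg_reg_ne _ _ (by simp), setReg_reg_ne _ _ (by simp), hP] at e₃
  have e₄ := Exec.sub (((σ.setReg (tr 0) 0).setReg (vr .lam) l).setReg (tr 0) (l - S.v .P))
    (vr .lam) (vr .lam) (tr 0)
  rw [setReg_reg_self, setReg_reg_ne _ _ (by simp), setReg_reg_self] at e₄
  have e₅ := Exec.const ((((σ.setReg (tr 0) 0).setReg (vr .lam) l).setReg (tr 0)
    (l - S.v .P)).setReg (vr .lam) (l - (l - S.v .P))) (tr 0) 0
  have hmin : l - (l - S.v .P) = min l (S.v .P) := by omega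
  refine ⟨_, _, e₁.seq (e₂.seq (e₃.seq (e₄.seq e₅))), ?_, ?_, ?_⟩
  · have : Nat.size (l - S.v .P) ≤ Nat.size l := Nat.size_le_size (Nat.sub_le _ _)
    simp only [Nat.size_zero]
    omega
  · rw [← hmin]
    exact ((((h.setTr 0 0).setVr .lam l).setTr 0 _).setVr .lam _).setTr 0 0 |> fun h' => by
      convert h' using 1
      ext1 <;> simp [St.setv]
  · refine ⟨fun r => ?_, hb.2⟩
    have hlt : l - (l - S.v .P) < 2 ^ b := by
      have := hb.1 (vr .P); rw [hP] at this; omega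
    simp only [State.setReg, Function.update_apply]
    split_ifs
    · positivity
    · exact hlt
    · exact hb.1 r

end Solver

/-! ### The result of the search -/

namespace Solver

open LoopLang LoopLang.Expr
open RAM (State Prog Runs Exec Bdd)

section

variable {I : RCPSP} {lam M h m : ℕ} {S : St}

/-- The number of entries of the queue, since these are pairwise inequivalent. -/
theorem Queue.le_count (hq : Queue I lam M h m S) :
    m ≤ 1 + I.numJobs * (2 * lam + 2) ^ I.width := by
  classical
  have hinj : ∀ p q, 0 < p → p < m → 0 < q → q < m →
      I.code (S.v .K) (entry I S p) = I.code (S.v .K) (entry I S q) → p = q := by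
    intro p q hp hpm hq0 hqm he
    rcases lt_trichotomy p q with hpq | hpq | hpq
    · exact absurd he (hq.inj p q hp hpq hqm)
    · exact hpq
    · exact absurd he.symm (hq.inj q p hq0 hpq hpm)
  have hcard : ((Finset.Ico 1 m).image (entry I S)).card = m - 1 := by
    rw [Finset.card_image_of_injOn, Nat.card_Ico]
    intro p hp q hq' he
    simp only [Finset.coe_Ico, Set.mem_Ico] at hp hq'
    exact hinj p q hp.1 hp.2 hq'.1 hq'.2 (by rw [he])
  have := RCPSP.card_le_of_inequivalent (lam := lam) ((Finset.Ico 1 m).image (entry I S)) ?_ ?_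
  · omega
  · intro f hf
    obtain ⟨q, hq', rfl⟩ := Finset.mem_image.1 hf
    rw [Finset.mem_Ico] at hq'
    exact ⟨RCPSP.valid_of_reach (hq.reach q hq'.2), hq.last q hq'.1 hq'.2⟩
  · intro f hf g hg he
    obtain ⟨p, hp, rfl⟩ := Finset.mem_image.1 hf
    obtain ⟨q, hq', rfl⟩ := Finset.mem_image.1 hg
    rw [Finset.mem_Ico] at hp hq'
    rw [hinj p q hp.1 hp.2 hq'.1 hq'.2 (he.code_eq _)]

/-- When the whole queue has been treated, every reachable partial schedule is equivalent to one of
its entries. -/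
theorem Inv.exists_entry (hS : Inv I lam M m m S) (hlam : lam ≤ ∑ i, I.proc i)
    (hK : 2 * ∑ i, I.proc i + 3 ≤ 2 ^ S.v .K) {g : Fin I.numJobs → ℕ}
    (hg : Relation.ReflTransGen (I.Succ lam) 0 g) : ∃ q < m, I.Equivalent (entry I S q) g := by
  have hE : ∀ f ∈ {f | ∃ q < m, entry I S q = f}, ∀ f', I.Succ lam f f' →
      ∃ e ∈ {f | ∃ q < m, entry I S q = f}, I.Equivalent e f' := by
    rintro f ⟨q, hq, rfl⟩ f' hs
    obtain ⟨p, -, hp, hc⟩ := (hS.queue.seen _).1 (hS.closed q hq f' hs)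
    have h1 := RCPSP.valid_of_reach (hS.queue.reach p hp)
    have h2 := (RCPSP.valid_of_reach (hS.queue.reach q hq)).succ hs
    exact ⟨_, ⟨p, hp, rfl⟩, RCPSP.equivalent_of_code_eq (fun k => h1.digit_lt hlam hK k)
      (fun k => h2.digit_lt hlam hK k) hc⟩
  obtain ⟨f, ⟨q, hq, rfl⟩, he⟩ :=
    RCPSP.exists_equivalent_of_closed (E := {f | ∃ q < m, entry I S q = f})
      ⟨0, hS.queue.pos, hS.queue.zero⟩ hE hg
  exact ⟨q, hq, he⟩

/-- When the whole queue has been treated, the best partial schedule found yields an optimal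
schedule. -/
theorem Inv.isOptimalWithLag (hS : Inv I (min lam (∑ i, I.proc i)) M m m S)
    (hK : 2 * ∑ i, I.proc i + 3 ≤ 2 ^ S.v .K) (hf : S.v .found ≠ 0) :
    ∃ f : Fin I.numJobs → ℕ, (∀ k : Fin I.numJobs, S.a .best k = f k) ∧
      I.IsOptimalWithLag lam (I.fill f) := by
  obtain ⟨q, hq, hc, -, hb, hmin⟩ := hS.best hf
  have hv := RCPSP.valid_of_reach (hS.queue.reach q hq)
  refine ⟨_, hb, ⟨RCPSP.fill_feasible hv hc, (RCPSP.lag_fill hv hc).trans (min_le_left _ _)⟩,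
    fun s hs hlag => ?_⟩
  obtain ⟨g, hg, hgc, hgs⟩ := RCPSP.exists_reach_of_feasible hs hlag
  obtain ⟨p, hp, he⟩ := hS.exists_entry (min_le_right _ _) hK hg
  rw [RCPSP.makespan_fill hv]
  exact ((hmin p hp (he.symm.complete hgc)).trans he.span_le).trans hgs

/-- If there is a feasible schedule of lag at most `lam`, the search finds a complete partial
schedule. -/
theorem Inv.found_ne_zero (hS : Inv I (min lam (∑ i, I.proc i)) M m m S)
    (hK : 2 * ∑ i, I.proc i + 3 ≤ 2 ^ S.v .K) {s : Fin I.numJobs → ℕ} (hs : I.Feasible s)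
    (hlag : I.lag s ≤ lam) : S.v .found ≠ 0 := by
  intro h0
  obtain ⟨g, hg, hgc, -⟩ := RCPSP.exists_reach_of_feasible hs hlag
  obtain ⟨p, hp, he⟩ := hS.exists_entry (min_le_right _ _) hK hg
  exact hS.not_complete h0 p hp (he.symm.complete hgc)

end

/-! ### The main loop -/

/-- The registers that are reset after every visit of an entry of the queue. This keeps the numbers
in the registers small. -/
def scratch : List ℕ := (visit.compile 0).writes.filter fun r => r ≠ 1 ∧ ∀ x ∈ live, r ≠ vr x

/-- One round of the main loop. -/
def body : Prog := .seq (visit.compile 0) (RAM.clear scratch)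

/-- The variables that keep their meaning only during the visit of an entry of the queue. -/
def temps : List Var :=
  [.clock, .span, .time, .ok, .power, .gap, .acc, .code, .prod, .i, .j, .k, .r, .c]

theorem mem_temps {x : Var} : x ∈ temps ↔ x ∉ live := by cases x <;> decide

section

variable {I : RCPSP} {lam M h m B μ C : ℕ} {S : St} {σ : State}

/-- A bound on the number of unit steps of one round of the main loop. -/
noncomputable def roundSteps : Polynomial ℕ := visit.cost + (scratch.length + 1 : ℕ)

theorem vr_notMem_scratch {x : Var} (hx : x ∈ live) : vr x ∉ scratch := by
  intro h
  have := (List.mem_filter.1 h).2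
  simp only [decide_eq_true_eq] at this
  exact this.2 x hx rfl

theorem one_notMem_scratch : 1 ∉ scratch := fun h => by
  simpa using (List.mem_filter.1 h).2

/-- One round of the main loop. The bound `2 ^ B` on all numbers is the same before and after it:
the numbers that live on are bounded by the invariant of the search or do not change, and all
registers with intermediate results are cleared. -/
theorem body_exec (hlam : lam ≤ ∑ i, I.proc i) (hM : 3 * ∑ i, I.proc i + 1 ≤ M)
    (hC : 1 + I.numJobs * (2 * lam + 2) ^ I.width ≤ C)
    (hB : C * I.numJobs < 2 ^ B ∧ C < 2 ^ B ∧ M < 2 ^ B) (hS : Inv I lam M h m S) (hhm : h < m)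
    (hμ : ∀ x ∈ [Var.N, .R, .K], S.v x ≤ μ) (hσ : Rep S σ) (hb : Bdd B σ) :
    ∃ S' τ t m', Exec body σ t τ ∧
      t ≤ roundSteps.eval μ * (1 + 2 * (B + roundSteps.eval μ)) ∧
      Inv I lam M (h + 1) m' S' ∧ S'.v .K = S.v .K ∧ (∀ x ∈ [Var.N, .R, .K], S'.v x ≤ μ) ∧
      S'.base = S.base ∧ Rep S' τ ∧ Bdd B τ := by
  obtain ⟨m', hS₁⟩ := visit_eval hlam hM hS hhm
  have hag := visit.agree S
  obtain ⟨σ₁, r₁, h₁, -, X₁⟩ := visit.compile_runs 0 (by decide) hμ hσ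
  obtain ⟨t, e, ht, hb'⟩ := (r₁.seq (RAM.clear_runs scratch σ₁)) B hb
  obtain ⟨t₁, e₁, -, -⟩ := r₁ B hb
  generalize visit.eval S = S₁ at *
  obtain ⟨S', hS'⟩ : ∃ S' : St, S' = ⟨S₁.base, fun x => if vr x ∈ scratch then 0 else S₁.v x,
    S₁.a, S₁.io⟩ := ⟨_, rfl⟩
  have hlive : ∀ x ∈ live, S'.v x = S₁.v x := fun x hx => by
    rw [hS']; exact if_neg (vr_notMem_scratch hx)
  have hag' : Agree temps [] false S₁ S' := by
    rw [hS']
    refine ⟨rfl, fun x hx => ?_, fun _ _ => rfl, fun _ => rfl⟩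
    rw [mem_temps, not_not] at hx
    exact if_neg (vr_notMem_scratch hx)
  have hI := hS₁.agree hag' fun x hx hx' => mem_temps.1 hx' hx
  have hrep : Rep S' ⟨fun r => if r ∈ scratch then 0 else σ₁.reg r, σ₁.mem⟩ := by
    rw [hS']
    refine ⟨h₁.pos, ?_, fun x => ?_, h₁.io, h₁.a⟩
    · dsimp only
      rw [if_neg one_notMem_scratch]
      exact h₁.base
    · dsimp only
      rw [h₁.v]
  refine ⟨S', _, t, m', e, ?_, hI, ?_, fun x hx => ?_, ?_, hrep, ?_⟩
  · rw [roundSteps, Polynomial.eval_add, Polynomial.eval_natCast]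
    exact ht
  · rw [hlive _ (by decide), hag.v _ (by decide)]
  · rw [hlive _ (by revert x; decide)]
    exact X₁ x hx
  · rw [hS', ← hag.base]
  -- the numbers do not grow
  have hm' := hI.queue.le_count.trans hC
  have hhead : (h + 1) ≤ C := by have := hI.queue.pending; omega
  have hmul : ∀ a ≤ C, a * I.numJobs < 2 ^ B := fun a ha =>
    (Nat.mul_le_mul_right _ ha).trans_lt hB.1
  have hfix : ∀ x ∈ [Var.N, .R, .K, .P, .lam, .offP, .offA, .offR], S₁.v x < 2 ^ B := fun x hx => by
    rw [hag.v x (by revert x; decide), ← hσ.v]; exact hb.1 _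
  have hvar : ∀ x ∈ live, S₁.v x < 2 ^ B := by
    intro x hx
    by_cases hx' : x ∈ [Var.N, .R, .K, .P, .lam, .offP, .offA, .offR]
    · exact hfix x hx'
    · rw [← hlive x hx]
      have : x ∈ [Var.found, .head, .tail, .pending, .best] := by
        revert x; decide
      simp only [List.mem_cons, List.not_mem_nil, or_false] at this
      rcases this with rfl | rfl | rfl | rfl | rfl
      · have := hI.found_le; omega
      · rw [hI.head]; exact hmul _ hhead
      · rw [hI.queue.tail]; exact hmul _ hm'
      · have := hI.queue.pending; omega
      · have := hI.best_le; omega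
  refine ⟨fun r => ?_, fun a ha => ?_⟩
  · dsimp only
    split_ifs with hr
    · positivity
    · by_cases hw : r ∈ (visit.compile 0).writes
      · by_cases hr1 : r = 1
        · rw [hr1, h₁.base, hag.base, ← hσ.base]; exact hb.1 1
        have : ∃ x ∈ live, r = vr x := by
          by_contra hcon
          push Not at hcon
          exact hr (List.mem_filter.2 ⟨hw, by simpa [hr1] using hcon⟩)
        obtain ⟨x, hx, rfl⟩ := this
        rw [h₁.v]
        exact hvar x hx
      · rw [e₁.reg_eq hw]; exact hb.1 r
  · dsimp only
    by_cases hab : a < S₁.base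
    · rw [h₁.io a hab, hag.io (by decide), ← hσ.io a (by rwa [← hag.base])]
      exact hb.2 a ha
    · obtain ⟨k, i, rfl⟩ : ∃ (k : Arr) (i : ℕ), a = S₁.base + 4 * i + k.ctorIdx := by
        have h4 : (a - S₁.base) % 4 < 4 := Nat.mod_lt _ (by norm_num)
        have hd := Nat.div_add_mod (a - S₁.base) 4
        generalize (a - S₁.base) % 4 = y at *
        have : ∃ k : Arr, k.ctorIdx = y := by
          interval_cases y
          exacts [⟨.es, rfl⟩, ⟨.queue, rfl⟩, ⟨.seen, rfl⟩, ⟨.best, rfl⟩]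
        obtain ⟨k, hk⟩ := this
        exact ⟨k, (a - S₁.base) / 4, by omega⟩
      have hSa : S'.a = S₁.a := by rw [hS']
      rw [h₁.a]
      cases k with
      | es =>
        rw [hag.a .es (by decide), ← hσ.a]
        exact hb.2 _ (by have := hσ.pos; omega)
      | queue => have := hI.queue.le i; rw [hSa] at this; omega
      | seen => have := hI.queue.seen_le i; rw [hSa] at this; omega
      | best => have := hI.arr_best_le i; rw [hSa] at this; omega

/-- The main loop, from the entry `h` on; there are at most `C` entries. -/
theorem search_exec (hlam : lam ≤ ∑ i, I.proc i) (hM : 3 * ∑ i, I.proc i + 1 ≤ M)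
    (hC : 1 + I.numJobs * (2 * lam + 2) ^ I.width ≤ C)
    (hB : C * I.numJobs < 2 ^ B ∧ C < 2 ^ B ∧ M < 2 ^ B) (d : ℕ) (hd : C ≤ h + d)
    (hS : Inv I lam M h m S) (hμ : ∀ x ∈ [Var.N, .R, .K], S.v x ≤ μ) (hσ : Rep S σ)
    (hb : Bdd B σ) :
    ∃ S' τ t m', Exec (.loop (vr .pending) body) σ t τ ∧
      t ≤ d * (1 + B + roundSteps.eval μ * (1 + 2 * (B + roundSteps.eval μ))) + 1 ∧
      Inv I lam M m' m' S' ∧ S'.v .K = S.v .K ∧ (∀ x ∈ [Var.N, .R, .K], S'.v x ≤ μ) ∧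
      S'.base = S.base ∧ Rep S' τ ∧ Bdd B τ := by
  induction d generalizing h m S σ with
  | zero =>
    have hp : S.v .pending = 0 := by
      have := hS.queue.le_count; have := hS.queue.pending; omega
    have hm : h = m := by have := hS.queue.pending; omega
    subst hm
    have h0 : σ.reg (vr .pending) = 0 := (hσ.v _).trans hp
    exact ⟨S, σ, _, h, Exec.loop_stop h0, by rw [h0]; simp, hS, rfl, hμ, rfl, hσ, hb⟩
  | succ d ih =>
    by_cases hp : S.v .pending = 0
    · have hm : h = m := by have := hS.queue.pending; omega
      subst hm
      have h0 : σ.reg (vr .pending) = 0 := (hσ.v _).trans hp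
      exact ⟨S, σ, _, h, Exec.loop_stop h0, by rw [h0]; simp, hS, rfl, hμ, rfl, hσ, hb⟩
    · obtain ⟨S₁, σ₁, t₁, m₁, e₁, ht₁, hI₁, hK₁, hμ₁, hbase₁, hσ₁, hb₁⟩ :=
        body_exec hlam hM hC hB hS (by have := hS.queue.pending; omega) hμ hσ hb
      obtain ⟨S₂, σ₂, t₂, m₂, e₂, ht₂, hI₂, hK₂, hμ₂, hbase₂, hσ₂, hb₂⟩ :=
        ih (by omega) hI₁ hμ₁ hσ₁ hb₁
      have h0 : σ.reg (vr .pending) ≠ 0 := by rw [hσ.v]; exact hp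
      refine ⟨S₂, σ₂, _, m₂, .loop_step h0 e₁ e₂, ?_, hI₂, hK₂.trans hK₁, hμ₂,
        hbase₂.trans hbase₁, hσ₂, hb₂⟩
      have := hb.size_reg (vr .pending)
      rw [Nat.succ_mul]
      omega

end

end Solver

/-! ### The whole program -/

namespace Solver

open LoopLang LoopLang.Expr
open RAM (State Prog Runs Exec Bdd)

/-- Everything that is computed before the search, except for the length of a digit. -/
def setup : Cmd := setOffsets ;; sumProc ;; relax ;; startBits

/-- The program for instances with at least one job. -/
def main : Prog :=
  .seq (.seq layout (.seq (setup.compile 0) (.loop (vr .gap) (nextBit.compile 0)))) <|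
  .seq cap <| .seq (startQueue.compile 0) <| .seq (.loop (vr .pending) body)
    ((finish ;; output).compile 0)

/-- The whole program. Without jobs, the empty schedule is optimal. The width is zero in this case,
so the bound on the running time does not depend on `lam`, and the memory cell `0`, which holds
`lam`, must not be read. -/
def program : Prog := .seq loadJobs (.ite (vr .N) main (.const (vr .found) 1))

/-- The state before the search for the length of a digit, in which the rest of the state is
unchanged. -/
theorem setup_eval (I : RCPSP) (lam : ℕ) :
    Agree setup.vars [.es] false (startState I lam) (setup.eval (startState I lam)) ∧
    Input I (setup.eval (startState I lam)) ∧
    (setup.eval (startState I lam)).v .P = ∑ i, I.proc i ∧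
    (∀ k : Fin I.numJobs, (setup.eval (startState I lam)).a .es k = I.earliest k) ∧
    (setup.eval (startState I lam)).v .power = 1 ∧
    (setup.eval (startState I lam)).v .gap = 2 * ∑ i, I.proc i + 2 := by
  refine ⟨(setup.agree _).mono (List.Subset.refl _) (by decide) (by decide), ?_⟩
  have i₁ := setOffsets_eval (S := startState I lam) (I := I) (by simp [startState])
    (by simp [startState]) (startState_inp I lam)
  have a₁ := setOffsets.agree (startState I lam)
  have P₁ := a₁.v .P (by decide)
  have e₁ := a₁.a .es (by decide)
  rw [setup, Cmd.eval, Cmd.eval, Cmd.eval]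
  generalize setOffsets.eval (startState I lam) = S₁ at *
  have P₂ := sumProc_eval i₁ (P₁.trans (by simp [startState]))
  have a₂ := sumProc.agree S₁
  have i₂ := i₁.agree a₂ (by decide)
  have e₂ := (a₂.a .es (by decide)).trans e₁
  generalize sumProc.eval S₁ = S₂ at *
  have e₃ := relax_eval i₂ fun k => by rw [e₂]; rfl
  have a₃ := relax.agree S₂
  have i₃ := i₂.agree a₃ (by decide)
  have P₃ := (a₃.v .P (by decide)).trans P₂
  generalize relax.eval S₂ = S₃ at *
  have a₄ := startBits.agree S₃
  refine ⟨i₃.agree a₄ (by decide), (a₄.v .P (by decide)).trans P₃, fun k => ?_, ?_, ?_⟩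
  · rw [a₄.a .es (by decide), e₃]
  · simp [startBits]
  · simp [startBits, P₃, two_mul]

/-- The invariant of the search holds at the beginning, with the empty partial schedule in the
queue. -/
theorem startQueue_eval {I : RCPSP} {L M : ℕ} {S : St} (h : Input I S) (hlam : S.v .lam = L)
    (hes : ∀ k : Fin I.numJobs, S.a .es k = I.earliest k)
    (hv : ∀ x ∈ [Var.found, .head, .best], S.v x = 0)
    (ha : ∀ k ∈ [Arr.queue, .seen, .best], ∀ i, S.a k i = 0) :
    Inv I L M 0 1 (startQueue.eval S) := by
  have hag := startQueue.agree S
  have hin := h.agree hag (by decide)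
  have hv' : ∀ x ∈ [Var.found, .head, .best], (startQueue.eval S).v x = 0 := fun x hx => by
    rw [hag.v x (by revert x; decide), hv x hx]
  have hA : (startQueue.eval S).a = S.a := rfl
  have ht : (startQueue.eval S).v .tail = 1 * I.numJobs := by simp [startQueue, h.N]
  have hp : (startQueue.eval S).v .pending = 1 := by simp [startQueue]
  have hl := (hag.v .lam (by decide)).trans hlam
  have h0 : entry I (startQueue.eval S) 0 = 0 := funext fun k => by
    rw [entry, hA, ha _ (by simp)]; rfl
  generalize startQueue.eval S = S' at *
  refine ⟨hin, hl, hA ▸ hes, ⟨one_pos, ht, hp, fun q hq => ?_, h0, fun q h1 h2 => ?_, fun c => ?_,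
    fun c => ?_, fun p q h1 h2 h3 => ?_, fun i => ?_⟩, ?_, fun q hq => ?_, ?_, fun _ q hq => ?_,
    fun hf => ?_, ?_, fun i => ?_⟩
  · obtain rfl : q = 0 := by omega
    rw [h0]
  · omega
  · rw [hA, ha _ (by simp)]; exact Nat.zero_le _
  · rw [hA, ha _ (by simp)]
    refine iff_of_false (by simp) ?_
    rintro ⟨q, h1, h2, -⟩
    omega
  · omega
  · rw [hA, ha _ (by simp)]; exact Nat.zero_le _
  · rw [hv' _ (by simp), Nat.zero_mul]
  · omega
  · rw [hv' _ (by simp)]; exact Nat.zero_le _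
  · omega
  · exact absurd (hv' _ (by simp)) hf
  · rw [hv' _ (by simp)]; exact Nat.zero_le _
  · rw [hA, ha _ (by simp)]; exact Nat.zero_le _

/-- A bound on the number of unit steps of the first part of the program. -/
noncomputable def firstSteps : Polynomial ℕ :=
  3 * Polynomial.X + 14 + setup.cost + (Polynomial.X + 2) * (nextBit.cost + 1) + 1

/-- The first part of the program: it determines the state in which the search starts, but for the
bound on the lag. -/
theorem first_runs (I : RCPSP) (lam : ℕ) :
    ∃ τ S, Runs (.seq layout (.seq (setup.compile 0) (.loop (vr .gap) (nextBit.compile 0))))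
      (((RAM.initial (lam :: I.encode)).setReg (tr 0) 1).setReg (vr .N) I.numJobs)
      (firstSteps.eval I.size) τ ∧ Rep S τ ∧ S.base = 4 * 2 ^ (I.numJobs + I.numRes) ∧
      S.io 0 = lam ∧ Input I S ∧ S.v .P = ∑ i, I.proc i ∧
      (∀ k : Fin I.numJobs, S.a .es k = I.earliest k) ∧
      (∀ x ∈ [Var.found, .head, .best], S.v x = 0) ∧
      (∀ k ∈ [Arr.queue, .seen, .best], ∀ i, S.a k i = 0) ∧
      2 * ∑ i, I.proc i + 3 ≤ 2 ^ S.v .K ∧ S.v .K ≤ I.size + 2 := by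
  obtain ⟨σ₁, r₁, h₁⟩ := layout_runs I lam
  have hsize := I.numJobs_add_numRes_le_size
  obtain ⟨σ₂, r₂, h₂, -, -⟩ := setup.compile_runs 0 (X := [.N, .R]) (m := I.size) (by decide)
    (S := startState I lam) (by simp [startState]; omega) h₁
  obtain ⟨a₁, i₁, P₁, es₁, pow₁, gap₁⟩ := setup_eval I lam
  have K₁ : (setup.eval (startState I lam)).v .K = 0 := a₁.v .K (by decide)
  generalize setup.eval (startState I lam) = S₁ at *
  obtain ⟨n, hn⟩ : ∃ n, n = Nat.clog 2 (2 * ∑ i, I.proc i + 3) := ⟨_, rfl⟩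
  have hit := iterate_nextBit K₁ pow₁ (by rw [gap₁, P₁])
  have hle : 2 * ∑ i, I.proc i + 3 ≤ 2 ^ n := by rw [hn]; exact Nat.le_pow_clog one_lt_two _
  have hlt : ∀ i < n, 2 ^ i < 2 * ∑ i, I.proc i + 3 := fun i hi =>
    (Nat.lt_clog_iff_pow_lt one_lt_two).1 (hn ▸ hi)
  have hn2 : n ≤ I.size + 2 := by
    rw [hn, Nat.clog_le_iff_le_pow one_lt_two]
    have := I.sum_proc_lt
    rw [pow_add]
    omega
  obtain ⟨σ₃, r₃, h₃⟩ := while_runs nextBit .gap (m := I.size) (by decide) n h₂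
    (fun i hi => by rw [(hit i).2.2.2, P₁]; have := hlt i hi; omega)
    (by rw [(hit n).2.2.2, P₁]; omega)
  obtain ⟨a₂, K₂, -, -⟩ := hit n
  generalize nextBit.eval^[n] S₁ = S₂ at *
  refine ⟨σ₃, S₂, (r₁.seq (r₂.seq r₃)).mono ?_, h₃, ?_, ?_, i₁.agree a₂ (by decide), ?_,
    fun k => ?_, fun x hx => ?_, fun k hk i => ?_, ?_, ?_⟩
  · have : n * (nextBit.cost.eval I.size + 1) ≤ (I.size + 2) * (nextBit.cost.eval I.size + 1) :=
      Nat.mul_le_mul_right _ hn2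
    simp only [firstSteps, Polynomial.eval_add, Polynomial.eval_mul, Polynomial.eval_X,
      Polynomial.eval_ofNat, Polynomial.eval_one]
    omega
  · rw [a₂.base, a₁.base]; rfl
  · rw [a₂.io rfl, a₁.io rfl]; rfl
  · rw [a₂.v _ (by decide), P₁]
  · rw [a₂.a _ (by simp), es₁]
  · rw [a₂.v _ (by revert x; decide), a₁.v _ (by revert x; decide)]
    revert x
    simp [startState]
  · rw [a₂.a _ (by simp), a₁.a _ (by revert k; decide)]; rfl
  · rw [K₂]; exact hle
  · rw [K₂]; exact hn2

end Solver

namespace Solver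

open LoopLang LoopLang.Expr
open RAM (State Prog Runs Exec Bdd)

/-! ### Running time and correctness -/

theorem width_le_numJobs (I : RCPSP) : I.width ≤ I.numJobs := by
  classical
  refine Finset.sup_le fun A _ => ?_
  simpa using Finset.card_le_univ A

/-- A bound on the number of entries of the queue. -/
noncomputable def maxEntries (I : RCPSP) (L : ℕ) : ℕ :=
  1 + I.numJobs * (2 * L + 2) ^ I.width

theorem maxEntries_le (I : RCPSP) {L : ℕ} (hL : L ≤ ∑ i, I.proc i) :
    maxEntries I L ≤ 2 ^ (I.size * I.size + 2 * I.size) := by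
  have hP := I.sum_proc_lt
  have hN := I.numJobs_add_numRes_le_size
  have hw := width_le_numJobs I
  generalize I.size = n at *
  have h1 : (2 * L + 2) ^ I.width ≤ 2 ^ ((n + 1) * n) :=
    calc (2 * L + 2) ^ I.width ≤ (2 ^ (n + 1)) ^ I.width :=
          Nat.pow_le_pow_left (by rw [pow_succ]; omega) _
      _ ≤ (2 ^ (n + 1)) ^ n := Nat.pow_le_pow_right (by positivity) (by omega)
      _ = 2 ^ ((n + 1) * n) := (pow_mul _ _ _).symm
  have h2 : 0 < (2 * L + 2) ^ I.width := by positivity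
  have h3 : n < 2 ^ n := Nat.lt_two_pow_self
  calc maxEntries I L ≤ (1 + I.numJobs) * (2 * L + 2) ^ I.width := by
        rw [maxEntries, add_mul]; omega
    _ ≤ 2 ^ n * 2 ^ ((n + 1) * n) := Nat.mul_le_mul (by omega) h1
    _ = 2 ^ (n * n + 2 * n) := by rw [← pow_add]; congr 1; ring

theorem maxEntries_mul_lt (I : RCPSP) {L : ℕ} (hL : L ≤ ∑ i, I.proc i) :
    maxEntries I L * I.numJobs < 2 ^ (I.size * I.size + 3 * I.size) := by
  have hN := I.numJobs_add_numRes_le_size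
  have h3 : I.size < 2 ^ I.size := Nat.lt_two_pow_self
  calc maxEntries I L * I.numJobs < 2 ^ (I.size * I.size + 2 * I.size) * 2 ^ I.size :=
        Nat.mul_lt_mul_of_le_of_lt (maxEntries_le I hL) (by omega) (by positivity)
    _ = 2 ^ (I.size * I.size + 3 * I.size) := by rw [← pow_add]; congr 1; ring

/-- The number of bits of the numbers after the first part of the program. -/
noncomputable def firstBits : Polynomial ℕ := Polynomial.X + 3 + firstSteps

/-- The number of bits of the numbers in the main loop. -/
noncomputable def searchBits : Polynomial ℕ :=
  firstBits + startQueue.cost + (Polynomial.X * Polynomial.X + 3 * Polynomial.X + 4)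

/-- The cost of one round of the main loop. -/
noncomputable def roundCost : Polynomial ℕ :=
  roundSteps.comp (Polynomial.X + 2) *
    (1 + 2 * (searchBits + roundSteps.comp (Polynomial.X + 2)))

/-- The cost of the last part of the program. -/
noncomputable def lastCost : Polynomial ℕ :=
  (finish ;; output).cost.comp (Polynomial.X + 2) *
    (1 + 2 * (searchBits + (finish ;; output).cost.comp (Polynomial.X + 2)))

/-- The cost of the program without the main loop, but for the size of the bound on the lag. -/
noncomputable def fixedCost : Polynomial ℕ :=
  3 * (1 + 2 * (Polynomial.X + 3)) + (1 + (Polynomial.X + 3)) +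
    firstSteps * (1 + 2 * (Polynomial.X + 3 + firstSteps)) + (5 + firstBits) +
    startQueue.cost * (1 + 2 * (firstBits + startQueue.cost)) + 1 + lastCost

/-- The polynomial in the bound on the running time. -/
noncomputable def totalCost : Polynomial ℕ :=
  fixedCost + 4 + (Polynomial.X + 1) * (1 + searchBits + roundCost)

theorem output_of_found_eq_zero {S : St} {τ : State} (h : Rep S τ) (h0 : S.v .found = 0) (n : ℕ) :
    τ.output n = none := if_pos ((h.v .found).trans h0)

/-- The program for instances with at least one job, started after the number of jobs has been
loaded, which has cost at most `3 * (1 + 2 * (I.size + 3))`; a test of this number follows. -/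
theorem main_exec (I : RCPSP) (lam : ℕ) {b : ℕ} (hb : b = I.size + 3)
    (hb' : Bdd b (((RAM.initial (lam :: I.encode)).setReg (tr 0) 1).setReg (vr .N) I.numJobs)) :
    ∃ τ t, Exec main
        (((RAM.initial (lam :: I.encode)).setReg (tr 0) 1).setReg (vr .N) I.numJobs) t τ ∧
      t + (3 * (1 + 2 * (I.size + 3)) + (1 + (I.size + 3))) ≤ fixedCost.eval I.size +
        4 * Nat.size lam + maxEntries I (min lam (∑ i, I.proc i)) *
          (1 + searchBits.eval I.size + roundCost.eval I.size) ∧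
      (∀ s, τ.output I.numJobs = some s → I.IsOptimalWithLag lam s) ∧
      ((∃ s, I.Feasible s ∧ I.lag s ≤ lam) → τ.output I.numJobs ≠ none) := by
  obtain ⟨L, hL⟩ : ∃ L, L = min lam (∑ i, I.proc i) := ⟨_, rfl⟩
  have hLP : L ≤ ∑ i, I.proc i := hL ▸ min_le_right _ _
  have hNR := I.numJobs_add_numRes_le_size
  -- preparations
  obtain ⟨σ₁, S₁, r₁, h₁, base₁, io₁, i₁, P₁, es₁, v₁, a₁, K₁, K₁'⟩ := first_runs I lam
  obtain ⟨t₁, e₁, ht₁, b₁⟩ := r₁ _ hb'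
  rw [hb] at ht₁ b₁
  have hfb : I.size + 3 + firstSteps.eval I.size = firstBits.eval I.size := by
    simp [firstBits]
  rw [hfb] at ht₁ b₁
  obtain ⟨σ₂, t₂, e₂, ht₂, h₂, b₂⟩ := cap_exec h₁ b₁
  rw [io₁] at ht₂
  rw [io₁, P₁, ← hL] at h₂
  have ag₂ : Agree [.lam] [] false S₁ (S₁.setv .lam L) := Agree.setv L (by simp)
  have i₂ := i₁.agree ag₂ (by decide)
  have v₂ : ∀ x ∈ [Var.found, .head, .best], (S₁.setv .lam L).v x = 0 := fun x hx => by
    rw [ag₂.v x (by revert x; decide), v₁ x hx]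
  have K₂ := ag₂.v .K (by decide)
  have l₂ : (S₁.setv .lam L).v .lam = L := by simp
  have A₂ : (S₁.setv .lam L).a = S₁.a := rfl
  have base₂ := ag₂.base
  rw [← A₂] at a₁ es₁
  generalize S₁.setv .lam L = S₂ at *
  have I₃ := startQueue_eval (M := 3 * ∑ i, I.proc i + 1) i₂ l₂ es₁ v₂ a₁
  obtain ⟨σ₃, r₃, h₃, -, -⟩ := startQueue.compile_runs 0 (X := []) (m := I.size) (by decide)
    (by simp) h₂
  obtain ⟨t₃, e₃, ht₃, b₃⟩ := r₃ _ b₂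
  have ag₃ := startQueue.agree S₂
  have K₃ := (ag₃.v .K (by decide)).trans K₂
  have base₃ := (ag₃.base.trans base₂).trans base₁
  generalize startQueue.eval S₂ = S₃ at *
  -- the main loop
  have hμ : ∀ x ∈ [Var.N, .R, .K], S₃.v x ≤ I.size + 2 := by
    intro x hx
    simp only [List.mem_cons, List.not_mem_nil, or_false] at hx
    rcases hx with rfl | rfl | rfl
    · rw [I₃.N]; omega
    · rw [I₃.R]; omega
    · rw [K₃]; exact K₁'
  have hsb : searchBits.eval I.size = firstBits.eval I.size + startQueue.cost.eval I.size +
      (I.size * I.size + 3 * I.size + 4) := by simp [searchBits]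
  have b₃' : Bdd (searchBits.eval I.size) σ₃ := b₃.mono (by omega)
  have hB : maxEntries I L * I.numJobs < 2 ^ searchBits.eval I.size ∧
      maxEntries I L < 2 ^ searchBits.eval I.size ∧
      3 * ∑ i, I.proc i + 1 < 2 ^ searchBits.eval I.size := by
    refine ⟨(maxEntries_mul_lt I hLP).trans_le (Nat.pow_le_pow_right two_pos (by omega)),
      (maxEntries_le I hLP).trans_lt (Nat.pow_lt_pow_right one_lt_two (by omega)), ?_⟩
    have h4 : 2 ^ (I.size + 2) ≤ 2 ^ searchBits.eval I.size :=
      Nat.pow_le_pow_right two_pos (by omega)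
    have := I.sum_proc_lt
    rw [pow_add] at h4
    omega
  obtain ⟨S₄, σ₄, t₄, m, e₄, ht₄, I₄, K₄, hμ₄, base₄, h₄, b₄⟩ := search_exec (C := maxEntries I L)
    hLP le_rfl le_rfl hB (maxEntries I L) (by omega) I₃ hμ h₃ b₃'
  have K₄' : 2 * ∑ i, I.proc i + 3 ≤ 2 ^ S₄.v .K := by rw [K₄, K₃]; exact K₁
  -- the output
  obtain ⟨σ₅, r₅, h₅, -, -⟩ := (finish ;; output).compile_runs 0 (X := [.N]) (m := I.size + 2)
    (by decide) (fun x hx => hμ₄ x (by revert x; decide)) h₄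
  obtain ⟨t₅, e₅, ht₅, b₅⟩ := r₅ _ b₄
  refine ⟨σ₅, _, e₁.seq (e₂.seq (e₃.seq (e₄.seq e₅))), ?_, ?_⟩
  · rw [← hL]
    simp only [fixedCost, lastCost, roundCost, Polynomial.eval_add, Polynomial.eval_mul,
      Polynomial.eval_X, Polynomial.eval_ofNat, Polynomial.eval_one, Polynomial.eval_comp, hfb]
    omega
  have hN : I.numJobs ≤ ((finish ;; output).eval S₄).base := by
    rw [((finish ;; output).agree S₄).base, base₄, base₃]
    have : I.numJobs + I.numRes < 2 ^ (I.numJobs + I.numRes) := Nat.lt_two_pow_self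
    omega
  have hfound : ((finish ;; output).eval S₄).v .found = S₄.v .found :=
    ((finish ;; output).agree S₄).v .found (by decide)
  rw [hL] at I₄
  refine ⟨fun s hs => ?_, ?_⟩
  · have hf : S₄.v .found ≠ 0 := fun h0 => by
      rw [output_of_found_eq_zero h₅ (hfound.trans h0)] at hs
      exact absurd hs (by simp)
    obtain ⟨f, hf', hopt⟩ := I₄.isOptimalWithLag K₄' hf
    have h0 : σ₅.reg (vr .found) ≠ 0 := by rwa [h₅.v, hfound]
    have : s = I.fill f := by
      rw [State.output, if_neg (show σ₅.reg 0 ≠ 0 from h0)] at hs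
      funext j
      have agf := finish.agree S₄
      have bf : (finish.eval S₄).base = ((finish ;; output).eval S₄).base :=
        agf.base.trans ((finish ;; output).agree S₄).base.symm
      rw [← Option.some.inj hs]
      change σ₅.mem j = _
      rw [h₅.io j (j.2.trans_le hN), Cmd.eval,
        output_eval ((agf.v .N (by decide)).trans I₄.N) (by rw [bf]; exact hN),
        finish_eval I₄.toInput hf']
    rw [this]
    exact hopt
  · rintro ⟨s, hs, hlag⟩ h0
    have hf := I₄.found_ne_zero K₄' hs hlag
    rw [State.output, if_neg] at h0
    · exact absurd h0 (by simp)
    · change σ₅.reg (vr .found) ≠ 0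
      rwa [h₅.v, hfound]

theorem isOptimalWithLag_of_numJobs_eq_zero {I : RCPSP} (h : I.numJobs = 0) (lam : ℕ)
    (s : Fin I.numJobs → ℕ) : I.IsOptimalWithLag lam s := by
  have : IsEmpty (Fin I.numJobs) := by rw [h]; infer_instance
  refine ⟨⟨⟨fun i => isEmptyElim i, fun t ρ => ?_⟩, ?_⟩, fun s' _ _ => ?_⟩
  · simp [Finset.eq_empty_of_isEmpty]
  · simp [RCPSP.lag]
  · simp [RCPSP.makespan]

theorem program_exec (I : RCPSP) (lam : ℕ) :
    ∃ t τ, Exec program (RAM.initial (lam :: I.encode)) t τ ∧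
      t ≤ (2 * lam + 1) ^ I.width * 2 ^ I.width * totalCost.eval I.size ∧
      (∀ s, τ.output I.numJobs = some s → I.IsOptimalWithLag lam s) ∧
      ((∃ s, I.Feasible s ∧ I.lag s ≤ lam) → τ.output I.numJobs ≠ none) := by
  obtain ⟨t₀, e₀, ht₀, b₀⟩ := loadJobs_runs I lam _ (bdd_initial I lam)
  have hN : (((RAM.initial (lam :: I.encode)).setReg (tr 0) 1).setReg (vr .N) I.numJobs).reg
      (vr .N) = I.numJobs := setReg_reg_self _ _ _
  have hs := b₀.size_reg (vr .N)
  rw [hN] at hs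
  have hpos : 0 < (2 * lam + 1) ^ I.width * 2 ^ I.width := by positivity
  rcases Nat.eq_zero_or_pos I.numJobs with h0 | h0
  · refine ⟨_, _, e₀.seq (Exec.ite_false (hN.trans h0) (Exec.const _ _ _)), ?_,
      fun s _ => isOptimalWithLag_of_numJobs_eq_zero h0 lam s, fun _ => ?_⟩
    · refine le_trans ?_ (Nat.le_mul_of_pos_left _ hpos)
      rw [hN, h0]
      simp only [totalCost, fixedCost, Polynomial.eval_add, Polynomial.eval_mul, Polynomial.eval_X,
        Polynomial.eval_ofNat, Polynomial.eval_one, Nat.size_zero, Nat.size_one]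
      omega
    · rw [State.output, if_neg]
      · simp
      · change (State.setReg _ (vr .found) 1).reg (vr .found) ≠ 0
        simp
  · obtain ⟨τ, t, e, ht, h1, h2⟩ := main_exec I lam rfl b₀
    refine ⟨_, τ, e₀.seq (Exec.ite_true (by rw [hN]; omega) e), ?_, h1, h2⟩
    rw [hN]
    have hw := I.width_pos h0
    obtain ⟨A, hA⟩ : ∃ A, A = (2 * lam + 1) ^ I.width * 2 ^ I.width := ⟨_, rfl⟩
    rw [← hA] at hpos ⊢
    have hA1 : lam ≤ A := by
      have h3 : 2 * lam + 1 ≤ (2 * lam + 1) ^ I.width := Nat.le_self_pow hw.ne' _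
      have h4 : (2 * lam + 1) ^ I.width ≤ A := hA ▸ Nat.le_mul_of_pos_right _ (by positivity)
      omega
    have hA2 : Nat.size lam ≤ A := (Nat.size_le.2 Nat.lt_two_pow_self).trans hA1
    have hA3 : (2 * min lam (∑ i, I.proc i) + 2) ^ I.width ≤ A := by
      rw [hA, ← mul_pow]
      exact Nat.pow_le_pow_left (by have := min_le_left lam (∑ i, I.proc i); omega) _
    have hA4 : maxEntries I (min lam (∑ i, I.proc i)) ≤ A * (I.size + 1) := by
      have := Nat.mul_le_mul (I.numJobs_add_numRes_le_size) hA3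
      have h5 : I.numJobs * (2 * min lam (∑ i, I.proc i) + 2) ^ I.width ≤ I.size * A :=
        Nat.mul_le_mul (by have := I.numJobs_add_numRes_le_size; omega) hA3
      rw [maxEntries, mul_add, mul_comm A]
      omega
    have h6 := Nat.mul_le_mul_right (1 + searchBits.eval I.size + roundCost.eval I.size) hA4
    have h7 : fixedCost.eval I.size ≤ A * fixedCost.eval I.size := Nat.le_mul_of_pos_left _ hpos
    simp only [totalCost, Polynomial.eval_add, Polynomial.eval_mul, Polynomial.eval_X,
      Polynomial.eval_ofNat, Polynomial.eval_one]
    rw [mul_add, mul_add, ← mul_assoc]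
    omega

end Solver

theorem mainTheorem3 :
    ∃ (prog : RAM.Prog) (poly : Polynomial ℕ), ∀ (I : RCPSP) (lam : ℕ),
      ∃ (t : ℕ) (final : RAM.State),
        RAM.Exec prog (RAM.initial (lam :: I.encode)) t final ∧
        t ≤ (2 * lam + 1) ^ I.width * 2 ^ I.width * poly.eval I.size ∧
        (∀ s, final.output I.numJobs = some s → I.IsOptimalWithLag lam s) ∧
        (final.output I.numJobs = none ↔ ¬ ∃ s, I.Feasible s ∧ I.lag s ≤ lam) ∧
        ((∃ s, I.IsOptimal s ∧ I.lag s ≤ lam) →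
          ∃ s, final.output I.numJobs = some s ∧ I.IsOptimal s ∧ I.lag s ≤ lam) := by
  refine ⟨Solver.program, Solver.totalCost, fun I lam => ?_⟩
  obtain ⟨t, τ, e, ht, h1, h2⟩ := Solver.program_exec I lam
  refine ⟨t, τ, e, ht, h1, ⟨fun h hs => h2 hs h, fun h => ?_⟩, ?_⟩
  · by_contra hne
    obtain ⟨s, hs⟩ := Option.ne_none_iff_exists'.1 hne
    exact h ⟨s, (h1 s hs).1⟩
  · rintro ⟨s', ⟨hs', hmin⟩, hlag⟩
    obtain ⟨s, hs⟩ := Option.ne_none_iff_exists'.1 (h2 ⟨s', hs', hlag⟩)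
    obtain ⟨⟨hf, hl⟩, hopt⟩ := h1 s hs
    exact ⟨s, hs, ⟨hf, fun r hr => (hopt s' hs' hlag).trans (hmin r hr)⟩, hl⟩
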